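/- Let $k$ be an algebraically closed field with a fixed total order on the set $k$ (used only to normalize Weyr matrices). **Matrix bimodule problems.** A (trivial) *matrix bimodule problem* $\mathfrak A=(R,\mathcal K,\mathcal M,H)$ consists of an index set $T=\{1,\dots,t\}$ with an equivalence relation, whose set of classes (*vertices*) is $\mathcal T$ ($R=k^{\mathcal T}$; write $E_X=\sum_{i\in X}e_{ii}$, $\mathcal K_0=\langle E_X\mid X\in\mathcal T\rangle$); a space $\mathcal K_1$ of strictly upper triangular $t\times t$ matrices over $k$, closed under products and under $V\mapsto E_XVE_Y$; a space $\mathcal M_1$ of $t\times t$ matrices; and a matrix $H=\sum_X E_XHE_X$ such that $\mathcal K_1\mathcal M_1\subseteq\mathcal M_1$, $\mathcal M_1\mathcal K_1\subseteq\mathcal M_1$ and $VH-HV\in\mathcal M_1$ for $V\in\mathcal K_1$. Positions are ordered from the lowest row upwards and in each row from left to right. $\mathcal M_1$ has a normalized basis $\mathcal A=\{A_1,A_2,\dots\}$ (the *base matrices*): each $A_l$ lies in $E_X\mathcal M_1E_Y$ for some $X,Y$, has entry $1$ at its leading (first non-zero) position, and the other $A_{l'}$ are $0$ there. The members of $\mathcal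 A$ correspond to the *solid arrows* $a_l:X\to Y$, and a basis of $\mathcal K_1$ that consists of matrices in the spaces $E_X\mathcal K_1E_Y$ (a *quasi-basis*) has as its dual basis the *dotted arrows*. $a_1$ is the solid arrow with the smallest leading position $(p,q)$; $\delta(a_1)$ is the functional $V\mapsto (VH-HV)_{pq}$ on $\mathcal K_1$. $\mathfrak A$ is *local* if $|\mathcal T|=1$. $\mathfrak A$ is *bipartite* if $H=0$ and $\mathcal T=\mathcal T'\,\dot\cup\,\mathcal T''$ with $\mathcal T',\mathcal T''\ne\emptyset$, such that $\mathcal K_1$ is supported on $(\mathcal T'\times\mathcal T')\cup(\mathcal T''\times\mathcal T'')$ and $\mathcal M_1$ on $\mathcal T'\times\mathcal T''$. It satisfies *RDCC* if the row indices of the leading positions of the base matrices are pairwise different and the column index of each leading position is the largest index in its vertex. **Reductions** (of the first arrow $a_1:X\to Y$). * *Regularization*, if $\delta(a_1)\neq0$: $\mathcal K_1'=\ker\delta(a_1)$, $\mathcal M_1'=\{B\in\mathcal M_1\mid B_{pq}=0\}$; $T,\mathcal T,H$ are unchanged. * If $\delta(a_1)=0$: $a_1\mapsto G$ for a matrix $G$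 with labelled rows and columns. Each index in $X$ (resp. $Y$) is replaced by a group of consecutive indices labelled by the rows (resp. columns) of $G$; other indices are kept. In an *edge reduction* ($X\ne Y$), $G$ is one of $(0)$, $(1)$, $(0\ 1)$, $\binom10$, $\begin{pmatrix}0&1\\0&0\end{pmatrix}$; the row and the column of the entry $1$ (if any) carry one common label, that is, they belong to one new vertex, and each other row or column carries a label of its own and gives a new vertex of its own. In a *loop reduction* ($X=Y$), $G$ is a Weyr matrix similar to $\bigoplus_{(\lambda,j)\in S}J_j(\lambda)1_{Z_{(\lambda,j)}}$ with $S\subset k\times\mathbb N_{\ge1}$ finite and non-empty: its rows and columns are labelled $(\lambda,j,r)$, $1\le r\le j$, ordered by $\lambda$, then by $r$, then by decreasing $j$, with entry $\lambda$ at equal labels and $1$ at $\big((\lambda,j,r),(\lambda,j,r+1)\big)$; the new vertices are the $Z_{(\lambda,j)}$. In both cases the other vertices are kept; $\mathcal K_1'$ is spanned by the block diagonal matrices $\bigoplus_W F_W*E_W$, where the $F_W$ ($W\in\mathcal T$) are strictly upper triangular matrices over the labels of $W$ with $F_XG=GF_Y$, and the matrices obtained from some $V\in\mathcal K_1$ by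 placing $V_{ij}$, for all $i,j$, at the label pair $(a,b)$ of the block $(i,j)$, for fixed labels $a,b$; $\mathcal M_1'$ is spanned by the matrices obtained in this last way from those $B\in\mathcal M_1$ with $B_{pq}=0$; and $H'=\sum_W I_W*H_W+G*A_1$. If $\mathfrak A'$ is obtained from $\mathfrak A$ by successive reductions, its indices are grouped in blocks over $T$, the number of indices in the block $i$ depends only on the vertex of $i$, and $H'$, partitioned in this way, is a representation $\vartheta(H'(k))=H_{\underline m}(k)+\sum_l P(a_l)*A_l$ of $\mathfrak A$ (that is, a size vector $\underline m$ over $\mathcal T$ and a matrix $P(a_l)$ for each solid arrow). **Theorem.** Let $\mathfrak A=(R,\mathcal K,\mathcal M,H=0)$ be a bipartite matrix bimodule problem satisfying RDCC, and let $$\mathfrak A=\mathfrak A^0,\ \mathfrak A^1,\ \dots,\ \mathfrak A^s\qquad(\ast)$$ be a sequence of reductions, each of the above kinds, with $\mathfrak A^s$ local. Put $M=\vartheta^{0s}(H^s(k))=\sum_l M_l*A_l$. Let $Z\in\mathcal T''$, and let the *bordered matrix* $\widetilde M=\sum_l\widetilde M_l*A_l$ be the representation of $\mathfrak A$ whose size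 vector is that of $M$ increased by $1$ at $Z$, with $\widetilde M_l=(0\ M_l)$ (a zero column added on the left) if $a_l$ ends in $Z$, and $\widetilde M_l=M_l$ otherwise. 1. There is a unique sequence of problems, partitioned over $T$, $$\mathfrak A=\widetilde{\mathfrak A}^0,\ \widetilde{\mathfrak A}^1,\ \dots,\ \widetilde{\mathfrak A}^s\qquad(\widetilde\ast)$$ that is *based on* (*parallel to*) $(\ast)$ with respect to $Z$, in the following sense: * $\widetilde{\mathfrak A}^{i+1}$ arises from $\widetilde{\mathfrak A}^i$ by one reduction or by a composition of two reductions; * for each $i$, either $\widetilde{\mathfrak A}^i=\mathfrak A^i$, or $\widetilde{\mathfrak A}^i$ is a bordering of $\mathfrak A^i$: its index set is that of $\mathfrak A^i$ with one index added in front of each block in $Z$, and the added indices form one new vertex $Y$; apart from $Y$, the vertices, the matrix $H$ and the leading positions of the solid arrows are those of $\mathfrak A^i$; the columns of $\widetilde H^i$ in $Y$ are zero; in a column of $Y$ there is the leading position of a solid arrow exactly in those rows in which $\mathfrak A^i$ has one in the first column of the same block; and there is none in the rows of $Y$; * $\widetilde\vartheta^{0s}(\widetilde H^s(k))=\widetilde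 M$. 2. $\widetilde{\mathfrak A}^s$ has exactly two vertices. 3. For each $0\le i\le s$, all diagonal blocks over indices in $Z$ of a matrix in $\widetilde{\mathcal K}^i_0\oplus\widetilde{\mathcal K}^i_1$ coincide and are upper triangular, $$\begin{pmatrix}s_{00}&s_{01}&\cdots&s_{0m}\\&s_{11}&\cdots&s_{1m}\\&&\ddots&\vdots\\&&&s_{mm}\end{pmatrix},$$ and the entries $s_{01},\dots,s_{0m}$ of the first row are pairwise different dotted arrows of $\widetilde{\mathfrak A}^i$: as functionals on $\widetilde{\mathcal K}^i_1$ they are distinct members of the dual basis of some quasi-basis of $\widetilde{\mathcal K}^i_1$. -/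

import Mathlib

open Matrix

noncomputable section

/-- The order on matrix positions: `(i, j) ≼ (i', j')` iff `i > i'`, or `i = i'` and `j ≤ j'`
(the lowest row comes first, and each row is read from left to right). -/
def PosLE {t : ℕ} (x y : Fin t × Fin t) : Prop :=
  y.1 < x.1 ∨ (x.1 = y.1 ∧ x.2 ≤ y.2)

/-- `x` is the leading position of the matrix `U`. -/
def IsLeadingPos {k : Type*} [Field k] {t : ℕ} (U : Matrix (Fin t) (Fin t) k)
    (x : Fin t × Fin t) : Prop :=
  U x.1 x.2 ≠ 0 ∧ ∀ i j, U i j ≠ 0 → PosLE x (i, j)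

open Classical in
/-- `E_X U E_Y`, where `X`, `Y` are the vertices (equivalence classes) of `x`, `y`. -/
def corner {k : Type*} [Field k] {t : ℕ} (s : Setoid (Fin t)) (x y : Fin t)
    (U : Matrix (Fin t) (Fin t) k) : Matrix (Fin t) (Fin t) k :=
  Matrix.of fun i j => if s.r i x ∧ s.r j y then U i j else 0

/-- A matrix bimodule problem `(R, 𝒦, ℳ, H)` all of whose vertices are trivial.
The index set is `T = Fin t`, the vertices are the classes of `vert`, and `R = k^𝒯`.
Since every `R_X` is `k`, all `R_X ⊗ R_Y ⊗ ⋯` are `k` too and the quasi-free bimodules `𝒦₁`, `ℳ₁`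
are spaces of matrices over `k` that are stable under `U ↦ E_X U E_Y`.
The normalized quasi-basis `𝒜` of `ℳ₁` is indexed by the leading positions of its members. -/
structure MatrixBimoduleProblem (k : Type*) [Field k] where
  t : ℕ
  vert : Setoid (Fin t)
  /-- The space `𝒦₁`. -/
  K1 : Submodule k (Matrix (Fin t) (Fin t) k)
  leads : Finset (Fin t × Fin t)
  /-- The normalized quasi-basis `𝒜` of `ℳ₁`. -/
  A : leads → Matrix (Fin t) (Fin t) k
  H : Matrix (Fin t) (Fin t) k
  K1_upper : ∀ V ∈ K1, ∀ i j, j ≤ i → V i j = 0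
  K1_corner : ∀ V ∈ K1, ∀ x y, corner vert x y V ∈ K1
  K1_mul : ∀ V ∈ K1, ∀ W ∈ K1, V * W ∈ K1
  A_lead : ∀ l : leads, IsLeadingPos (A l) l.1
  A_one : ∀ l : leads, A l l.1.1 l.1.2 = 1
  A_zero : ∀ l l' : leads, l ≠ l' → A l' l.1.1 l.1.2 = 0
  A_corner : ∀ l : leads, corner vert l.1.1 l.1.2 (A l) = A l
  K1_mul_A : ∀ V ∈ K1, ∀ l : leads, V * A l ∈ Submodule.span k (Set.range A)
  A_mul_K1 : ∀ V ∈ K1, ∀ l : leads, A l * V ∈ Submodule.span k (Set.range A)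
  H_vert : ∀ i j, H i j ≠ 0 → vert.r i j
  d_mem : ∀ V ∈ K1, V * H - H * V ∈ Submodule.span k (Set.range A)

namespace MatrixBimoduleProblem

variable {k : Type*} [Field k]

/-- The space `ℳ₁`. -/
def M1 (𝔄 : MatrixBimoduleProblem k) : Submodule k (Matrix (Fin 𝔄.t) (Fin 𝔄.t) k) :=
  Submodule.span k (Set.range 𝔄.A)

open Classical in
/-- The idempotent `E_X`, for the vertex `X` of `x`. -/
def E (𝔄 : MatrixBimoduleProblem k) (x : Fin 𝔄.t) : Matrix (Fin 𝔄.t) (Fin 𝔄.t) k :=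
  Matrix.diagonal fun i => if 𝔄.vert.r i x then 1 else 0

/-- The space `𝒦₀`. -/
def K0 (𝔄 : MatrixBimoduleProblem k) : Submodule k (Matrix (Fin 𝔄.t) (Fin 𝔄.t) k) :=
  Submodule.span k (Set.range 𝔄.E)

/-- The vertex set `𝒯`. -/
abbrev Vertex (𝔄 : MatrixBimoduleProblem k) : Type := Quotient 𝔄.vert

/-- `a_l` is the first solid arrow of the associated bocs. -/
def IsFirstArrow (𝔄 : MatrixBimoduleProblem k) (l : 𝔄.leads) : Prop :=
  ∀ l' : 𝔄.leads, PosLE l.1 l'.1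

/-- The differential of the first solid arrow `a_l`, an element of the dual space `𝒞₁` of `𝒦₁`:
the functional sending `V` to the coefficient of `A_l` in `d(V) = V H - H V`.
As `𝒜` is normalized, this coefficient is the entry at the leading position of `A_l`.
(The terms `ι₁₁(a_l)` and `τ₁₁(a_l)` of the differential vanish for the first arrow.) -/
def deltaFirst (𝔄 : MatrixBimoduleProblem k) (l : 𝔄.leads) : 𝔄.K1 →ₗ[k] k where
  toFun V := (V.1 * 𝔄.H - 𝔄.H * V.1) l.1.1 l.1.2
  map_add' V W := by
    simp only [Submodule.coe_add, add_mul, mul_add, Matrix.sub_apply, Matrix.add_apply]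
    ring
  map_smul' c V := by
    simp only [SetLike.val_smul, Matrix.smul_mul, Matrix.mul_smul, Matrix.sub_apply,
      Matrix.smul_apply, smul_eq_mul, RingHom.id_apply]
    ring

/-- `𝔄` is bipartite: `𝒯` is the disjoint union of two non-empty parts, `T₂` and its complement
(given here as sets of indices), `𝒦` is the product of its two parts, `ℳ` is a bimodule over the
first part on the left and the second part on the right, and `H = 0`. -/
structure IsBipartite (𝔄 : MatrixBimoduleProblem k) (T₂ : Set (Fin 𝔄.t)) : Prop where
  nonempty_left : (T₂ᶜ).Nonempty
  nonempty_right : T₂.Nonempty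
  vert : ∀ i j, 𝔄.vert.r i j → (i ∈ T₂ ↔ j ∈ T₂)
  K1 : ∀ V ∈ 𝔄.K1, ∀ i j, V i j ≠ 0 → (i ∈ T₂ ↔ j ∈ T₂)
  M1 : ∀ B ∈ 𝔄.M1, ∀ i j, B i j ≠ 0 → i ∉ T₂ ∧ j ∈ T₂
  H : 𝔄.H = 0

/-- The RDCC condition: the row indices of the leading positions of the base matrices in `𝒜` are
pairwise different, and the column index of each leading position is the largest index in its
vertex. -/
structure IsRDCC (𝔄 : MatrixBimoduleProblem k) : Prop where
  row : ∀ l l' : 𝔄.leads, l.1.1 = l'.1.1 → l = l'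
  col : ∀ l : 𝔄.leads, ∀ j, 𝔄.vert.r j l.1.2 → j ≤ l.1.2

/-- `𝔅` is obtained from `𝔄` by a regularization of the first arrow `a_l`: `δ(a_l) ≠ 0`, `𝒦₁` is
replaced by the kernel of `δ(a_l)`, and `A_l` is removed from `𝒜`; the order isomorphism `π`
identifies the two index sets. -/
structure IsRegularization (𝔄 𝔅 : MatrixBimoduleProblem k) (π : Fin 𝔅.t → Fin 𝔄.t)
    (l : 𝔄.leads) : Prop where
  first : 𝔄.IsFirstArrow l
  delta : 𝔄.deltaFirst l ≠ 0
  strictMono : StrictMono π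
  surjective : Function.Surjective π
  vert : ∀ x y, 𝔅.vert.r x y ↔ 𝔄.vert.r (π x) (π y)
  K1 : ∀ U, U ∈ 𝔅.K1 ↔ ∃ V : 𝔄.K1, 𝔄.deltaFirst l V = 0 ∧ U = V.1.submatrix π π
  M1 : ∀ U, U ∈ 𝔅.M1 ↔ ∃ B ∈ 𝔄.M1, B l.1.1 l.1.2 = 0 ∧ U = B.submatrix π π
  H : 𝔅.H = 𝔄.H.submatrix π π

open Classical in
/-- The matrix `(f_a ⊗ e_b) ∗ V`: its block over `(i, j)` has the entry `V i j` in row `a` and column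
`b`, and zeros elsewhere. Here `π` is the block map and `ℓ` gives the labels within blocks. -/
def slice {t t' : ℕ} {Λ : Type*} (π : Fin t' → Fin t) (ℓ : Fin t' → Λ) (a b : Λ)
    (V : Matrix (Fin t) (Fin t) k) : Matrix (Fin t') (Fin t') k :=
  Matrix.of fun x y => if ℓ x = a ∧ ℓ y = b then V (π x) (π y) else 0

open Classical in
/-- `⊕_X (F_X ∗ E_X)`. -/
def diagStar {t t' : ℕ} {Λ : Type*} (π : Fin t' → Fin t) (ℓ : Fin t' → Λ)
    (F : Fin t → Λ → Λ → k) : Matrix (Fin t') (Fin t') k :=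
  Matrix.of fun x y => if π x = π y then F (π x) (ℓ x) (ℓ y) else 0

open Classical in
/-- The labels of the summands of `L_X`, for each index `i ∈ X`, when the vertices of `p` and `q`
are split with label sets `LX` and `LY` and the other vertices are kept. -/
def labelsAt (𝔄 : MatrixBimoduleProblem k) {Λ : Type*} (p q : Fin 𝔄.t) (LX LY : Finset Λ) (o : Λ)
    (i : Fin 𝔄.t) : Finset Λ :=
  if 𝔄.vert.r i p then LX else if 𝔄.vert.r i q then LY else {o}

/-- The elements of `Ē₁`: families of strictly upper triangular matrices `F_X`, one for each vertex,
with `F_X L(a_l) = L(a_l) F_Y` for the first arrow `a_l : X → Y`, where `L(a_l) = G`. -/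
structure IsUpperEndo (𝔄 : MatrixBimoduleProblem k) {Λ : Type*} (lt : Λ → Λ → Prop)
    (lab : Fin 𝔄.t → Finset Λ) (l : 𝔄.leads) (G : Λ → Λ → k) (F : Fin 𝔄.t → Λ → Λ → k) :
    Prop where
  vert : ∀ i j, 𝔄.vert.r i j → F i = F j
  upper : ∀ i, ∀ a ∈ lab i, ∀ b ∈ lab i, F i a b ≠ 0 → lt a b
  comm : ∀ a ∈ lab l.1.1, ∀ b ∈ lab l.1.2,
    ∑ c ∈ lab l.1.1, F l.1.1 a c * G c b = ∑ c ∈ lab l.1.2, G a c * F l.1.2 c b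

/-- `𝔅` is the matrix bimodule problem induced from `𝔄` by `a_l ↦ G`, where `a_l : X → Y` is the
first arrow and `δ(a_l) = 0`. Each index `i` is split into the indices `x` with `π x = i`, which
carry distinct labels `ℓ x ∈ lab i` and are ordered by their labels; the new vertex of
`x` is determined by `kind (ℓ x)` if `π x ∈ X ∪ Y`, and by the vertex of `π x` otherwise. -/
structure IsInduced (𝔄 𝔅 : MatrixBimoduleProblem k) (π : Fin 𝔅.t → Fin 𝔄.t) (l : 𝔄.leads)
    {Λ κ : Type*} (lt : Λ → Λ → Prop) (lab : Fin 𝔄.t → Finset Λ) (kind : Λ → κ)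
    (G : Λ → Λ → k) (ℓ : Fin 𝔅.t → Λ) : Prop where
  first : 𝔄.IsFirstArrow l
  delta : 𝔄.deltaFirst l = 0
  order : ∀ x y, x < y ↔ π x < π y ∨ (π x = π y ∧ lt (ℓ x) (ℓ y))
  labels : ∀ i a, a ∈ lab i ↔ ∃ x, π x = i ∧ ℓ x = a
  vert : ∀ x y, 𝔅.vert.r x y ↔ kind (ℓ x) = kind (ℓ y) ∧
    (𝔄.vert.r (π x) (π y) ∨
      ((𝔄.vert.r (π x) l.1.1 ∨ 𝔄.vert.r (π x) l.1.2) ∧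
        (𝔄.vert.r (π y) l.1.1 ∨ 𝔄.vert.r (π y) l.1.2)))
  K1 : 𝔅.K1 = Submodule.span k
    ({U | ∃ F, 𝔄.IsUpperEndo lt lab l G F ∧ U = diagStar π ℓ F} ∪
      {U | ∃ V ∈ 𝔄.K1, ∃ a b, U = slice π ℓ a b V})
  M1 : 𝔅.M1 = Submodule.span k
    {U | ∃ B ∈ 𝔄.M1, B l.1.1 l.1.2 = 0 ∧ ∃ a b, U = slice π ℓ a b B}
  H_eq : ∀ x y, (ℓ x = ℓ y → 𝔅.H x y = 𝔄.H (π x) (π y) + G (ℓ x) (ℓ y) * 𝔄.A l (π x) (π y)) ∧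
    (ℓ x ≠ ℓ y → 𝔅.H x y = G (ℓ x) (ℓ y) * 𝔄.A l (π x) (π y))

/-- The reduction block of an edge reduction. The labels `0 < 1 < 2` stand for `Z₃, Z₂, Z₁`, so
that `X` splits into `(Z₂, Z₁)`, `Y` splits into `(Z₃, Z₂)`, and `G` has the entry `1` at
`(Z₂, Z₂)`. -/
def edgeBlock (k : Type*) [Field k] (a b : Fin 3) : k := if a = 1 ∧ b = 1 then 1 else 0

/-- `𝔅` is obtained from `𝔄` by an edge reduction followed by a deletion: `a_l : X → Y` with
`X ≠ Y` and `δ(a_l) = 0`, and `a_l ↦ G` with `G` one of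
`(0)`, `(1)`, `(0 1)`, `(1 0)ᵀ`, `(0 1; 0 0)`. The sets `LX`, `LY` are those of the vertices among
`Z₂, Z₁` and `Z₃, Z₂` that are not deleted. -/
def IsEdgeReduction (𝔄 𝔅 : MatrixBimoduleProblem k) (π : Fin 𝔅.t → Fin 𝔄.t) (l : 𝔄.leads) :
    Prop :=
  ¬ 𝔄.vert.r l.1.1 l.1.2 ∧
    ∃ LX LY : Finset (Fin 3), LX ⊆ {1, 2} ∧ LY ⊆ {0, 1} ∧ LX.Nonempty ∧ LY.Nonempty ∧
      (1 ∈ LX ↔ 1 ∈ LY) ∧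
      ∃ ℓ : Fin 𝔅.t → Fin 3, IsInduced 𝔄 𝔅 π l (fun a b => a < b)
        (𝔄.labelsAt l.1.1 l.1.2 LX LY 1) id (edgeBlock k) ℓ

/-- A row of a Weyr matrix over a minimal algebra: the row `pos` (`1 ≤ pos ≤ size`) of the
Jordan block `J_size(ev)`, which belongs to the vertex `Z_(ev, size)`. -/
structure WeyrLabel (k : Type*) where
  ev : k
  size : ℕ
  pos : ℕ

/-- The order on the rows of a Weyr matrix. -/
def WeyrLabel.lt [LinearOrder k] (a b : WeyrLabel k) : Prop :=
  a.ev < b.ev ∨ (a.ev = b.ev ∧ (a.pos < b.pos ∨ (a.pos = b.pos ∧ b.size < a.size)))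

open Classical in
/-- The Weyr matrix similar to `⊕ J_j(λ) 1_{Z_(λ, j)}`. -/
def weyrBlock (k : Type*) [Field k] (a b : WeyrLabel k) : k :=
  if a.ev = b.ev ∧ a.size = b.size then
    (if a.pos = b.pos then a.ev else if b.pos = a.pos + 1 then 1 else 0)
  else 0

/-- `𝔅` is obtained from `𝔄` by a loop reduction (a loop mutation, an unraveling and a
deletion): `a_l : X → X`, `δ(a_l) = 0`, and `a_l ↦ W` for a Weyr matrix
`W ≃ ⊕_{(λ, j) ∈ S} J_j(λ) 1_{Z_(λ, j)}`, with `S` finite and non-empty. -/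
def IsLoopReduction [LinearOrder k] (𝔄 𝔅 : MatrixBimoduleProblem k) (π : Fin 𝔅.t → Fin 𝔄.t)
    (l : 𝔄.leads) : Prop :=
  𝔄.vert.r l.1.1 l.1.2 ∧
    ∃ S : Finset (k × ℕ), S.Nonempty ∧ (∀ s ∈ S, 1 ≤ s.2) ∧
    ∃ L : Finset (WeyrLabel k),
      (∀ a, a ∈ L ↔ (a.ev, a.size) ∈ S ∧ 1 ≤ a.pos ∧ a.pos ≤ a.size) ∧
      ∃ ℓ : Fin 𝔅.t → WeyrLabel k, IsInduced 𝔄 𝔅 π l WeyrLabel.lt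
        (𝔄.labelsAt l.1.1 l.1.2 L L ⟨0, 1, 1⟩) (fun a => (a.ev, a.size)) (weyrBlock k) ℓ

/-- `𝔅` is obtained from `𝔄` by a reduction of the first arrow: a regularization, a loop reduction
or an edge reduction. -/
def IsReduction [LinearOrder k] (𝔄 𝔅 : MatrixBimoduleProblem k) (π : Fin 𝔅.t → Fin 𝔄.t) : Prop :=
  ∃ l : 𝔄.leads, IsRegularization 𝔄 𝔅 π l ∨ IsLoopReduction 𝔄 𝔅 π l ∨ IsEdgeReduction 𝔄 𝔅 π l

/-- A matrix bimodule problem whose matrices are partitioned under the vertex set of `𝔄`: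
`blk x` is the index of the block of `𝔄` in which the index `x` lies. -/
structure Over (𝔄 : MatrixBimoduleProblem k) where
  prob : MatrixBimoduleProblem k
  blk : Fin prob.t → Fin 𝔄.t
  blk_mono : Monotone blk
  /-- The numbers of rows of the blocks form a size vector over `𝒯`. -/
  card_vert : ∀ i j, 𝔄.vert.r i j →
    (Finset.univ.filter fun x => blk x = i).card = (Finset.univ.filter fun x => blk x = j).card

namespace Over

variable {𝔄 : MatrixBimoduleProblem k}

/-- `𝔄` over itself. -/
def base (𝔄 : MatrixBimoduleProblem k) : Over 𝔄 where
  prob := 𝔄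
  blk := id
  blk_mono := monotone_id
  card_vert i j _ := by simp [Finset.filter_eq']

/-- The size vector over `T`. -/
def size (𝔇 : Over 𝔄) (i : Fin 𝔄.t) : ℕ := (Finset.univ.filter fun x => 𝔇.blk x = i).card

/-- The `a`-th index (counted from `0`) in the block `i`. -/
def idx (𝔇 : Over 𝔄) (i : Fin 𝔄.t) (a : Fin (𝔇.size i)) : Fin 𝔇.prob.t :=
  (Finset.univ.filter fun x => 𝔇.blk x = i).orderEmbOfFin rfl a

/-- `𝔇'` is obtained from `𝔇` by one reduction. -/
def Red [LinearOrder k] (𝔇 𝔇' : Over 𝔄) : Prop :=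
  ∃ π : Fin 𝔇'.prob.t → Fin 𝔇.prob.t, IsReduction 𝔇.prob 𝔇'.prob π ∧ 𝔇'.blk = 𝔇.blk ∘ π

end Over

/-- A representation of `𝔄`: a size vector over `𝒯` and a matrix `P(a_l)` for each solid arrow. -/
structure Rep (𝔄 : MatrixBimoduleProblem k) where
  size : Fin 𝔄.t → ℕ
  size_vert : ∀ i j, 𝔄.vert.r i j → size i = size j
  P : (l : 𝔄.leads) → Matrix (Fin (size l.1.1)) (Fin (size l.1.2)) k

namespace Rep

variable {𝔄 : MatrixBimoduleProblem k}

/-- The entry `(a, b)` of `P(a_l)`, and `0` outside the matrix. -/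
def ent (P : Rep 𝔄) (l : 𝔄.leads) (a b : ℕ) : k :=
  if h : a < P.size l.1.1 ∧ b < P.size l.1.2 then P.P l ⟨a, h.1⟩ ⟨b, h.2⟩ else 0

/-- The entry `(a, b)` of the block `(i, j)` of the partitioned matrix
`H_m(k) + ∑_l P(a_l) ∗ A_l`. -/
def entry (P : Rep 𝔄) (i j : Fin 𝔄.t) (a b : ℕ) : k :=
  (if a = b then 𝔄.H i j else 0) + ∑ l : 𝔄.leads, 𝔄.A l i j * P.ent l a b

open Classical in
/-- The bordered matrix with respect to the vertex `Z` of `z`: the size is enlarged by `1` at the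
indices in `Z`, and `P(a_l)` is replaced by `(0 P(a_l))` for the arrows `a_l` ending in `Z`. -/
def border (P : Rep 𝔄) (z : Fin 𝔄.t) : Rep 𝔄 where
  size i := P.size i + if 𝔄.vert.r i z then 1 else 0
  size_vert i j h := by
    have hij : 𝔄.vert.r i z ↔ 𝔄.vert.r j z :=
      ⟨fun h' => 𝔄.vert.iseqv.trans (𝔄.vert.iseqv.symm h) h', fun h' => 𝔄.vert.iseqv.trans h h'⟩
    simp only [P.size_vert i j h, hij]
  P l := Matrix.of fun a b =>
    if 𝔄.vert.r l.1.2 z then (if (b : ℕ) = 0 then 0 else P.ent l a ((b : ℕ) - 1))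
    else P.ent l a b

end Rep

namespace Over

variable {𝔄 : MatrixBimoduleProblem k}

/-- The representation `ϑ(H'(k))` of `𝔄` for a problem `𝔇 = (R', 𝒦', ℳ', H')` induced from `𝔄`:
the matrix `H'(k)` partitioned under `𝒯`. As `𝒜` is normalized, the value at `a_l` can be read off
from the block at the leading position of `A_l`. -/
def theta (𝔇 : Over 𝔄) : Rep 𝔄 where
  size := 𝔇.size
  size_vert := 𝔇.card_vert
  P l := Matrix.of fun a b => 𝔇.prob.H (𝔇.idx l.1.1 a) (𝔇.idx l.1.2 b) -
    if (a : ℕ) = b then 𝔄.H l.1.1 l.1.2 else 0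

/-- `ϑ(H'(k)) = P`, as an equality of partitioned matrices. -/
def IsTheta (𝔇 : Over 𝔄) (P : Rep 𝔄) : Prop :=
  (∀ i, 𝔇.size i = P.size i) ∧
    ∀ i j (a : Fin (𝔇.size i)) (b : Fin (𝔇.size j)),
      𝔇.prob.H (𝔇.idx i a) (𝔇.idx j b) = P.entry i j a b

/-- `x` is the first index of its block. -/
def IsFirstInBlock (𝔇 : Over 𝔄) (x : Fin 𝔇.prob.t) : Prop :=
  ∀ y, 𝔇.blk y = 𝔇.blk x → x ≤ y

/-- `𝔇'` arises from `𝔇` by adding a new vertex `Y`, which consists of one additional index at the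
beginning of each block in `Z`. Apart from `Y` the vertices, the matrix `H` and the positions of the
solid arrows are those of `𝔇`; the columns in `Y` of `H'` are zero; and in these columns there
is a solid arrow exactly in front of each solid arrow of `𝔇` that lies in the first column of
a block in `Z`. -/
def IsBordered (z : Fin 𝔄.t) (𝔇 𝔇' : Over 𝔄) : Prop :=
  ∃ e : Fin 𝔇.prob.t → Fin 𝔇'.prob.t, StrictMono e ∧
    (∀ x, 𝔇'.blk (e x) = 𝔇.blk x) ∧
    (∀ w, w ∉ Set.range e ↔ 𝔄.vert.r (𝔇'.blk w) z ∧ 𝔇'.IsFirstInBlock w) ∧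
    (∀ x y, 𝔇'.prob.vert.r (e x) (e y) ↔ 𝔇.prob.vert.r x y) ∧
    (∀ w, w ∉ Set.range e → ∀ w', 𝔇'.prob.vert.r w w' ↔ w' ∉ Set.range e) ∧
    (∀ x y, 𝔇'.prob.H (e x) (e y) = 𝔇.prob.H x y) ∧
    (∀ w, w ∉ Set.range e → ∀ x, 𝔇'.prob.H x w = 0) ∧
    (∀ x y, (e x, e y) ∈ 𝔇'.prob.leads ↔ (x, y) ∈ 𝔇.prob.leads) ∧
    (∀ w, w ∉ Set.range e → ∀ y, 𝔇.blk y = 𝔇'.blk w → 𝔇.IsFirstInBlock y →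
      ∀ x, (e x, w) ∈ 𝔇'.prob.leads ↔ (x, y) ∈ 𝔇.prob.leads) ∧
    (∀ w, w ∉ Set.range e → ∀ x, (w, x) ∉ 𝔇'.prob.leads)

/-- The sequence `𝔖` of problems is parallel to (based on) the reduction sequence `B` from `𝔄`, with
respect to the vertex `Z` of `z`: it starts with `𝔄`; each step consists of one or two reductions;
its `i`-th term is `B i`, or is `B i` with the border vertex added; and
`ϑ(H(k))`, for the last term, is the bordered matrix of `M = ϑ(H(k))` for the last term of `B`. -/
structure IsParallel [LinearOrder k] (z : Fin 𝔄.t) {s : ℕ} (B 𝔖 : Fin (s + 1) → Over 𝔄) :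
    Prop where
  zero : 𝔖 0 = base 𝔄
  step : ∀ i : Fin s, Red (𝔖 i.castSucc) (𝔖 i.succ) ∨
    ∃ 𝔇, Red (𝔖 i.castSucc) 𝔇 ∧ Red 𝔇 (𝔖 i.succ)
  based : ∀ i, 𝔖 i = B i ∨ IsBordered z (B i) (𝔖 i)
  theta : IsTheta (𝔖 (Fin.last s)) ((Over.theta (B (Fin.last s))).border z)

/-- The main diagonal block of `𝒦₀ ⊕ 𝒦₁` over the vertex `Z` of `z`: all diagonal blocks in `Z`
coincide, they are upper triangular, and the entries of the first row to the right of the diagonal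
are different dotted arrows, that is, they are part of the dual basis of a quasi-basis of `𝒦₁`
(a basis that consists of matrices `V` with `E_X V E_Y = V` for some vertices `X, Y`). -/
structure HasFreeFirstRow (z : Fin 𝔄.t) (𝔇 : Over 𝔄) : Prop where
  same : ∀ U ∈ 𝔇.prob.K0 ⊔ 𝔇.prob.K1, ∀ q, 𝔄.vert.r q z →
    ∀ (a b : Fin (𝔇.size q)) (a' b' : Fin (𝔇.size z)), (a : ℕ) = a' → (b : ℕ) = b' →
      U (𝔇.idx q a) (𝔇.idx q b) = U (𝔇.idx z a') (𝔇.idx z b')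
  upper : ∀ U ∈ 𝔇.prob.K0 ⊔ 𝔇.prob.K1, ∀ a b : Fin (𝔇.size z), b < a →
    U (𝔇.idx z a) (𝔇.idx z b) = 0
  free : ∃ (ι : Type) (V : Module.Basis ι k 𝔇.prob.K1),
    (∀ i, ∃ x y, corner 𝔇.prob.vert x y (V i).1 = (V i).1) ∧
    ∃ f : {b : Fin (𝔇.size z) // 0 < (b : ℕ)} → ι, Function.Injective f ∧
      ∀ (a : Fin (𝔇.size z)) (b : {b : Fin (𝔇.size z) // 0 < (b : ℕ)}), (a : ℕ) = 0 →
        ∀ U : 𝔇.prob.K1, V.coord (f b) U = U.1 (𝔇.idx z a) (𝔇.idx z b)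

end Over

end MatrixBimoduleProblem

end

/-! The parallel sequence carries out the given reductions while it keeps, at the front of every
block in Z, one index in which `H` has a zero column, these front indices forming one vertex (the
border vertex). `FrontInv` records this together with two further facts: every other index of a
block in Z is equivalent to an index outside `T₂`, and the entries of the first row of the main
diagonal block are independent functionals on 𝒦₁.

Existence. At the start `H = 0` and every block is a single index. The first arrow has its row
outside `T₂`, so no loop ends in the border vertex. If the arrow does not end there, the border
indices are not split and the invariant survives. If it does, and G is (0), (0 1) or (0 1; 0 0),
then the zero column of G supplies the new border. The only exception is G = (1) or (1; 0) at an
arrow ending in the border vertex. There the sequence branches: G is replaced by (0 G), which yields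
a bordering of the next problem (`FrontInv.isBorderMap_edge`). From then on the parallel problem is
the given one with a border. If the first arrow lies in the first column of a block in Z, another
arrow stands in front of it in the border column. That one is deleted, by a regularization or by G =
(0), and then the given reduction is repeated; otherwise the given reduction is repeated at once
(`Over.ParallelInv.exists_step`). Branching must happen: the single vertex of a local problem over a
bipartite one cannot lie inside `T₂`.

Freeness. If the border vertex is split into the labels 0 and 1, the elementary matrix at (0, 1)
over it is an admissible F, because column 0 of G is zero. If an arrow is removed, a matrix of 𝒦₁
supported in the rows of the border vertex lies in the kernel of δ, because the row of the arrow is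
not in the border and `H` has zero columns there. A dual family then extends to a quasi-basis.

Uniqueness. The final matrix determines each reduction. After a₁ ↦ G every matrix of ℳ₁ vanishes
over the position of a₁, so the final block there is an expansion of G (plus a scalar, for a loop).
Labels of an edge reduction are read from its non-zero rows and columns, those of a Weyr matrix from
the diagonal and from chains of non-zero entries (`IsReduction.isIso_of_reach`). A problem is
determined by its index set, vertices, 𝒦₁, ℳ₁ and `H`, so isomorphic results are equal. There
remains the choice between one and two reductions in a step. Two different choices would give two
problems, based on the same term, of which one is a reduction of the other; sizes, numbers of arrows
and the links to indices outside `T₂` exclude this (`Over.not_red_of_based`). -/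

/-! ### The order of positions -/

theorem PosLE.refl {t : ℕ} (x : Fin t × Fin t) : PosLE x x := Or.inr ⟨rfl, le_rfl⟩

theorem PosLE.antisymm {t : ℕ} {x y : Fin t × Fin t} (h : PosLE x y) (h' : PosLE y x) : x = y := by
  unfold PosLE at *
  apply Prod.ext <;> omega

theorem PosLE.total {t : ℕ} (x y : Fin t × Fin t) : PosLE x y ∨ PosLE y x := by
  unfold PosLE
  omega

theorem PosLE.trans {t : ℕ} {x y z : Fin t × Fin t} (h : PosLE x y) (h' : PosLE y z) :
    PosLE x z := by
  unfold PosLE at *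
  omega

theorem PosLE.exists_least {t : ℕ} (s : Finset (Fin t × Fin t)) (hs : s.Nonempty) :
    ∃ x ∈ s, ∀ y ∈ s, PosLE x y := by
  induction hs using Finset.Nonempty.cons_induction with
  | singleton a => exact ⟨a, by simp, by simp [PosLE.refl]⟩
  | cons a s ha hs ih =>
    obtain ⟨x, hx, h⟩ := ih
    rcases PosLE.total a x with h1 | h1
    · refine ⟨a, by simp, fun y hy => ?_⟩
      rcases Finset.mem_cons.1 hy with rfl | hy
      · exact PosLE.refl _
      · exact h1.trans (h y hy)
    · refine ⟨x, by simp [hx], fun y hy => ?_⟩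
      rcases Finset.mem_cons.1 hy with rfl | hy
      · exact h1
      · exact h y hy

theorem IsLeadingPos.unique {k : Type*} [Field k] {t : ℕ} {U : Matrix (Fin t) (Fin t) k}
    {x y : Fin t × Fin t} (hx : IsLeadingPos U x) (hy : IsLeadingPos U y) : x = y :=
  (hx.2 _ _ hy.1).antisymm (hy.2 _ _ hx.1)

/-! ### Corners and scalings of rows and columns -/

section Corner

variable {k : Type*} [Field k] {t : ℕ}

/-- Rows and columns of `V` scaled by `f` and `g`. -/
def scaleBy (f g : Fin t → k) (V : Matrix (Fin t) (Fin t) k) : Matrix (Fin t) (Fin t) k :=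
  Matrix.of fun i j => f i * V i j * g j

open Classical in
theorem scaleBy_eq_sum (s : Setoid (Fin t)) (f g : Fin t → k)
    (hf : ∀ i j, s.r i j → f i = f j) (hg : ∀ i j, s.r i j → g i = g j)
    (V : Matrix (Fin t) (Fin t) k) : scaleBy f g V = ∑ c : Quotient s, ∑ d : Quotient s,
      (f c.out * g d.out) • corner s c.out d.out V := by
  ext i j
  have hrel : ∀ (i : Fin t) (c : Quotient s), s.r i c.out ↔ c = Quotient.mk s i := by
    intro i c
    constructor
    · intro h
      rw [← Quotient.out_eq c]
      exact Quotient.sound (s.iseqv.symm h)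
    · rintro rfl
      exact s.iseqv.symm (Quotient.mk_out (s := s) i)
  rw [Matrix.sum_apply, Finset.sum_eq_single (Quotient.mk s i)]
  · rw [Matrix.sum_apply, Finset.sum_eq_single (Quotient.mk s j)]
    · have h1 := (hrel i _).2 rfl
      have h2 := (hrel j _).2 rfl
      simp only [scaleBy, corner, Matrix.smul_apply, Matrix.of_apply, h1, h2, and_self, if_true,
        smul_eq_mul, hf _ _ h1, hg _ _ h2]
      ring
    · intro d _ hd
      simp only [corner, Matrix.smul_apply, Matrix.of_apply, hrel, hd, and_false, if_false,
        smul_zero]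
    · simp
  · intro c _ hc
    rw [Matrix.sum_apply]
    refine Finset.sum_eq_zero fun d _ => ?_
    simp only [corner, Matrix.smul_apply, Matrix.of_apply, hrel, hc, false_and, if_false,
      smul_zero]
  · simp

open Classical in
theorem eq_sum_corner (s : Setoid (Fin t)) (V : Matrix (Fin t) (Fin t) k) :
    V = ∑ c : Quotient s, ∑ d : Quotient s, corner s c.out d.out V := by
  have := scaleBy_eq_sum s (fun _ => 1) (fun _ => 1) (fun _ _ _ => rfl) (fun _ _ _ => rfl) V
  simp only [mul_one, one_smul] at this
  rw [← this]
  ext i j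
  simp [scaleBy]

theorem corner_corner (s : Setoid (Fin t)) (x y : Fin t) (V : Matrix (Fin t) (Fin t) k) :
    corner s x y (corner s x y V) = corner s x y V := by
  ext i j
  simp only [corner, Matrix.of_apply]
  split_ifs <;> rfl

/-- A scaling that is constant on vertices is a combination of corners. Stability under `E_X · E_Y`
is used mostly in this form: restriction to given labels and multiplication by the entries of the
`F_W` are such scalings. -/
theorem scaleBy_mem (s : Setoid (Fin t)) (N : Submodule k (Matrix (Fin t) (Fin t) k))
    (hN : ∀ V ∈ N, ∀ x y, corner s x y V ∈ N) (f g : Fin t → k)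
    (hf : ∀ i j, s.r i j → f i = f j) (hg : ∀ i j, s.r i j → g i = g j)
    {V : Matrix (Fin t) (Fin t) k} (hV : V ∈ N) : scaleBy f g V ∈ N := by
  classical
  rw [scaleBy_eq_sum s f g hf hg]
  exact N.sum_mem fun c _ => N.sum_mem fun d _ => N.smul_mem _ (hN V hV _ _)

end Corner

/-! ### Base matrices, leading positions, isomorphisms -/

namespace MatrixBimoduleProblem

variable {k : Type*} [Field k] (𝔄 : MatrixBimoduleProblem k)

theorem vert_refl (i : Fin 𝔄.t) : 𝔄.vert.r i i := 𝔄.vert.iseqv.refl i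

variable {𝔄}

theorem vert_symm {i j : Fin 𝔄.t} (h : 𝔄.vert.r i j) : 𝔄.vert.r j i := 𝔄.vert.iseqv.symm h

theorem vert_trans {i j m : Fin 𝔄.t} (h : 𝔄.vert.r i j) (h' : 𝔄.vert.r j m) : 𝔄.vert.r i m :=
  𝔄.vert.iseqv.trans h h'

theorem vert_congr_left {i j m : Fin 𝔄.t} (h : 𝔄.vert.r i j) : 𝔄.vert.r i m ↔ 𝔄.vert.r j m :=
  ⟨fun h' => vert_trans (vert_symm h) h', fun h' => vert_trans h h'⟩

theorem A_mem_M1 (l : 𝔄.leads) : 𝔄.A l ∈ 𝔄.M1 := Submodule.subset_span ⟨l, rfl⟩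

theorem A_apply_lead (l l' : 𝔄.leads) : 𝔄.A l' l.1.1 l.1.2 = if l' = l then 1 else 0 := by
  split_ifs with h
  · subst h; exact 𝔄.A_one _
  · exact 𝔄.A_zero l l' (Ne.symm h)

theorem A_vert {l : 𝔄.leads} {i j : Fin 𝔄.t} (h : 𝔄.A l i j ≠ 0) :
    𝔄.vert.r i l.1.1 ∧ 𝔄.vert.r j l.1.2 := by
  rw [← 𝔄.A_corner l] at h
  by_contra hc
  simp [corner, hc] at h

theorem sum_smul_A_apply (c : 𝔄.leads → k) (l : 𝔄.leads) :
    (∑ l', c l' • 𝔄.A l') l.1.1 l.1.2 = c l := by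
  classical
  simp [Matrix.sum_apply, A_apply_lead]

theorem M1_repr {U : Matrix (Fin 𝔄.t) (Fin 𝔄.t) k} (hU : U ∈ 𝔄.M1) :
    U = ∑ l : 𝔄.leads, U l.1.1 l.1.2 • 𝔄.A l := by
  obtain ⟨c, rfl⟩ := (Submodule.mem_span_range_iff_exists_fun k).1 hU
  simp only [sum_smul_A_apply]

theorem M1_repr_apply {U : Matrix (Fin 𝔄.t) (Fin 𝔄.t) k} (hU : U ∈ 𝔄.M1) (i j : Fin 𝔄.t) :
    U i j = ∑ l : 𝔄.leads, U l.1.1 l.1.2 * 𝔄.A l i j := by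
  conv_lhs => rw [M1_repr hU]
  simp [Matrix.sum_apply]

/-- In a combination of base matrices the smallest lead with a non-zero coefficient is the leading
position of the sum. Hence `leads` depends on ℳ₁ only. -/
theorem mem_leads_iff {x : Fin 𝔄.t × Fin 𝔄.t} :
    x ∈ 𝔄.leads ↔ ∃ U ∈ 𝔄.M1, IsLeadingPos U x := by
  classical
  constructor
  · intro hx
    exact ⟨_, A_mem_M1 ⟨x, hx⟩, 𝔄.A_lead ⟨x, hx⟩⟩
  · rintro ⟨U, hU, hx⟩
    have hne : (𝔄.leads.filter fun l => U l.1 l.2 ≠ 0).Nonempty := by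
      by_contra h
      rw [Finset.not_nonempty_iff_eq_empty, Finset.filter_eq_empty_iff] at h
      push Not at h
      apply hx.1
      rw [M1_repr_apply hU]
      exact Finset.sum_eq_zero fun l _ => by rw [h l.2, zero_mul]
    obtain ⟨y, hy, hmin⟩ := PosLE.exists_least _ hne
    simp only [Finset.mem_filter] at hy hmin
    have hlead : IsLeadingPos U y := by
      refine ⟨hy.2, fun i j hij => ?_⟩
      rw [M1_repr_apply hU] at hij
      obtain ⟨l, -, hl⟩ := Finset.exists_ne_zero_of_sum_ne_zero hij
      exact (hmin l.1 ⟨l.2, left_ne_zero_of_mul hl⟩).trans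
        ((𝔄.A_lead l).2 i j (right_ne_zero_of_mul hl))
    rw [hx.unique hlead]
    exact hy.1

theorem IsFirstArrow.unique {l l' : 𝔄.leads} (h : 𝔄.IsFirstArrow l) (h' : 𝔄.IsFirstArrow l') :
    l = l' := Subtype.ext ((h l').antisymm (h' l))

theorem IsFirstArrow.posLE {l : 𝔄.leads} (h : 𝔄.IsFirstArrow l)
    {U : Matrix (Fin 𝔄.t) (Fin 𝔄.t) k} (hU : U ∈ 𝔄.M1) {i j : Fin 𝔄.t} (hij : U i j ≠ 0) :
    PosLE l.1 (i, j) := by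
  rw [M1_repr_apply hU] at hij
  obtain ⟨l', -, hl⟩ := Finset.exists_ne_zero_of_sum_ne_zero hij
  exact (h l').trans ((𝔄.A_lead l').2 i j (right_ne_zero_of_mul hl))

theorem mul_mem_M1 {V U : Matrix (Fin 𝔄.t) (Fin 𝔄.t) k} (hV : V ∈ 𝔄.K1) (hU : U ∈ 𝔄.M1) :
    V * U ∈ 𝔄.M1 := by
  rw [M1_repr hU, Finset.mul_sum]
  refine 𝔄.M1.sum_mem fun l _ => ?_
  rw [Matrix.mul_smul]
  exact 𝔄.M1.smul_mem _ (𝔄.K1_mul_A V hV l)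

theorem M1_mul_mem {V U : Matrix (Fin 𝔄.t) (Fin 𝔄.t) k} (hV : V ∈ 𝔄.K1) (hU : U ∈ 𝔄.M1) :
    U * V ∈ 𝔄.M1 := by
  rw [M1_repr hU, Finset.sum_mul]
  refine 𝔄.M1.sum_mem fun l _ => ?_
  rw [Matrix.smul_mul]
  exact 𝔄.M1.smul_mem _ (𝔄.A_mul_K1 V hV l)

/-- As V is strictly upper triangular, the entry at the first position (p, q) of `V * U` involves
only entries of U in rows below p, and these precede every leading position. With its mirror image
`IsFirstArrow.apply_mul` this makes ℳ₁ without the first arrow a bimodule again. -/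
theorem IsFirstArrow.mul_apply {l : 𝔄.leads} (h : 𝔄.IsFirstArrow l)
    {V U : Matrix (Fin 𝔄.t) (Fin 𝔄.t) k} (hV : V ∈ 𝔄.K1) (hU : U ∈ 𝔄.M1) :
    (V * U) l.1.1 l.1.2 = 0 := by
  rw [Matrix.mul_apply]
  refine Finset.sum_eq_zero fun u _ => ?_
  by_contra hne
  have h1 := left_ne_zero_of_mul hne
  have h2 := h.posLE hU (right_ne_zero_of_mul hne)
  have h3 : l.1.1 < u := by
    by_contra hc
    exact h1 (𝔄.K1_upper V hV _ _ (not_lt.1 hc))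
  rcases h2 with h2 | h2 <;> simp at h2 <;> omega

theorem IsFirstArrow.apply_mul {l : 𝔄.leads} (h : 𝔄.IsFirstArrow l)
    {V U : Matrix (Fin 𝔄.t) (Fin 𝔄.t) k} (hV : V ∈ 𝔄.K1) (hU : U ∈ 𝔄.M1) :
    (U * V) l.1.1 l.1.2 = 0 := by
  rw [Matrix.mul_apply]
  refine Finset.sum_eq_zero fun u _ => ?_
  by_contra hne
  have h1 := right_ne_zero_of_mul hne
  have h2 := h.posLE hU (left_ne_zero_of_mul hne)
  have h3 : u < l.1.2 := by
    by_contra hc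
    exact h1 (𝔄.K1_upper V hV _ _ (not_lt.1 hc))
  rcases h2 with h2 | h2 <;> simp at h2 <;> omega

theorem M1_corner {U : Matrix (Fin 𝔄.t) (Fin 𝔄.t) k} (hU : U ∈ 𝔄.M1) (x y : Fin 𝔄.t) :
    corner 𝔄.vert x y U ∈ 𝔄.M1 := by
  classical
  have : corner 𝔄.vert x y U = ∑ l : 𝔄.leads,
      (if 𝔄.vert.r l.1.1 x ∧ 𝔄.vert.r l.1.2 y then U l.1.1 l.1.2 else 0) • 𝔄.A l := by
    ext i j
    simp only [corner, Matrix.of_apply, Matrix.sum_apply, Matrix.smul_apply, smul_eq_mul]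
    rw [M1_repr_apply hU i j]
    split_ifs with hc
    · refine Finset.sum_congr rfl fun l _ => ?_
      by_cases hl : 𝔄.A l i j = 0
      · simp [hl]
      · rw [if_pos ⟨vert_trans (vert_symm (A_vert hl).1) hc.1,
          vert_trans (vert_symm (A_vert hl).2) hc.2⟩]
    · refine (Finset.sum_eq_zero fun l _ => ?_).symm
      by_cases hl : 𝔄.A l i j = 0
      · simp [hl]
      · rw [if_neg fun h => hc ⟨vert_trans (A_vert hl).1 h.1, vert_trans (A_vert hl).2 h.2⟩,
          zero_mul]
  rw [this]
  exact 𝔄.M1.sum_mem fun l _ => 𝔄.M1.smul_mem _ (A_mem_M1 l)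

theorem K1_scaleBy {V : Matrix (Fin 𝔄.t) (Fin 𝔄.t) k} (hV : V ∈ 𝔄.K1) {f g : Fin 𝔄.t → k}
    (hf : ∀ i j, 𝔄.vert.r i j → f i = f j) (hg : ∀ i j, 𝔄.vert.r i j → g i = g j) :
    scaleBy f g V ∈ 𝔄.K1 :=
  scaleBy_mem 𝔄.vert 𝔄.K1 𝔄.K1_corner f g hf hg hV

theorem M1_scaleBy {U : Matrix (Fin 𝔄.t) (Fin 𝔄.t) k} (hU : U ∈ 𝔄.M1) {f g : Fin 𝔄.t → k}
    (hf : ∀ i j, 𝔄.vert.r i j → f i = f j) (hg : ∀ i j, 𝔄.vert.r i j → g i = g j) :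
    scaleBy f g U ∈ 𝔄.M1 :=
  scaleBy_mem 𝔄.vert 𝔄.M1 (fun _ h x y => M1_corner h x y) f g hf hg hU

/-- The matrices in `ℳ₁` that vanish at the leading position of `A_l`. -/
def M1Off (𝔄 : MatrixBimoduleProblem k) (l : 𝔄.leads) :
    Submodule k (Matrix (Fin 𝔄.t) (Fin 𝔄.t) k) where
  carrier := {U | U ∈ 𝔄.M1 ∧ U l.1.1 l.1.2 = 0}
  add_mem' h h' := ⟨𝔄.M1.add_mem h.1 h'.1, by simp [h.2, h'.2]⟩
  zero_mem' := ⟨𝔄.M1.zero_mem, rfl⟩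
  smul_mem' c _ h := ⟨𝔄.M1.smul_mem c h.1, by simp [h.2]⟩

theorem M1Off_scaleBy {l : 𝔄.leads} {U : Matrix (Fin 𝔄.t) (Fin 𝔄.t) k} (hU : U ∈ 𝔄.M1Off l)
    {f g : Fin 𝔄.t → k} (hf : ∀ i j, 𝔄.vert.r i j → f i = f j)
    (hg : ∀ i j, 𝔄.vert.r i j → g i = g j) : scaleBy f g U ∈ 𝔄.M1Off l :=
  ⟨M1_scaleBy hU.1 hf hg, by simp [scaleBy, hU.2]⟩

theorem M1Off_repr {l : 𝔄.leads} {U : Matrix (Fin 𝔄.t) (Fin 𝔄.t) k} (hU : U ∈ 𝔄.M1Off l) :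
    U ∈ Submodule.span k (𝔄.A '' {l' | l' ≠ l}) := by
  rw [M1_repr hU.1]
  refine Submodule.sum_mem _ fun l' _ => ?_
  by_cases h : l' = l
  · subst h
    rw [hU.2, zero_smul]
    exact Submodule.zero_mem _
  · exact Submodule.smul_mem _ _ (Submodule.subset_span ⟨l', h, rfl⟩)

theorem A_mem_M1Off {l l' : 𝔄.leads} (h : l' ≠ l) : 𝔄.A l' ∈ 𝔄.M1Off l :=
  ⟨A_mem_M1 l', 𝔄.A_zero l l' (Ne.symm h)⟩

/-- An isomorphism of problems given by an order isomorphism of the index sets. -/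
structure IsIso (𝔄 𝔅 : MatrixBimoduleProblem k) (f : Fin 𝔄.t → Fin 𝔅.t) : Prop where
  strictMono : StrictMono f
  surjective : Function.Surjective f
  vert : ∀ x y, 𝔄.vert.r x y ↔ 𝔅.vert.r (f x) (f y)
  K1 : ∀ U, U ∈ 𝔅.K1 ↔ U.submatrix f f ∈ 𝔄.K1
  M1 : ∀ U, U ∈ 𝔅.M1 ↔ U.submatrix f f ∈ 𝔄.M1
  H : 𝔄.H = 𝔅.H.submatrix f f

theorem IsIso.mem_leads {𝔄 𝔅 : MatrixBimoduleProblem k} {f : Fin 𝔄.t → Fin 𝔅.t}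
    (h : IsIso 𝔄 𝔅 f) (x : Fin 𝔄.t × Fin 𝔄.t) : x ∈ 𝔄.leads ↔ (f x.1, f x.2) ∈ 𝔅.leads := by
  have hpos : ∀ i j, PosLE (f x.1, f x.2) (f i, f j) ↔ PosLE x (i, j) := by
    intro i j
    simp [PosLE, h.strictMono.lt_iff_lt, h.strictMono.le_iff_le, h.strictMono.injective.eq_iff]
  rw [mem_leads_iff, mem_leads_iff]
  constructor
  · rintro ⟨U, hU, hx⟩
    obtain ⟨g, hg⟩ := h.surjective.hasRightInverse
    have hg' : Function.LeftInverse g f := hg.leftInverse_of_injective h.strictMono.injective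
    have hUU : (U.submatrix g g).submatrix f f = U := by
      ext i j
      simp [hg' i, hg' j]
    refine ⟨U.submatrix g g, (h.M1 _).2 (by rwa [hUU]), ?_, fun i j hij => ?_⟩
    · simpa [hg' x.1, hg' x.2] using hx.1
    · have := hx.2 _ _ hij
      rw [← hpos, hg i, hg j] at this
      exact this
  · rintro ⟨U, hU, hx⟩
    exact ⟨U.submatrix f f, (h.M1 U).1 hU, hx.1, fun i j hij => (hpos i j).1 (hx.2 _ _ hij)⟩

theorem IsIso.A_eq {𝔄 𝔅 : MatrixBimoduleProblem k} {f : Fin 𝔄.t → Fin 𝔅.t}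
    (h : IsIso 𝔄 𝔅 f) (x : Fin 𝔄.t × Fin 𝔄.t) (hx : x ∈ 𝔄.leads)
    (hx' : (f x.1, f x.2) ∈ 𝔅.leads) : 𝔄.A ⟨x, hx⟩ = (𝔅.A ⟨_, hx'⟩).submatrix f f := by
  have hU : (𝔅.A ⟨_, hx'⟩).submatrix f f ∈ 𝔄.M1 := (h.M1 _).1 (A_mem_M1 _)
  rw [M1_repr hU, M1_repr (A_mem_M1 ⟨x, hx⟩)]
  refine Finset.sum_congr rfl fun l _ => ?_
  congr 1
  have := A_apply_lead (𝔄 := 𝔅) ⟨(f l.1.1, f l.1.2), (h.mem_leads _).1 l.2⟩ ⟨_, hx'⟩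
  rw [A_apply_lead, Matrix.submatrix_apply, this]
  congr 1
  simp [Prod.ext_iff, Subtype.ext_iff, h.strictMono.injective.eq_iff]

/-- The leads and the normalized base matrices are functions of ℳ₁, and a strictly monotone self-map
of `Fin t` is the identity. So isomorphic problems are equal, which turns uniqueness up to
isomorphism into equality. -/
theorem IsIso.eq_cast {𝔄 𝔅 : MatrixBimoduleProblem k} {f : Fin 𝔄.t → Fin 𝔅.t}
    (h : IsIso 𝔄 𝔅 f) : ∃ e : 𝔄 = 𝔅, ∀ x, f x = x.cast (congrArg _ e) := by
  have ht : 𝔄.t = 𝔅.t := by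
    simpa using Fintype.card_of_bijective ⟨h.strictMono.injective, h.surjective⟩
  have hv := h.vert
  have hK := h.K1
  have hH := h.H
  have hf := h.strictMono
  have hleads := h.mem_leads
  have hA := h.A_eq
  clear h
  obtain ⟨t, v, K, L, A, H, _, _, _, _, _, _, _, _, _, _, _⟩ := 𝔄
  obtain ⟨t', v', K', L', A', H', _, _, _, _, _, _, _, _, _, _, _⟩ := 𝔅
  dsimp only at ht
  subst ht
  obtain rfl : f = id := hf.eq_id
  have h1 : v = v' := Setoid.ext fun x y => hv x y
  have h2 : K = K' := Submodule.ext fun U => (hK U).symm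
  have h3 : L = L' := Finset.ext fun x => hleads x
  have h4 : H = H' := hH
  subst h1 h2 h3 h4
  have h5 : A = A' := funext fun x => hA x.1 x.2 x.2
  subst h5
  exact ⟨rfl, fun x => rfl⟩

end MatrixBimoduleProblem

/-! ### The kernel of δ, removal of the first arrow, blow-ups of index sets -/

namespace MatrixBimoduleProblem

variable {k : Type*} [Field k] {𝔄 : MatrixBimoduleProblem k}

/-- The kernel of `δ(a_l)`, as a space of matrices. -/
def kerDelta (𝔄 : MatrixBimoduleProblem k) (l : 𝔄.leads) :
    Submodule k (Matrix (Fin 𝔄.t) (Fin 𝔄.t) k) where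
  carrier := {V | V ∈ 𝔄.K1 ∧ (V * 𝔄.H - 𝔄.H * V) l.1.1 l.1.2 = 0}
  add_mem' {V W} h h' := ⟨𝔄.K1.add_mem h.1 h'.1, by
    have : (V + W) * 𝔄.H - 𝔄.H * (V + W) = (V * 𝔄.H - 𝔄.H * V) + (W * 𝔄.H - 𝔄.H * W) := by
      rw [add_mul, mul_add]; abel
    rw [this, Matrix.add_apply, h.2, h'.2, add_zero]⟩
  zero_mem' := ⟨𝔄.K1.zero_mem, by simp⟩
  smul_mem' c V h := ⟨𝔄.K1.smul_mem c h.1, by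
    rw [Matrix.smul_mul, Matrix.mul_smul, ← smul_sub, Matrix.smul_apply, h.2, smul_zero]⟩

theorem mem_kerDelta {l : 𝔄.leads} {V : Matrix (Fin 𝔄.t) (Fin 𝔄.t) k} :
    V ∈ 𝔄.kerDelta l ↔ V ∈ 𝔄.K1 ∧ (V * 𝔄.H - 𝔄.H * V) l.1.1 l.1.2 = 0 := Iff.rfl

theorem deltaFirst_eq_zero_iff {l : 𝔄.leads} :
    𝔄.deltaFirst l = 0 ↔ ∀ V ∈ 𝔄.K1, (V * 𝔄.H - 𝔄.H * V) l.1.1 l.1.2 = 0 := by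
  constructor
  · intro h V hV
    exact congrArg (fun f => f ⟨V, hV⟩) h
  · intro h
    ext V
    exact h V.1 V.2

/-- Since `H` only relates equivalent indices, d commutes with passing to a corner: the entry at (p,
q) is kept or replaced by zero. -/
theorem kerDelta_corner {l : 𝔄.leads} {V : Matrix (Fin 𝔄.t) (Fin 𝔄.t) k}
    (hV : V ∈ 𝔄.kerDelta l) (x y : Fin 𝔄.t) : corner 𝔄.vert x y V ∈ 𝔄.kerDelta l := by
  classical
  refine ⟨𝔄.K1_corner V hV.1 x y, ?_⟩
  have h2 := hV.2
  rw [Matrix.sub_apply, Matrix.mul_apply, Matrix.mul_apply] at h2 ⊢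
  have e1 : ∀ u, corner 𝔄.vert x y V l.1.1 u * 𝔄.H u l.1.2 =
      (if 𝔄.vert.r l.1.1 x ∧ 𝔄.vert.r l.1.2 y then 1 else 0) * (V l.1.1 u * 𝔄.H u l.1.2) := by
    intro u
    by_cases hu : 𝔄.H u l.1.2 = 0
    · simp [hu]
    · simp only [corner, Matrix.of_apply, vert_congr_left (𝔄.H_vert _ _ hu)]
      split_ifs <;> simp
  have e2 : ∀ u, 𝔄.H l.1.1 u * corner 𝔄.vert x y V u l.1.2 =
      (if 𝔄.vert.r l.1.1 x ∧ 𝔄.vert.r l.1.2 y then 1 else 0) * (𝔄.H l.1.1 u * V u l.1.2) := by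
    intro u
    by_cases hu : 𝔄.H l.1.1 u = 0
    · simp [hu]
    · simp only [corner, Matrix.of_apply, vert_congr_left (𝔄.H_vert _ _ hu)]
      split_ifs <;> simp
  simp only [e1, e2, ← Finset.mul_sum, ← mul_sub, h2, mul_zero]

/-- By the Leibniz rule for `V ↦ V H - H V`; both terms are products of 𝒦₁ with ℳ₁ and vanish at the
first position. -/
theorem kerDelta_mul {l : 𝔄.leads} (hl : 𝔄.IsFirstArrow l) {V W : Matrix (Fin 𝔄.t) (Fin 𝔄.t) k}
    (hV : V ∈ 𝔄.kerDelta l) (hW : W ∈ 𝔄.kerDelta l) : V * W ∈ 𝔄.kerDelta l := by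
  refine ⟨𝔄.K1_mul V hV.1 W hW.1, ?_⟩
  have : V * W * 𝔄.H - 𝔄.H * (V * W) =
      V * (W * 𝔄.H - 𝔄.H * W) + (V * 𝔄.H - 𝔄.H * V) * W := by
    rw [mul_sub, sub_mul, Matrix.mul_assoc, Matrix.mul_assoc, Matrix.mul_assoc]
    abel
  rw [this, Matrix.add_apply, hl.mul_apply hV.1 (𝔄.d_mem W hW.1),
    hl.apply_mul hW.1 (𝔄.d_mem V hV.1), add_zero]

theorem span_erase (l : 𝔄.leads) :
    Submodule.span k (Set.range fun m : (𝔄.leads.erase l.1 : Finset _) =>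
      𝔄.A ⟨m.1, Finset.mem_of_mem_erase m.2⟩) = 𝔄.M1Off l := by
  refine le_antisymm (Submodule.span_le.2 ?_) fun U hU => ?_
  · rintro _ ⟨m, rfl⟩
    exact A_mem_M1Off fun h => Finset.ne_of_mem_erase m.2 (congrArg Subtype.val h)
  · refine Submodule.span_mono ?_ (M1Off_repr hU)
    rintro _ ⟨l', hl', rfl⟩
    exact ⟨⟨l'.1, Finset.mem_erase.2 ⟨fun h => hl' (Subtype.ext h), l'.2⟩⟩, rfl⟩

/-- The problem with `𝒦₁` replaced by `ker δ(a_l)` and `A_l` removed, for the first arrow `a_l`. -/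
def removeFirst (𝔄 : MatrixBimoduleProblem k) (l : 𝔄.leads) (hl : 𝔄.IsFirstArrow l) :
    MatrixBimoduleProblem k where
  t := 𝔄.t
  vert := 𝔄.vert
  K1 := 𝔄.kerDelta l
  leads := 𝔄.leads.erase l.1
  A := fun m => 𝔄.A ⟨m.1, Finset.mem_of_mem_erase m.2⟩
  H := 𝔄.H
  K1_upper := fun V hV => 𝔄.K1_upper V hV.1
  K1_corner := fun V hV x y => kerDelta_corner hV x y
  K1_mul := fun V hV W hW => kerDelta_mul hl hV hW
  A_lead := fun m => 𝔄.A_lead _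
  A_one := fun m => 𝔄.A_one ⟨m.1, _⟩
  A_zero := fun m m' h => 𝔄.A_zero ⟨m.1, Finset.mem_of_mem_erase m.2⟩
    ⟨m'.1, Finset.mem_of_mem_erase m'.2⟩ fun h' => h (Subtype.ext (congrArg (fun z => z.1) h'))
  A_corner := fun m => 𝔄.A_corner ⟨m.1, _⟩
  K1_mul_A := fun V hV m => by
    rw [span_erase]
    exact ⟨𝔄.K1_mul_A V hV.1 _, hl.mul_apply hV.1 (A_mem_M1 _)⟩
  A_mul_K1 := fun V hV m => by
    rw [span_erase]
    exact ⟨𝔄.A_mul_K1 V hV.1 _, hl.apply_mul hV.1 (A_mem_M1 _)⟩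
  H_vert := 𝔄.H_vert
  d_mem := fun V hV => by
    rw [span_erase]
    exact ⟨𝔄.d_mem V hV.1, hV.2⟩

theorem removeFirst_M1 (l : 𝔄.leads) (hl : 𝔄.IsFirstArrow l) :
    (𝔄.removeFirst l hl).M1 = 𝔄.M1Off l :=
  span_erase l

/-- Each index `i` is replaced by indices labelled by the members of `lab i`, in the order `lt`. -/
structure IsBlowUp {t t' : ℕ} {Λ : Type*} (lt : Λ → Λ → Prop) (lab : Fin t → Finset Λ)
    (π : Fin t' → Fin t) (ℓ : Fin t' → Λ) : Prop where
  order : ∀ x y, x < y ↔ π x < π y ∨ (π x = π y ∧ lt (ℓ x) (ℓ y))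
  labels : ∀ i a, a ∈ lab i ↔ ∃ x, π x = i ∧ ℓ x = a

namespace IsBlowUp

variable {t t' : ℕ} {Λ : Type*} {lt : Λ → Λ → Prop} {lab : Fin t → Finset Λ}
  {π : Fin t' → Fin t} {ℓ : Fin t' → Λ}

theorem mono (h : IsBlowUp lt lab π ℓ) : Monotone π := by
  intro x y hxy
  by_contra hc
  exact absurd ((h.order y x).2 (Or.inl (not_le.1 hc))) (not_lt.2 hxy)

theorem mem (h : IsBlowUp lt lab π ℓ) (x : Fin t') : ℓ x ∈ lab (π x) :=
  (h.labels _ _).2 ⟨x, rfl, rfl⟩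

theorem not_lt_self (h : IsBlowUp lt lab π ℓ) (x : Fin t') : ¬ lt (ℓ x) (ℓ x) := fun hlt =>
  lt_irrefl x ((h.order x x).2 (Or.inr ⟨rfl, hlt⟩))

theorem inj (h : IsBlowUp lt lab π ℓ) {x y : Fin t'} (hπ : π x = π y) (hℓ : ℓ x = ℓ y) :
    x = y := by
  rcases lt_trichotomy x y with hxy | hxy | hxy
  · rcases (h.order x y).1 hxy with h1 | h1
    · omega
    · exact absurd (hℓ ▸ h1.2) (h.not_lt_self x)
  · exact hxy
  · rcases (h.order y x).1 hxy with h1 | h1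
    · omega
    · exact absurd (hℓ ▸ h1.2) (h.not_lt_self y)

theorem sum_eq (h : IsBlowUp lt lab π ℓ) (g : Fin t → Λ → k) :
    ∑ u, g (π u) (ℓ u) = ∑ i, ∑ c ∈ lab i, g i c := by
  classical
  rw [Finset.sum_sigma']
  refine Finset.sum_bij (fun u _ => (⟨π u, ℓ u⟩ : (_ : Fin t) × Λ)) ?_ ?_ ?_ ?_
  · intro u _
    simpa using h.mem u
  · intro u _ v _ huv
    simp only [Sigma.mk.injEq, heq_eq_eq] at huv
    exact h.inj huv.1 huv.2
  · rintro ⟨i, c⟩ hic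
    simp only [Finset.mem_sigma, Finset.mem_univ, true_and] at hic
    obtain ⟨x, rfl, rfl⟩ := (h.labels _ _).1 hic
    exact ⟨x, Finset.mem_univ _, rfl⟩
  · intro u _
    rfl

end IsBlowUp

/-- The new indices are the pairs `(i, a)` with `a ∈ lab i`, sorted lexicographically. -/
theorem exists_isBlowUp {t : ℕ} {Λ : Type*} (lt : Λ → Λ → Prop) (hlt : IsStrictTotalOrder Λ lt)
    (lab : Fin t → Finset Λ) :
    ∃ (t' : ℕ) (π : Fin t' → Fin t) (ℓ : Fin t' → Λ), IsBlowUp lt lab π ℓ := by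
  classical
  let _ : LinearOrder Λ := linearOrderOfSTO lt
  have hlt' : ∀ a b : Λ, a < b ↔ lt a b := fun a b => Iff.rfl
  let F : Finset (Fin t ×ₗ Λ) := (Finset.univ.sigma lab).image fun s => toLex (s.1, s.2)
  let e := F.orderIsoOfFin rfl
  refine ⟨F.card, fun x => (ofLex (e x).1).1, fun x => (ofLex (e x).1).2, ?_, ?_⟩
  · intro x y
    rw [← e.lt_iff_lt, ← Subtype.coe_lt_coe, Prod.Lex.lt_iff]
    rfl
  · intro i a
    constructor
    · intro ha
      have hmem : toLex (i, a) ∈ F := Finset.mem_image.2 ⟨⟨i, a⟩, by simpa using ha, rfl⟩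
      refine ⟨e.symm ⟨_, hmem⟩, ?_, ?_⟩ <;> simp
    · rintro ⟨x, rfl, rfl⟩
      obtain ⟨s, hs, hx⟩ := Finset.mem_image.1 (e x).2
      rw [← hx]
      simpa using hs

end MatrixBimoduleProblem

/-! ### Blown-up matrices and the construction of induced problems -/

namespace MatrixBimoduleProblem

variable {k : Type*} [Field k] {𝔄 : MatrixBimoduleProblem k}

section Blow

variable {t t' : ℕ} {Λ : Type*} {lt : Λ → Λ → Prop} {lab : Fin t → Finset Λ}
  {π : Fin t' → Fin t} {ℓ : Fin t' → Λ}

/-- The matrix whose block over `(i, j)` has the entry `f a b i j` at the labels `(a, b)`. -/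
def blow (π : Fin t' → Fin t) (ℓ : Fin t' → Λ) (f : Λ → Λ → Matrix (Fin t) (Fin t) k) :
    Matrix (Fin t') (Fin t') k :=
  Matrix.of fun x y => f (ℓ x) (ℓ y) (π x) (π y)

theorem blow_apply (f : Λ → Λ → Matrix (Fin t) (Fin t) k) (x y : Fin t') :
    blow π ℓ f x y = f (ℓ x) (ℓ y) (π x) (π y) := rfl

theorem diagStar_apply (F : Fin t → Λ → Λ → k) (x y : Fin t') :
    diagStar π ℓ F x y = if π x = π y then F (π x) (ℓ x) (ℓ y) else 0 := by
  simp [diagStar]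

open Classical in
theorem slice_apply (a b : Λ) (V : Matrix (Fin t) (Fin t) k) (x y : Fin t') :
    slice π ℓ a b V x y = if ℓ x = a ∧ ℓ y = b then V (π x) (π y) else 0 := rfl

theorem slice_add (a b : Λ) (V W : Matrix (Fin t) (Fin t) k) :
    slice π ℓ a b (V + W) = slice π ℓ a b V + slice π ℓ a b W := by
  classical
  ext x y
  simp only [slice_apply, Matrix.add_apply]
  split_ifs <;> simp

theorem slice_smul (a b : Λ) (c : k) (V : Matrix (Fin t) (Fin t) k) :
    slice π ℓ a b (c • V) = c • slice π ℓ a b V := by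
  classical
  ext x y
  simp only [slice_apply, Matrix.smul_apply]
  split_ifs <;> simp

theorem slice_zero (a b : Λ) : slice π ℓ a b (0 : Matrix (Fin t) (Fin t) k) = 0 := by
  classical
  ext x y
  simp [slice_apply]

open Classical in
theorem slice_eq_blow (a b : Λ) (V : Matrix (Fin t) (Fin t) k) :
    slice π ℓ a b V = blow π ℓ fun a' b' => if a' = a ∧ b' = b then V else 0 := by
  ext x y
  simp only [slice_apply, blow_apply]
  split_ifs <;> rfl

open Classical in
theorem blow_eq_sum (h : IsBlowUp lt lab π ℓ) (f : Λ → Λ → Matrix (Fin t) (Fin t) k) :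
    blow π ℓ f = ∑ a ∈ Finset.univ.biUnion lab, ∑ b ∈ Finset.univ.biUnion lab,
      slice π ℓ a b (f a b) := by
  have hC : ∀ x, ℓ x ∈ Finset.univ.biUnion lab := fun x =>
    Finset.mem_biUnion.2 ⟨_, Finset.mem_univ _, h.mem x⟩
  ext x y
  rw [Matrix.sum_apply, Finset.sum_eq_single_of_mem _ (hC x)]
  · rw [Matrix.sum_apply, Finset.sum_eq_single_of_mem _ (hC y)]
    · simp [slice_apply, blow_apply]
    · intro b _ hb
      simp [slice_apply, Ne.symm hb]
  · intro a _ ha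
    rw [Matrix.sum_apply]
    refine Finset.sum_eq_zero fun b _ => ?_
    simp [slice_apply, Ne.symm ha]

open Classical in
/-- `f a b`, restricted to the rows labelled by `a` and the columns labelled by `b`. -/
noncomputable def restrictLabels (lab : Fin t → Finset Λ) (f : Λ → Λ → Matrix (Fin t) (Fin t) k) (a b : Λ) :
    Matrix (Fin t) (Fin t) k :=
  scaleBy (fun i => if a ∈ lab i then 1 else 0) (fun j => if b ∈ lab j then 1 else 0) (f a b)

theorem restrictLabels_left (f : Λ → Λ → Matrix (Fin t) (Fin t) k) {a b : Λ} {i : Fin t}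
    (h : a ∉ lab i) (j : Fin t) : restrictLabels lab f a b i j = 0 := by
  simp [restrictLabels, scaleBy, h]

theorem restrictLabels_right (f : Λ → Λ → Matrix (Fin t) (Fin t) k) {a b : Λ} {j : Fin t}
    (h : b ∉ lab j) (i : Fin t) : restrictLabels lab f a b i j = 0 := by
  simp [restrictLabels, scaleBy, h]

/-- Entries of `f a b` in rows without the label a or in columns without the label b are never read.
Setting them to zero allows the sums over the labels of one index, which occur in products, to be
extended to all labels. -/
theorem blow_restrictLabels (h : IsBlowUp lt lab π ℓ) (f : Λ → Λ → Matrix (Fin t) (Fin t) k) :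
    blow π ℓ (restrictLabels lab f) = blow π ℓ f := by
  ext x y
  simp [blow_apply, restrictLabels, scaleBy, h.mem]

theorem sum_labels_eq [DecidableEq Λ] (i : Fin t) (g : Λ → k) :
    ∑ c ∈ lab i, g c = ∑ c ∈ Finset.univ.biUnion lab, if c ∈ lab i then g c else 0 := by
  rw [← Finset.sum_filter]
  refine Finset.sum_congr ?_ fun _ _ => rfl
  ext c
  simp only [Finset.mem_filter, Finset.mem_biUnion, Finset.mem_univ, true_and]
  exact ⟨fun h => ⟨⟨i, h⟩, h⟩, fun h => h.2⟩

theorem diagStar_mul_diagStar (h : IsBlowUp lt lab π ℓ) (F F' : Fin t → Λ → Λ → k) :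
    diagStar π ℓ F * diagStar π ℓ F' =
      diagStar π ℓ fun i a b => ∑ c ∈ lab i, F i a c * F' i c b := by
  ext x y
  rw [Matrix.mul_apply, diagStar_apply]
  simp only [diagStar_apply]
  rw [h.sum_eq fun i c => (if π x = i then F (π x) (ℓ x) c else 0) *
    (if i = π y then F' i c (ℓ y) else 0)]
  rw [Finset.sum_eq_single (π x)]
  · simp only [if_true]
    split_ifs <;> simp
  · intro i _ hi
    simp [Ne.symm hi]
  · simp

theorem diagStar_mul_blow_apply (h : IsBlowUp lt lab π ℓ) (F : Fin t → Λ → Λ → k)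
    (f : Λ → Λ → Matrix (Fin t) (Fin t) k) (x y : Fin t') :
    (diagStar π ℓ F * blow π ℓ f) x y =
      ∑ c ∈ lab (π x), F (π x) (ℓ x) c * f c (ℓ y) (π x) (π y) := by
  rw [Matrix.mul_apply]
  simp only [diagStar_apply, blow_apply]
  rw [h.sum_eq fun i c => (if π x = i then F (π x) (ℓ x) c else 0) * f c (ℓ y) i (π y)]
  rw [Finset.sum_eq_single (π x)]
  · simp
  · intro i _ hi
    simp [Ne.symm hi]
  · simp

theorem blow_mul_diagStar_apply (h : IsBlowUp lt lab π ℓ) (F : Fin t → Λ → Λ → k)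
    (f : Λ → Λ → Matrix (Fin t) (Fin t) k) (x y : Fin t') :
    (blow π ℓ f * diagStar π ℓ F) x y =
      ∑ c ∈ lab (π y), f (ℓ x) c (π x) (π y) * F (π y) c (ℓ y) := by
  rw [Matrix.mul_apply]
  simp only [diagStar_apply, blow_apply]
  rw [h.sum_eq fun i c => f (ℓ x) c (π x) i * if i = π y then F i c (ℓ y) else 0]
  rw [Finset.sum_eq_single (π y)]
  · simp
  · intro i _ hi
    simp [hi]
  · simp

/-- A product of blown-up matrices is a sum over pairs `(j, c)` with `c ∈ lab j`; by `hfg` the pairs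
with `c ∉ lab j` contribute nothing, so the sum separates into a matrix product for each label c. -/
theorem blow_mul_blow_apply [DecidableEq Λ] (h : IsBlowUp lt lab π ℓ)
    (f g : Λ → Λ → Matrix (Fin t) (Fin t) k)
    (hfg : ∀ a c b i j m, c ∉ lab j → f a c i j * g c b j m = 0) (x y : Fin t') :
    (blow π ℓ f * blow π ℓ g) x y =
      ∑ c ∈ Finset.univ.biUnion lab, (f (ℓ x) c * g c (ℓ y)) (π x) (π y) := by
  rw [Matrix.mul_apply]
  simp only [blow_apply]
  rw [h.sum_eq fun i c => f (ℓ x) c (π x) i * g c (ℓ y) i (π y)]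
  simp only [Matrix.mul_apply]
  rw [Finset.sum_comm]
  refine Finset.sum_congr rfl fun i _ => ?_
  rw [sum_labels_eq]
  refine Finset.sum_congr rfl fun c _ => ?_
  split_ifs with hc
  · rfl
  · rw [hfg _ _ _ _ _ _ hc]

end Blow

/-- The data for the problem induced by `a_l ↦ G`, where `a_l` is the first arrow. -/
structure Inducible (𝔄 : MatrixBimoduleProblem k) {t' : ℕ} (π : Fin t' → Fin 𝔄.t) (l : 𝔄.leads)
    {Λ κ : Type*} (lt : Λ → Λ → Prop) (lab : Fin 𝔄.t → Finset Λ) (kind : Λ → κ)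
    (G : Λ → Λ → k) (ℓ : Fin t' → Λ) : Prop where
  blowUp : IsBlowUp lt lab π ℓ
  first : 𝔄.IsFirstArrow l
  delta : 𝔄.deltaFirst l = 0
  lab_vert : ∀ i j, 𝔄.vert.r i j → lab i = lab j
  kind_G : ∀ a b, G a b ≠ 0 → kind a = kind b

section Induce

variable {t' : ℕ} {π : Fin t' → Fin 𝔄.t} {l : 𝔄.leads} {Λ κ : Type*} {lt : Λ → Λ → Prop}
  {lab : Fin 𝔄.t → Finset Λ} {kind : Λ → κ} {G : Λ → Λ → k} {ℓ : Fin t' → Λ}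

theorem IsUpperEndo.add {F F' : Fin 𝔄.t → Λ → Λ → k} (h : 𝔄.IsUpperEndo lt lab l G F)
    (h' : 𝔄.IsUpperEndo lt lab l G F') :
    𝔄.IsUpperEndo lt lab l G fun i a b => F i a b + F' i a b where
  vert i j hij := by rw [h.vert i j hij, h'.vert i j hij]
  upper i a ha b hb hne := by
    by_contra hlt
    have h1 : F i a b = 0 := by
      by_contra hc; exact hlt (h.upper i a ha b hb hc)
    have h2 : F' i a b = 0 := by
      by_contra hc; exact hlt (h'.upper i a ha b hb hc)
    simp [h1, h2] at hne
  comm a ha b hb := by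
    simp only [add_mul, mul_add, Finset.sum_add_distrib, h.comm a ha b hb, h'.comm a ha b hb]

theorem IsUpperEndo.smul {F : Fin 𝔄.t → Λ → Λ → k} (h : 𝔄.IsUpperEndo lt lab l G F) (r : k) :
    𝔄.IsUpperEndo lt lab l G fun i a b => r * F i a b where
  vert i j hij := by rw [h.vert i j hij]
  upper i a ha b hb hne := h.upper i a ha b hb (right_ne_zero_of_mul hne)
  comm a ha b hb := by
    have := h.comm a ha b hb
    simp only [mul_assoc, mul_left_comm _ r, ← Finset.mul_sum, this]

theorem IsUpperEndo.zero : 𝔄.IsUpperEndo lt lab l G fun _ _ _ => 0 where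
  vert _ _ _ := rfl
  upper i a ha b hb hne := absurd rfl hne
  comm a ha b hb := by simp

theorem IsUpperEndo.mul [IsTrans Λ lt] (hlab : ∀ i j, 𝔄.vert.r i j → lab i = lab j)
    {F F' : Fin 𝔄.t → Λ → Λ → k} (h : 𝔄.IsUpperEndo lt lab l G F)
    (h' : 𝔄.IsUpperEndo lt lab l G F') :
    𝔄.IsUpperEndo lt lab l G fun i a b => ∑ c ∈ lab i, F i a c * F' i c b where
  vert i j hij := by rw [h.vert i j hij, h'.vert i j hij, hlab i j hij]
  upper i a ha b hb hne := by
    obtain ⟨c, hc, hne⟩ := Finset.exists_ne_zero_of_sum_ne_zero hne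
    exact _root_.trans (h.upper i a ha c hc (left_ne_zero_of_mul hne))
      (h'.upper i c hc b hb (right_ne_zero_of_mul hne))
  comm a ha b hb := by
    calc ∑ c ∈ lab l.1.1, (∑ d ∈ lab l.1.1, F l.1.1 a d * F' l.1.1 d c) * G c b
        = ∑ d ∈ lab l.1.1, F l.1.1 a d * ∑ c ∈ lab l.1.1, F' l.1.1 d c * G c b := by
          simp only [Finset.sum_mul, Finset.mul_sum, mul_assoc]
          exact Finset.sum_comm
      _ = ∑ d ∈ lab l.1.1, F l.1.1 a d * ∑ c ∈ lab l.1.2, G d c * F' l.1.2 c b :=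
          Finset.sum_congr rfl fun d hd => by rw [h'.comm d hd b hb]
      _ = ∑ c ∈ lab l.1.2, (∑ d ∈ lab l.1.1, F l.1.1 a d * G d c) * F' l.1.2 c b := by
          simp only [Finset.sum_mul, Finset.mul_sum, mul_assoc]
          exact Finset.sum_comm
      _ = ∑ c ∈ lab l.1.2, (∑ d ∈ lab l.1.2, G a d * F l.1.2 d c) * F' l.1.2 c b :=
          Finset.sum_congr rfl fun c hc => by rw [h.comm a ha c hc]
      _ = ∑ d ∈ lab l.1.2, G a d * ∑ c ∈ lab l.1.2, F l.1.2 d c * F' l.1.2 c b := by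
          simp only [Finset.sum_mul, Finset.mul_sum, mul_assoc]
          exact Finset.sum_comm

/-- The space `𝒦₁` of the induced problem. -/
def inducedK1 (𝔄 : MatrixBimoduleProblem k) (π : Fin t' → Fin 𝔄.t) (l : 𝔄.leads)
    (lt : Λ → Λ → Prop) (lab : Fin 𝔄.t → Finset Λ) (G : Λ → Λ → k) (ℓ : Fin t' → Λ) :
    Submodule k (Matrix (Fin t') (Fin t') k) where
  carrier := {U | ∃ F f, 𝔄.IsUpperEndo lt lab l G F ∧ (∀ a b, f a b ∈ 𝔄.K1) ∧
    U = diagStar π ℓ F + blow π ℓ f}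
  add_mem' := by
    rintro _ _ ⟨F, f, hF, hf, rfl⟩ ⟨F', f', hF', hf', rfl⟩
    refine ⟨_, fun a b => f a b + f' a b, hF.add hF', fun a b => 𝔄.K1.add_mem (hf a b) (hf' a b),
      ?_⟩
    ext x y
    simp only [Matrix.add_apply, diagStar_apply, blow_apply]
    split_ifs <;> ring
  zero_mem' := by
    refine ⟨_, fun _ _ => 0, IsUpperEndo.zero, fun _ _ => 𝔄.K1.zero_mem, ?_⟩
    ext x y
    simp [diagStar_apply, blow_apply]
  smul_mem' := by
    rintro r _ ⟨F, f, hF, hf, rfl⟩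
    refine ⟨_, fun a b => r • f a b, hF.smul r, fun a b => 𝔄.K1.smul_mem r (hf a b), ?_⟩
    ext x y
    simp only [Matrix.add_apply, diagStar_apply, blow_apply, Matrix.smul_apply, smul_eq_mul]
    split_ifs <;> ring

/-- The space `ℳ₁` of the induced problem. -/
def inducedM1 (𝔄 : MatrixBimoduleProblem k) (π : Fin t' → Fin 𝔄.t) (l : 𝔄.leads)
    (ℓ : Fin t' → Λ) : Submodule k (Matrix (Fin t') (Fin t') k) where
  carrier := {U | ∃ f, (∀ a b, f a b ∈ 𝔄.M1Off l) ∧ U = blow π ℓ f}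
  add_mem' := by
    rintro _ _ ⟨f, hf, rfl⟩ ⟨f', hf', rfl⟩
    exact ⟨fun a b => f a b + f' a b, fun a b => Submodule.add_mem _ (hf a b) (hf' a b), rfl⟩
  zero_mem' := ⟨fun _ _ => 0, fun _ _ => Submodule.zero_mem _, rfl⟩
  smul_mem' := by
    rintro r _ ⟨f, hf, rfl⟩
    exact ⟨fun a b => r • f a b, fun a b => Submodule.smul_mem _ r (hf a b), rfl⟩

/-- Replaces the span in the definition by a normal form, one endomorphism plus one blown-up family.
All computations in the induced 𝒦₁ use this form. -/
theorem span_eq_inducedK1 (h : IsBlowUp lt lab π ℓ) :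
    Submodule.span k ({U | ∃ F, 𝔄.IsUpperEndo lt lab l G F ∧ U = diagStar π ℓ F} ∪
      {U | ∃ V ∈ 𝔄.K1, ∃ a b, U = slice π ℓ a b V}) = 𝔄.inducedK1 π l lt lab G ℓ := by
  classical
  refine le_antisymm (Submodule.span_le.2 ?_) ?_
  · rintro U (⟨F, hF, rfl⟩ | ⟨V, hV, a, b, rfl⟩)
    · refine ⟨F, fun _ _ => 0, hF, fun _ _ => 𝔄.K1.zero_mem, ?_⟩
      ext x y
      simp [blow_apply]
    · refine ⟨_, fun a' b' => if a' = a ∧ b' = b then V else 0, IsUpperEndo.zero,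
        fun a' b' => ?_, ?_⟩
      · dsimp only
        split_ifs
        exacts [hV, 𝔄.K1.zero_mem]
      · rw [slice_eq_blow]
        ext x y
        simp only [Matrix.add_apply, diagStar_apply, ite_self, zero_add]
  · rintro _ ⟨F, f, hF, hf, rfl⟩
    refine Submodule.add_mem _ (Submodule.subset_span (Or.inl ⟨F, hF, rfl⟩)) ?_
    rw [blow_eq_sum h]
    exact Submodule.sum_mem _ fun a _ => Submodule.sum_mem _ fun b _ =>
      Submodule.subset_span (Or.inr ⟨_, hf a b, a, b, rfl⟩)

theorem span_eq_inducedM1 (h : IsBlowUp lt lab π ℓ) :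
    Submodule.span k {U | ∃ B ∈ 𝔄.M1, B l.1.1 l.1.2 = 0 ∧ ∃ a b, U = slice π ℓ a b B} =
      𝔄.inducedM1 π l ℓ := by
  classical
  refine le_antisymm (Submodule.span_le.2 ?_) ?_
  · rintro U ⟨V, hV, hV', a, b, rfl⟩
    rw [slice_eq_blow]
    refine ⟨_, fun a' b' => ?_, rfl⟩
    split_ifs
    exacts [⟨hV, hV'⟩, Submodule.zero_mem _]
  · rintro _ ⟨f, hf, rfl⟩
    rw [blow_eq_sum h]
    exact Submodule.sum_mem _ fun a _ => Submodule.sum_mem _ fun b _ =>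
      Submodule.subset_span ⟨_, (hf a b).1, (hf a b).2, a, b, rfl⟩

/-- The vertices of the induced problem. -/
def inducedVert (𝔄 : MatrixBimoduleProblem k) (π : Fin t' → Fin 𝔄.t) (l : 𝔄.leads)
    (kind : Λ → κ) (ℓ : Fin t' → Λ) : Setoid (Fin t') where
  r x y := kind (ℓ x) = kind (ℓ y) ∧
    (𝔄.vert.r (π x) (π y) ∨
      ((𝔄.vert.r (π x) l.1.1 ∨ 𝔄.vert.r (π x) l.1.2) ∧
        (𝔄.vert.r (π y) l.1.1 ∨ 𝔄.vert.r (π y) l.1.2)))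
  iseqv :=
    { refl := fun x => ⟨rfl, Or.inl (vert_refl _ _)⟩
      symm := fun h => ⟨h.1.symm, h.2.imp vert_symm And.symm⟩
      trans := by
        rintro x y w ⟨h1, h2⟩ ⟨h3, h4⟩
        refine ⟨h1.trans h3, ?_⟩
        rcases h2 with h2 | h2 <;> rcases h4 with h4 | h4
        · exact Or.inl (vert_trans h2 h4)
        · refine Or.inr ⟨h4.1.imp ?_ ?_, h4.2⟩ <;> exact fun h => vert_trans h2 h
        · refine Or.inr ⟨h2.1, h2.2.imp ?_ ?_⟩ <;> exact fun h => vert_trans (vert_symm h4) h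
        · exact Or.inr ⟨h2.1, h4.2⟩ }

end Induce

end MatrixBimoduleProblem

namespace MatrixBimoduleProblem

variable {k : Type*} [Field k] {𝔄 : MatrixBimoduleProblem k}

section Induce

variable {t' : ℕ} {π : Fin t' → Fin 𝔄.t} {l : 𝔄.leads} {Λ κ : Type*} {lt : Λ → Λ → Prop}
  {lab : Fin 𝔄.t → Finset Λ} {kind : Λ → κ} {G : Λ → Λ → k} {ℓ : Fin t' → Λ}

namespace Inducible

theorem restrictLabels_mem_K1 (h : 𝔄.Inducible π l lt lab kind G ℓ)
    {f : Λ → Λ → Matrix (Fin 𝔄.t) (Fin 𝔄.t) k} (hf : ∀ a b, f a b ∈ 𝔄.K1) (a b : Λ) :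
    restrictLabels lab f a b ∈ 𝔄.K1 :=
  K1_scaleBy (hf a b) (fun i j hij => by rw [h.lab_vert i j hij])
    fun i j hij => by rw [h.lab_vert i j hij]

/-- Left multiplication by `⊕ F_W ∗ E_W` on blown-up matrices with blocks in a scaling-stable
space. -/
theorem diagStar_mul_blow (h : 𝔄.Inducible π l lt lab kind G ℓ)
    {N : Submodule k (Matrix (Fin 𝔄.t) (Fin 𝔄.t) k)}
    (hN : ∀ U ∈ N, ∀ f g : Fin 𝔄.t → k, (∀ i j, 𝔄.vert.r i j → f i = f j) →
      (∀ i j, 𝔄.vert.r i j → g i = g j) → scaleBy f g U ∈ N)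
    {F : Fin 𝔄.t → Λ → Λ → k} (hF : 𝔄.IsUpperEndo lt lab l G F)
    {f : Λ → Λ → Matrix (Fin 𝔄.t) (Fin 𝔄.t) k} (hf : ∀ a b, f a b ∈ N) :
    ∃ g, (∀ a b, g a b ∈ N) ∧ diagStar π ℓ F * blow π ℓ f = blow π ℓ g := by
  classical
  refine ⟨fun a b => ∑ c ∈ Finset.univ.biUnion lab,
    scaleBy (fun i => if c ∈ lab i then F i a c else 0) (fun _ => 1) (f c b), fun a b =>
      N.sum_mem fun c _ => hN _ (hf c b) _ _ (fun i j hij => ?_) (fun _ _ _ => rfl), ?_⟩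
  · rw [h.lab_vert i j hij, hF.vert i j hij]
  · ext x y
    rw [diagStar_mul_blow_apply h.blowUp, sum_labels_eq, blow_apply, Matrix.sum_apply]
    refine Finset.sum_congr rfl fun c _ => ?_
    simp only [scaleBy, Matrix.of_apply, mul_one, ite_mul, zero_mul]

theorem blow_mul_diagStar (h : 𝔄.Inducible π l lt lab kind G ℓ)
    {N : Submodule k (Matrix (Fin 𝔄.t) (Fin 𝔄.t) k)}
    (hN : ∀ U ∈ N, ∀ f g : Fin 𝔄.t → k, (∀ i j, 𝔄.vert.r i j → f i = f j) →
      (∀ i j, 𝔄.vert.r i j → g i = g j) → scaleBy f g U ∈ N)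
    {F : Fin 𝔄.t → Λ → Λ → k} (hF : 𝔄.IsUpperEndo lt lab l G F)
    {f : Λ → Λ → Matrix (Fin 𝔄.t) (Fin 𝔄.t) k} (hf : ∀ a b, f a b ∈ N) :
    ∃ g, (∀ a b, g a b ∈ N) ∧ blow π ℓ f * diagStar π ℓ F = blow π ℓ g := by
  classical
  refine ⟨fun a b => ∑ c ∈ Finset.univ.biUnion lab,
    scaleBy (fun _ => 1) (fun j => if c ∈ lab j then F j c b else 0) (f a c), fun a b =>
      N.sum_mem fun c _ => hN _ (hf a c) _ _ (fun _ _ _ => rfl) (fun i j hij => ?_), ?_⟩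
  · rw [h.lab_vert i j hij, hF.vert i j hij]
  · ext x y
    rw [blow_mul_diagStar_apply h.blowUp, sum_labels_eq, blow_apply, Matrix.sum_apply]
    refine Finset.sum_congr rfl fun c _ => ?_
    simp only [scaleBy, Matrix.of_apply, one_mul, mul_ite, mul_zero]

theorem blow_mul_blow (h : 𝔄.Inducible π l lt lab kind G ℓ)
    {N₁ N₂ N : Submodule k (Matrix (Fin 𝔄.t) (Fin 𝔄.t) k)}
    (hN : ∀ U ∈ N₁, ∀ f g : Fin 𝔄.t → k, (∀ i j, 𝔄.vert.r i j → f i = f j) →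
      (∀ i j, 𝔄.vert.r i j → g i = g j) → scaleBy f g U ∈ N₁)
    (hmul : ∀ V ∈ N₁, ∀ W ∈ N₂, V * W ∈ N)
    {f g : Λ → Λ → Matrix (Fin 𝔄.t) (Fin 𝔄.t) k} (hf : ∀ a b, f a b ∈ N₁)
    (hg : ∀ a b, g a b ∈ N₂) :
    ∃ g', (∀ a b, g' a b ∈ N) ∧ blow π ℓ f * blow π ℓ g = blow π ℓ g' := by
  classical
  refine ⟨fun a b => ∑ c ∈ Finset.univ.biUnion lab, restrictLabels lab f a c * g c b,
    fun a b => N.sum_mem fun c _ => hmul _ ?_ _ (hg c b), ?_⟩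
  · exact hN _ (hf a c) _ _ (fun i j hij => by rw [h.lab_vert i j hij])
      fun i j hij => by rw [h.lab_vert i j hij]
  · rw [← blow_restrictLabels h.blowUp f]
    ext x y
    rw [blow_mul_blow_apply h.blowUp _ _
      (fun a c b i j m hc => by rw [restrictLabels_right _ hc, zero_mul]), blow_apply,
      Matrix.sum_apply]

theorem inducedK1_upper (h : 𝔄.Inducible π l lt lab kind G ℓ) {U : Matrix (Fin t') (Fin t') k}
    (hU : U ∈ 𝔄.inducedK1 π l lt lab G ℓ) (x y : Fin t') (hxy : y ≤ x) : U x y = 0 := by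
  obtain ⟨F, f, hF, hf, rfl⟩ := hU
  rw [Matrix.add_apply, diagStar_apply, blow_apply,
    𝔄.K1_upper _ (hf _ _) _ _ (h.blowUp.mono hxy), add_zero]
  split_ifs with hπ
  · by_contra hne
    have := hF.upper _ _ (h.blowUp.mem x) _ (hπ ▸ h.blowUp.mem y) hne
    exact absurd ((h.blowUp.order x y).2 (Or.inr ⟨hπ, this⟩)) (not_lt.2 hxy)
  · rfl

theorem inducedK1_mul [IsTrans Λ lt] (h : 𝔄.Inducible π l lt lab kind G ℓ)
    {U W : Matrix (Fin t') (Fin t') k}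
    (hU : U ∈ 𝔄.inducedK1 π l lt lab G ℓ) (hW : W ∈ 𝔄.inducedK1 π l lt lab G ℓ) :
    U * W ∈ 𝔄.inducedK1 π l lt lab G ℓ := by
  obtain ⟨F, f, hF, hf, rfl⟩ := hU
  obtain ⟨F', f', hF', hf', rfl⟩ := hW
  obtain ⟨g₁, hg₁, e₁⟩ := h.diagStar_mul_blow (N := 𝔄.K1)
    (fun U hU f g hf hg => K1_scaleBy hU hf hg) hF hf'
  obtain ⟨g₂, hg₂, e₂⟩ := h.blow_mul_diagStar (N := 𝔄.K1)
    (fun U hU f g hf hg => K1_scaleBy hU hf hg) hF' hf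
  obtain ⟨g₃, hg₃, e₃⟩ := h.blow_mul_blow (N₁ := 𝔄.K1)
    (fun U hU f g hf hg => K1_scaleBy hU hf hg) 𝔄.K1_mul hf hf'
  refine ⟨_, fun a b => g₁ a b + g₂ a b + g₃ a b, hF.mul h.lab_vert hF', fun a b =>
    𝔄.K1.add_mem (𝔄.K1.add_mem (hg₁ a b) (hg₂ a b)) (hg₃ a b), ?_⟩
  rw [add_mul, mul_add, mul_add, diagStar_mul_diagStar h.blowUp, e₁, e₂, e₃]
  ext x y
  simp only [Matrix.add_apply, blow_apply]
  ring

theorem inducedK1_mul_M1 (h : 𝔄.Inducible π l lt lab kind G ℓ)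
    {U W : Matrix (Fin t') (Fin t') k}
    (hU : U ∈ 𝔄.inducedK1 π l lt lab G ℓ) (hW : W ∈ 𝔄.inducedM1 π l ℓ) :
    U * W ∈ 𝔄.inducedM1 π l ℓ := by
  obtain ⟨F, f, hF, hf, rfl⟩ := hU
  obtain ⟨f', hf', rfl⟩ := hW
  obtain ⟨g₁, hg₁, e₁⟩ := h.diagStar_mul_blow (N := 𝔄.M1Off l)
    (fun U hU f g hf hg => M1Off_scaleBy hU hf hg) hF hf'
  obtain ⟨g₃, hg₃, e₃⟩ := h.blow_mul_blow (N₁ := 𝔄.K1) (N₂ := 𝔄.M1Off l) (N := 𝔄.M1Off l)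
    (fun U hU f g hf hg => K1_scaleBy hU hf hg)
    (fun V hV W hW => ⟨mul_mem_M1 hV hW.1, h.first.mul_apply hV hW.1⟩) hf hf'
  rw [add_mul, e₁, e₃]
  exact Submodule.add_mem _ ⟨g₁, hg₁, rfl⟩ ⟨g₃, hg₃, rfl⟩

theorem inducedM1_mul_K1 (h : 𝔄.Inducible π l lt lab kind G ℓ)
    {U W : Matrix (Fin t') (Fin t') k}
    (hU : U ∈ 𝔄.inducedK1 π l lt lab G ℓ) (hW : W ∈ 𝔄.inducedM1 π l ℓ) :
    W * U ∈ 𝔄.inducedM1 π l ℓ := by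
  obtain ⟨F, f, hF, hf, rfl⟩ := hU
  obtain ⟨f', hf', rfl⟩ := hW
  obtain ⟨g₁, hg₁, e₁⟩ := h.blow_mul_diagStar (N := 𝔄.M1Off l)
    (fun U hU f g hf hg => M1Off_scaleBy hU hf hg) hF hf'
  obtain ⟨g₃, hg₃, e₃⟩ := h.blow_mul_blow (N₁ := 𝔄.M1Off l) (N₂ := 𝔄.K1) (N := 𝔄.M1Off l)
    (fun U hU f g hf hg => M1Off_scaleBy hU hf hg)
    (fun V hV W hW => ⟨M1_mul_mem hW hV.1, h.first.apply_mul hW hV.1⟩) hf' hf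
  rw [mul_add, e₁, e₃]
  exact Submodule.add_mem _ ⟨g₁, hg₁, rfl⟩ ⟨g₃, hg₃, rfl⟩

/-- Both parts of the normal form can be cut down separately. For F the relation `F_X G = G F_Y`
survives, because G only relates labels of equal kind and the two ends of the first arrow belong to
the same new vertices. -/
theorem inducedK1_corner (h : 𝔄.Inducible π l lt lab kind G ℓ) {U : Matrix (Fin t') (Fin t') k}
    (hU : U ∈ 𝔄.inducedK1 π l lt lab G ℓ) (x y : Fin t') :
    corner (𝔄.inducedVert π l kind ℓ) x y U ∈ 𝔄.inducedK1 π l lt lab G ℓ := by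
  classical
  obtain ⟨F, f, hF, hf, rfl⟩ := hU
  -- `P x i` is the part of "equivalent to x" that concerns only the old index i: i lies in the
  -- vertex of `π x`, or both lie in X ∪ Y.
  obtain ⟨P, hPdef⟩ : ∃ P : Fin t' → Fin 𝔄.t → Prop, ∀ x i, P x i ↔ (𝔄.vert.r i (π x) ∨
      ((𝔄.vert.r i l.1.1 ∨ 𝔄.vert.r i l.1.2) ∧
        (𝔄.vert.r (π x) l.1.1 ∨ 𝔄.vert.r (π x) l.1.2))) := ⟨_, fun _ _ => Iff.rfl⟩
  have hP : ∀ x i j, 𝔄.vert.r i j → (P x i ↔ P x j) := by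
    intro x i j hij
    simp only [hPdef, vert_congr_left hij]
  have hPl : ∀ x, P x l.1.1 ↔ P x l.1.2 := by
    have key : ∀ x m, 𝔄.vert.r m l.1.1 ∨ 𝔄.vert.r m l.1.2 →
        (P x m ↔ (𝔄.vert.r (π x) l.1.1 ∨ 𝔄.vert.r (π x) l.1.2)) := by
      intro x m hm
      rw [hPdef]
      constructor
      · rintro (h1 | h1)
        · exact hm.imp (vert_trans (vert_symm h1)) (vert_trans (vert_symm h1))
        · exact h1.2
      · exact fun h1 => Or.inr ⟨hm, h1⟩
    intro x
    rw [key x _ (Or.inl (vert_refl _ _)), key x _ (Or.inr (vert_refl _ _))]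
  refine ⟨fun i a b => if (kind a = kind (ℓ x) ∧ P x i) ∧ (kind b = kind (ℓ y) ∧ P y i)
      then F i a b else 0,
    fun a b => scaleBy (fun i => if kind a = kind (ℓ x) ∧ P x i then 1 else 0)
      (fun j => if kind b = kind (ℓ y) ∧ P y j then 1 else 0) (f a b), ?_, fun a b => ?_, ?_⟩
  · constructor
    · intro i j hij
      simp only [hF.vert i j hij, hP _ i j hij]
    · intro i a ha b hb hne
      split_ifs at hne
      · exact hF.upper i a ha b hb hne
      · exact absurd rfl hne
    · intro a ha b hb
      have e1 : ∀ c, (if (kind a = kind (ℓ x) ∧ P x l.1.1) ∧ (kind c = kind (ℓ y) ∧ P y l.1.1)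
          then F l.1.1 a c else 0) * G c b =
          (if (kind a = kind (ℓ x) ∧ P x l.1.1) ∧ (kind b = kind (ℓ y) ∧ P y l.1.1) then 1 else 0) *
          (F l.1.1 a c * G c b) := by
        intro c
        by_cases hG : G c b = 0
        · simp [hG]
        · rw [h.kind_G c b hG]
          split_ifs <;> simp
      have e2 : ∀ c, G a c * (if (kind c = kind (ℓ x) ∧ P x l.1.2) ∧
          (kind b = kind (ℓ y) ∧ P y l.1.2) then F l.1.2 c b else 0) =
          (if (kind a = kind (ℓ x) ∧ P x l.1.1) ∧ (kind b = kind (ℓ y) ∧ P y l.1.1) then 1 else 0) *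
          (G a c * F l.1.2 c b) := by
        intro c
        by_cases hG : G a c = 0
        · simp [hG]
        · simp only [h.kind_G a c hG, hPl]
          split_ifs <;> simp
      simp only [e1, e2, ← Finset.mul_sum, hF.comm a ha b hb]
  · refine K1_scaleBy (hf a b) ?_ ?_
    all_goals
      intro i j hij
      simp only [hP _ i j hij]
  · ext u v
    have hr : ∀ u x, (𝔄.inducedVert π l kind ℓ).r u x ↔ kind (ℓ u) = kind (ℓ x) ∧ P x (π u) :=
      fun u x => by rw [hPdef]; rfl
    simp only [corner, Matrix.of_apply, hr, Matrix.add_apply, diagStar_apply, blow_apply, scaleBy]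
    by_cases h3 : π u = π v
    · by_cases h1 : kind (ℓ u) = kind (ℓ x) ∧ P x (π v) <;>
        by_cases h2 : kind (ℓ v) = kind (ℓ y) ∧ P y (π v) <;> simp [h1, h2, h3]
    · by_cases h1 : kind (ℓ u) = kind (ℓ x) ∧ P x (π u) <;>
        by_cases h2 : kind (ℓ v) = kind (ℓ y) ∧ P y (π v) <;> simp [h1, h2, h3]

end Inducible

open Classical in
/-- The matrix `H` of the induced problem. -/
noncomputable def inducedH (𝔄 : MatrixBimoduleProblem k) (π : Fin t' → Fin 𝔄.t) (l : 𝔄.leads)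
    (G : Λ → Λ → k) (ℓ : Fin t' → Λ) : Matrix (Fin t') (Fin t') k :=
  blow π ℓ fun a b => (if a = b then 𝔄.H else 0) + G a b • 𝔄.A l

/-- The part `⊕ F_W * E_W` commutes with the new `H`: with `I * H` because F is constant on
vertices, with `G * A_l` because `F_X G = G F_Y`. For the blown-up part the coefficient of `A_l`
vanishes, by `δ(a_l) = 0` in the terms from `H` and by the minimality of `a_l` in those from `A_l`.
-/
theorem Inducible.d_mem (h : 𝔄.Inducible π l lt lab kind G ℓ) {U : Matrix (Fin t') (Fin t') k}
    (hU : U ∈ 𝔄.inducedK1 π l lt lab G ℓ) :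
    U * 𝔄.inducedH π l G ℓ - 𝔄.inducedH π l G ℓ * U ∈ 𝔄.inducedM1 π l ℓ := by
  classical
  obtain ⟨F, f, hF, hf, rfl⟩ := hU
  have hdiag : diagStar π ℓ F * 𝔄.inducedH π l G ℓ - 𝔄.inducedH π l G ℓ * diagStar π ℓ F = 0 := by
    ext x y
    rw [Matrix.sub_apply, inducedH, diagStar_mul_blow_apply h.blowUp,
      blow_mul_diagStar_apply h.blowUp, Matrix.zero_apply, sub_eq_zero]
    simp only [Matrix.add_apply, Matrix.smul_apply, smul_eq_mul, mul_add, add_mul,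
      Finset.sum_add_distrib]
    congr 1
    · by_cases hH : 𝔄.H (π x) (π y) = 0
      · have : ∀ c d : Λ, (if c = d then 𝔄.H else 0) (π x) (π y) = 0 := by
          intro c d; split_ifs <;> simp [hH]
        simp [this]
      · have hv := 𝔄.H_vert _ _ hH
        have e : ∀ c d : Λ, (if c = d then 𝔄.H else 0) (π x) (π y) =
            if c = d then 𝔄.H (π x) (π y) else 0 := by
          intro c d; split_ifs <;> simp
        simp only [e, mul_ite, ite_mul, mul_zero, zero_mul, Finset.sum_ite_eq, Finset.sum_ite_eq']
        rw [h.lab_vert _ _ hv, if_pos (h.blowUp.mem y), if_pos (h.lab_vert _ _ hv ▸ h.blowUp.mem x),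
          hF.vert _ _ hv]
        ring
    · by_cases hA : 𝔄.A l (π x) (π y) = 0
      · simp [hA]
      · obtain ⟨h1, h2⟩ := A_vert hA
        have := hF.comm (ℓ x) (h.lab_vert _ _ h1 ▸ h.blowUp.mem x) (ℓ y)
          (h.lab_vert _ _ h2 ▸ h.blowUp.mem y)
        rw [hF.vert _ _ h1, hF.vert _ _ h2, h.lab_vert _ _ h1, h.lab_vert _ _ h2]
        simp only [← mul_assoc, ← Finset.sum_mul, this, mul_right_comm _ (𝔄.A l _ _)]
  have hsplit : (diagStar π ℓ F + blow π ℓ f) * 𝔄.inducedH π l G ℓ -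
      𝔄.inducedH π l G ℓ * (diagStar π ℓ F + blow π ℓ f) =
      (diagStar π ℓ F * 𝔄.inducedH π l G ℓ - 𝔄.inducedH π l G ℓ * diagStar π ℓ F) +
      (blow π ℓ f * 𝔄.inducedH π l G ℓ - 𝔄.inducedH π l G ℓ * blow π ℓ f) := by
    rw [add_mul, mul_add]; abel
  rw [hsplit, hdiag, zero_add, ← blow_restrictLabels h.blowUp f]
  set f' := restrictLabels lab f with hf'
  have hfm : ∀ a b, f' a b ∈ 𝔄.K1 := h.restrictLabels_mem_K1 hf
  refine ⟨fun a b => (f' a b * 𝔄.H - 𝔄.H * f' a b) +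
    ∑ c ∈ Finset.univ.biUnion lab, (G c b • (f' a c * 𝔄.A l) - G a c • (𝔄.A l * f' c b)),
    fun a b => Submodule.add_mem _ ⟨𝔄.d_mem _ (hfm a b), ?_⟩
      (Submodule.sum_mem _ fun c _ => Submodule.sub_mem _ (Submodule.smul_mem _ _ ?_)
        (Submodule.smul_mem _ _ ?_)), ?_⟩
  · exact deltaFirst_eq_zero_iff.1 h.delta _ (hfm a b)
  · exact ⟨mul_mem_M1 (hfm _ _) (A_mem_M1 l), h.first.mul_apply (hfm _ _) (A_mem_M1 l)⟩
  · exact ⟨M1_mul_mem (hfm _ _) (A_mem_M1 l), h.first.apply_mul (hfm _ _) (A_mem_M1 l)⟩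
  · ext x y
    have hC : ∀ x, ℓ x ∈ Finset.univ.biUnion lab := fun x =>
      Finset.mem_biUnion.2 ⟨_, Finset.mem_univ _, h.blowUp.mem x⟩
    rw [Matrix.sub_apply, inducedH, blow_mul_blow_apply h.blowUp _ _
      (fun a c b i j m hc => by rw [hf', restrictLabels_right _ hc, zero_mul]),
      blow_mul_blow_apply h.blowUp _ _
      (fun a c b i j m hc => by rw [hf', restrictLabels_left _ hc, mul_zero]), blow_apply]
    have e1 : ∀ c, (f' (ℓ x) c * ((if c = ℓ y then 𝔄.H else 0) + G c (ℓ y) • 𝔄.A l)) (π x) (π y) =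
        (if c = ℓ y then (f' (ℓ x) (ℓ y) * 𝔄.H) (π x) (π y) else 0) +
          (G c (ℓ y) • (f' (ℓ x) c * 𝔄.A l)) (π x) (π y) := by
      intro c
      rw [mul_add, Matrix.mul_smul, Matrix.add_apply]
      split_ifs with hc
      · rw [hc]
      · simp
    have e2 : ∀ c, (((if ℓ x = c then 𝔄.H else 0) + G (ℓ x) c • 𝔄.A l) * f' c (ℓ y)) (π x) (π y) =
        (if ℓ x = c then (𝔄.H * f' (ℓ x) (ℓ y)) (π x) (π y) else 0) +
          (G (ℓ x) c • (𝔄.A l * f' c (ℓ y))) (π x) (π y) := by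
      intro c
      rw [add_mul, Matrix.smul_mul, Matrix.add_apply]
      split_ifs with hc
      · rw [hc]
      · simp
    simp only [e1, e2, Finset.sum_add_distrib, Finset.sum_ite_eq, Finset.sum_ite_eq', hC, if_true,
      Matrix.add_apply, Matrix.sub_apply, Matrix.sum_apply, Finset.sum_sub_distrib]
    ring

end Induce

end MatrixBimoduleProblem

namespace MatrixBimoduleProblem

variable {k : Type*} [Field k] {𝔄 : MatrixBimoduleProblem k}

section Induce

variable {t' : ℕ} {π : Fin t' → Fin 𝔄.t} {l : 𝔄.leads} {Λ κ : Type*} {lt : Λ → Λ → Prop}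
  {lab : Fin 𝔄.t → Finset Λ} {kind : Λ → κ} {G : Λ → Λ → k} {ℓ : Fin t' → Λ}

/-- The positions over the leading positions other than that of `A_l`. -/
def inducedLeads (𝔄 : MatrixBimoduleProblem k) (π : Fin t' → Fin 𝔄.t) (l : 𝔄.leads) :
    Finset (Fin t' × Fin t') :=
  Finset.univ.filter fun m => (π m.1, π m.2) ∈ 𝔄.leads ∧ (π m.1, π m.2) ≠ l.1

theorem mem_inducedLeads {m : Fin t' × Fin t'} :
    m ∈ 𝔄.inducedLeads π l ↔ (π m.1, π m.2) ∈ 𝔄.leads ∧ (π m.1, π m.2) ≠ l.1 := by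
  simp [inducedLeads]

/-- The base matrices of the induced problem. -/
noncomputable def inducedA (𝔄 : MatrixBimoduleProblem k) (π : Fin t' → Fin 𝔄.t) (l : 𝔄.leads)
    (ℓ : Fin t' → Λ) (m : 𝔄.inducedLeads π l) : Matrix (Fin t') (Fin t') k :=
  slice π ℓ (ℓ m.1.1) (ℓ m.1.2) (𝔄.A ⟨(π m.1.1, π m.1.2), (mem_inducedLeads.1 m.2).1⟩)

theorem inducedA_ne_zero {m : 𝔄.inducedLeads π l} {x y : Fin t'}
    (h : 𝔄.inducedA π l ℓ m x y ≠ 0) : ℓ x = ℓ m.1.1 ∧ ℓ y = ℓ m.1.2 ∧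
      𝔄.A ⟨(π m.1.1, π m.1.2), (mem_inducedLeads.1 m.2).1⟩ (π x) (π y) ≠ 0 := by
  classical
  rw [inducedA, slice_apply] at h
  split_ifs at h with h1
  · exact ⟨h1.1, h1.2, h⟩
  · exact absurd rfl h

theorem inducedA_of_label {m : 𝔄.inducedLeads π l} {x y : Fin t'} (hx : ℓ x = ℓ m.1.1)
    (hy : ℓ y = ℓ m.1.2) : 𝔄.inducedA π l ℓ m x y =
      𝔄.A ⟨(π m.1.1, π m.1.2), (mem_inducedLeads.1 m.2).1⟩ (π x) (π y) := by
  classical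
  rw [inducedA, slice_apply, if_pos ⟨hx, hy⟩]

theorem Inducible.span_inducedA (h : 𝔄.Inducible π l lt lab kind G ℓ) :
    Submodule.span k (Set.range (𝔄.inducedA π l ℓ)) = 𝔄.inducedM1 π l ℓ := by
  classical
  rw [← span_eq_inducedM1 h.blowUp]
  refine le_antisymm (Submodule.span_le.2 ?_) (Submodule.span_le.2 ?_)
  · rintro _ ⟨m, rfl⟩
    have hm := mem_inducedLeads.1 m.2
    exact Submodule.subset_span ⟨_, A_mem_M1 _, 𝔄.A_zero l ⟨_, hm.1⟩
      fun hc => hm.2 (congrArg Subtype.val hc).symm, _, _, rfl⟩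
  · rintro _ ⟨B, hB, hB', a, b, rfl⟩
    have hmem := M1Off_repr (l := l) ⟨hB, hB'⟩
    refine Submodule.span_induction (p := fun B _ => slice π ℓ a b B ∈
      Submodule.span k (Set.range (𝔄.inducedA π l ℓ))) ?_ ?_ ?_ ?_ hmem
    · rintro _ ⟨l', hl', rfl⟩
      by_cases hex : a ∈ lab l'.1.1 ∧ b ∈ lab l'.1.2
      · obtain ⟨x, hx, rfl⟩ := (h.blowUp.labels _ _).1 hex.1
        obtain ⟨y, hy, rfl⟩ := (h.blowUp.labels _ _).1 hex.2
        refine Submodule.subset_span ⟨⟨(x, y), mem_inducedLeads.2 ?_⟩, ?_⟩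
        · simp only [hx, hy]
          exact ⟨l'.2, fun hc => hl' (Subtype.ext hc)⟩
        · simp only [inducedA, hx, hy]
      -- `A_l'` lies in one corner, and all rows (columns) of that corner carry the same labels. If
      -- a or b is not among them, the slice is empty.
      · have : slice π ℓ a b (𝔄.A l') = 0 := by
          ext x y
          rw [slice_apply, Matrix.zero_apply]
          split_ifs with hxy
          · by_contra hA
            obtain ⟨h1, h2⟩ := A_vert hA
            refine hex ⟨?_, ?_⟩
            · rw [← h.lab_vert _ _ h1, ← hxy.1]; exact h.blowUp.mem x
            · rw [← h.lab_vert _ _ h2, ← hxy.2]; exact h.blowUp.mem y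
          · rfl
        rw [this]
        exact Submodule.zero_mem _
    · rw [slice_zero]; exact Submodule.zero_mem _
    · intro U V _ _ hU hV
      rw [slice_add]; exact Submodule.add_mem _ hU hV
    · intro c U _ hU
      rw [slice_smul]; exact Submodule.smul_mem _ _ hU

open Classical in
theorem inducedH_apply (x y : Fin t') : 𝔄.inducedH π l G ℓ x y =
    (if ℓ x = ℓ y then 𝔄.H (π x) (π y) else 0) + G (ℓ x) (ℓ y) * 𝔄.A l (π x) (π y) := by
  simp only [inducedH, blow_apply, Matrix.add_apply, Matrix.smul_apply, smul_eq_mul]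
  split_ifs <;> rfl

theorem inducedH_vert (h : 𝔄.Inducible π l lt lab kind G ℓ) {x y : Fin t'}
    (hne : 𝔄.inducedH π l G ℓ x y ≠ 0) : (𝔄.inducedVert π l kind ℓ).r x y := by
  classical
  simp only [inducedH, blow_apply, Matrix.add_apply, Matrix.smul_apply, smul_eq_mul] at hne
  by_cases h1 : G (ℓ x) (ℓ y) * 𝔄.A l (π x) (π y) = 0
  · rw [h1, add_zero] at hne
    split_ifs at hne with h2
    · exact ⟨by rw [h2], Or.inl (𝔄.H_vert _ _ hne)⟩
    · exact absurd rfl hne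
  · obtain ⟨h2, h3⟩ := A_vert (right_ne_zero_of_mul h1)
    exact ⟨h.kind_G _ _ (left_ne_zero_of_mul h1), Or.inr ⟨Or.inl h2, Or.inr h3⟩⟩

/-- The problem induced from `𝔄` by `a_l ↦ G`. -/
noncomputable def induce [IsTrans Λ lt] (h : 𝔄.Inducible π l lt lab kind G ℓ) :
    MatrixBimoduleProblem k where
  t := t'
  vert := 𝔄.inducedVert π l kind ℓ
  K1 := 𝔄.inducedK1 π l lt lab G ℓ
  leads := 𝔄.inducedLeads π l
  A := 𝔄.inducedA π l ℓ
  H := 𝔄.inducedH π l G ℓ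
  K1_upper _ hV := h.inducedK1_upper hV
  K1_corner _ hV := h.inducedK1_corner hV
  K1_mul _ hV _ hW := h.inducedK1_mul hV hW
  A_lead m := by
    refine ⟨?_, fun x y hxy => ?_⟩
    · rw [inducedA_of_label rfl rfl]
      exact (𝔄.A_lead ⟨_, (mem_inducedLeads.1 m.2).1⟩).1
    · obtain ⟨h1, h2, h3⟩ := inducedA_ne_zero hxy
      rcases (𝔄.A_lead _).2 _ _ h3 with h4 | ⟨h4, h5⟩
      · exact Or.inl ((h.blowUp.order _ _).2 (Or.inl h4))
      · refine Or.inr ⟨h.blowUp.inj h4 h1.symm, ?_⟩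
        rcases h5.lt_or_eq with h5 | h5
        · exact le_of_lt ((h.blowUp.order _ _).2 (Or.inl h5))
        · exact (h.blowUp.inj h5 h2.symm).le
  A_one m := by
    rw [inducedA_of_label rfl rfl]
    exact 𝔄.A_one ⟨_, (mem_inducedLeads.1 m.2).1⟩
  A_zero m m' hne := by
    by_contra hc
    obtain ⟨h1, h2, h3⟩ := inducedA_ne_zero hc
    refine hne (Subtype.ext (Prod.ext ?_ ?_))
    all_goals
      have h4 : (⟨(π m.1.1, π m.1.2), (mem_inducedLeads.1 m.2).1⟩ : 𝔄.leads) =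
          ⟨(π m'.1.1, π m'.1.2), (mem_inducedLeads.1 m'.2).1⟩ := by
        by_contra h5
        exact h3 (𝔄.A_zero _ _ h5)
      simp only [Subtype.mk.injEq, Prod.mk.injEq] at h4
    · exact h.blowUp.inj h4.1 h1
    · exact h.blowUp.inj h4.2 h2
  A_corner m := by
    ext x y
    simp only [corner, Matrix.of_apply]
    split_ifs with hc
    · rfl
    · by_contra hne
      obtain ⟨h1, h2, h3⟩ := inducedA_ne_zero (Ne.symm hne)
      obtain ⟨h4, h5⟩ := A_vert h3
      exact hc ⟨⟨by rw [h1], Or.inl h4⟩, ⟨by rw [h2], Or.inl h5⟩⟩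
  K1_mul_A V hV m := by
    rw [h.span_inducedA]
    exact h.inducedK1_mul_M1 hV (h.span_inducedA ▸ Submodule.subset_span ⟨m, rfl⟩)
  A_mul_K1 V hV m := by
    rw [h.span_inducedA]
    exact h.inducedM1_mul_K1 hV (h.span_inducedA ▸ Submodule.subset_span ⟨m, rfl⟩)
  H_vert _ _ hne := inducedH_vert h hne
  d_mem V hV := by
    rw [h.span_inducedA]
    exact h.d_mem hV

theorem isInduced_induce [IsTrans Λ lt] (h : 𝔄.Inducible π l lt lab kind G ℓ) :
    IsInduced 𝔄 (induce h) π l lt lab kind G ℓ where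
  first := h.first
  delta := h.delta
  order := h.blowUp.order
  labels := h.blowUp.labels
  vert _ _ := Iff.rfl
  K1 := (span_eq_inducedK1 h.blowUp).symm
  M1 := h.span_inducedA.trans (span_eq_inducedM1 h.blowUp).symm
  H_eq x y := by
    refine ⟨fun hxy => (inducedH_apply x y).trans ?_, fun hxy => (inducedH_apply x y).trans ?_⟩
    · rw [if_pos hxy]
    · rw [if_neg hxy, zero_add]

end Induce

/-! ### Normal forms and leading positions after a reduction -/

section Induced

variable {𝔅 : MatrixBimoduleProblem k} {π : Fin 𝔅.t → Fin 𝔄.t} {l : 𝔄.leads} {Λ κ : Type*}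
  {lt : Λ → Λ → Prop} {lab : Fin 𝔄.t → Finset Λ} {kind : Λ → κ} {G : Λ → Λ → k}
  {ℓ : Fin 𝔅.t → Λ}

theorem IsInduced.isBlowUp (h : IsInduced 𝔄 𝔅 π l lt lab kind G ℓ) : IsBlowUp lt lab π ℓ :=
  ⟨h.order, h.labels⟩

theorem IsInduced.mem_K1 (h : IsInduced 𝔄 𝔅 π l lt lab kind G ℓ)
    {U : Matrix (Fin 𝔅.t) (Fin 𝔅.t) k} : U ∈ 𝔅.K1 ↔ ∃ F f, 𝔄.IsUpperEndo lt lab l G F ∧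
      (∀ a b, f a b ∈ 𝔄.K1) ∧ U = diagStar π ℓ F + blow π ℓ f := by
  rw [h.K1, span_eq_inducedK1 h.isBlowUp]
  rfl

theorem IsInduced.mem_M1 (h : IsInduced 𝔄 𝔅 π l lt lab kind G ℓ)
    {U : Matrix (Fin 𝔅.t) (Fin 𝔅.t) k} : U ∈ 𝔅.M1 ↔ ∃ f, (∀ a b, f a b ∈ 𝔄.M1Off l) ∧
      U = blow π ℓ f := by
  rw [h.M1, span_eq_inducedM1 h.isBlowUp]
  rfl

open Classical in
theorem IsInduced.H_apply (h : IsInduced 𝔄 𝔅 π l lt lab kind G ℓ) (x y : Fin 𝔅.t) :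
    𝔅.H x y = (if ℓ x = ℓ y then 𝔄.H (π x) (π y) else 0) +
      G (ℓ x) (ℓ y) * 𝔄.A l (π x) (π y) := by
  split_ifs with hxy
  · exact (h.H_eq x y).1 hxy
  · rw [zero_add]; exact (h.H_eq x y).2 hxy

/-- The leads depend on ℳ₁ alone, and `induce` has the same ℳ₁ and explicitly known leads. -/
theorem IsInduced.mem_leads [IsTrans Λ lt] (h : IsInduced 𝔄 𝔅 π l lt lab kind G ℓ)
    (hlab : ∀ i j, 𝔄.vert.r i j → lab i = lab j) (hkind : ∀ a b, G a b ≠ 0 → kind a = kind b)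
    (m : Fin 𝔅.t × Fin 𝔅.t) :
    m ∈ 𝔅.leads ↔ (π m.1, π m.2) ∈ 𝔄.leads ∧ (π m.1, π m.2) ≠ l.1 := by
  have hi : 𝔄.Inducible π l lt lab kind G ℓ := ⟨h.isBlowUp, h.first, h.delta, hlab, hkind⟩
  have hM : (induce hi).M1 = 𝔅.M1 :=
    (isInduced_induce hi).M1.trans h.M1.symm
  rw [mem_leads_iff, ← mem_inducedLeads (𝔄 := 𝔄) (π := π) (l := l)]
  have := mem_leads_iff (𝔄 := induce hi) (x := m)
  rw [hM] at this
  exact this.symm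

end Induced

theorem IsRegularization.mem_leads {𝔅 : MatrixBimoduleProblem k} {π : Fin 𝔅.t → Fin 𝔄.t}
    {l : 𝔄.leads} (h : IsRegularization 𝔄 𝔅 π l) (m : Fin 𝔅.t × Fin 𝔅.t) :
    m ∈ 𝔅.leads ↔ (π m.1, π m.2) ∈ 𝔄.leads ∧ (π m.1, π m.2) ≠ l.1 := by
  have hpos : ∀ i j, PosLE (π m.1, π m.2) (π i, π j) ↔ PosLE m (i, j) := by
    intro i j
    simp [PosLE, h.strictMono.lt_iff_lt, h.strictMono.le_iff_le, h.strictMono.injective.eq_iff]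
  constructor
  · intro hm
    obtain ⟨U, hU, hlead⟩ := mem_leads_iff.1 hm
    obtain ⟨B, hB, hB', rfl⟩ := (h.M1 U).1 hU
    refine ⟨mem_leads_iff.2 ⟨B, hB, hlead.1, fun i j hij => ?_⟩, fun hc => hlead.1 ?_⟩
    · obtain ⟨x, rfl⟩ := h.surjective i
      obtain ⟨y, rfl⟩ := h.surjective j
      exact (hpos x y).2 (hlead.2 x y hij)
    · rw [Matrix.submatrix_apply, ← hB', ← hc]
  · rintro ⟨h1, h2⟩
    refine mem_leads_iff.2 ⟨_, (h.M1 _).2 ⟨_, A_mem_M1 ⟨_, h1⟩, 𝔄.A_zero l ⟨_, h1⟩ fun hc =>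
      h2 (congrArg Subtype.val hc).symm, rfl⟩, (𝔄.A_lead ⟨_, h1⟩).1, fun i j hij => ?_⟩
    exact (hpos i j).1 ((𝔄.A_lead ⟨_, h1⟩).2 _ _ hij)

theorem labelsAt_vert {Λ : Type*} {p q : Fin 𝔄.t} {LX LY : Finset Λ} {o : Λ} {i j : Fin 𝔄.t}
    (h : 𝔄.vert.r i j) : 𝔄.labelsAt p q LX LY o i = 𝔄.labelsAt p q LX LY o j := by
  have e₁ := vert_congr_left (m := p) h
  have e₂ := vert_congr_left (m := q) h
  unfold labelsAt
  by_cases h₁ : 𝔄.vert.r i p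
  · rw [if_pos h₁, if_pos (e₁.1 h₁)]
  · rw [if_neg h₁, if_neg fun h' => h₁ (e₁.2 h')]
    by_cases h₂ : 𝔄.vert.r i q
    · rw [if_pos h₂, if_pos (e₂.1 h₂)]
    · rw [if_neg h₂, if_neg fun h' => h₂ (e₂.2 h')]

theorem labelsAt_left {Λ : Type*} {p q : Fin 𝔄.t} {LX LY : Finset Λ} {o : Λ} {i : Fin 𝔄.t}
    (h : 𝔄.vert.r i p) : 𝔄.labelsAt p q LX LY o i = LX := by
  simp [labelsAt, h]

theorem labelsAt_right {Λ : Type*} {p q : Fin 𝔄.t} {LX LY : Finset Λ} {o : Λ} {i : Fin 𝔄.t}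
    (hpq : ¬ 𝔄.vert.r p q) (h : 𝔄.vert.r i q) : 𝔄.labelsAt p q LX LY o i = LY := by
  have : ¬ 𝔄.vert.r i p := fun h' => hpq (vert_trans (vert_symm h') h)
  simp [labelsAt, h, this]

theorem labelsAt_other {Λ : Type*} {p q : Fin 𝔄.t} {LX LY : Finset Λ} {o : Λ} {i : Fin 𝔄.t}
    (h : ¬ 𝔄.vert.r i p) (h' : ¬ 𝔄.vert.r i q) : 𝔄.labelsAt p q LX LY o i = {o} := by
  simp [labelsAt, h, h']

theorem edgeBlock_kind {a b : Fin 3} (h : edgeBlock k a b ≠ 0) : id a = id b := by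
  unfold edgeBlock at h
  split_ifs at h with h1
  · rw [h1.1, h1.2]
  · exact absurd rfl h

theorem weyrBlock_kind {a b : WeyrLabel k} (h : weyrBlock k a b ≠ 0) :
    (a.ev, a.size) = (b.ev, b.size) := by
  unfold weyrBlock at h
  split_ifs at h with h1
  · rw [h1.1, h1.2]
  · rw [h1.1, h1.2]
  · exact absurd rfl h
  · exact absurd rfl h

theorem WeyrLabel.isStrictTotalOrder [LinearOrder k] :
    IsStrictTotalOrder (WeyrLabel k) WeyrLabel.lt where
  trichotomous a b := by
    rcases a with ⟨e, s, p⟩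
    rcases b with ⟨e', s', p'⟩
    simp only [WeyrLabel.lt, WeyrLabel.mk.injEq]
    intro h1 h2
    rcases lt_trichotomy e e' with h | h | h
    · exact absurd (Or.inl h) h1
    · refine ⟨h, ?_, ?_⟩ <;> · simp [h] at h1 h2; omega
    · exact absurd (Or.inl h) h2
  irrefl a := by simp [WeyrLabel.lt]
  trans a b c := by
    rintro (h1 | ⟨h1, h2⟩) (h3 | ⟨h3, h4⟩)
    · exact Or.inl (h1.trans h3)
    · exact Or.inl (h3 ▸ h1)
    · exact Or.inl (h1 ▸ h3)
    · exact Or.inr ⟨h1.trans h3, by omega⟩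

end MatrixBimoduleProblem

/-! ### Expansions of index sets -/

/-- Each index of `Fin n` is expanded to a block of indices of `Fin m`, and `ρ` relates the indices
at the same place in the blocks over equivalent indices. -/
structure IsExpansion {n m : ℕ} (r : Setoid (Fin n)) (r' : Setoid (Fin m)) (π : Fin m → Fin n)
    (ρ : Fin m → Fin m → Prop) : Prop where
  mono : Monotone π
  surj : Function.Surjective π
  refl : ∀ x, ρ x x
  symm : ∀ x y, ρ x y → ρ y x
  trans : ∀ x y w, ρ x y → ρ y w → ρ x w
  base : ∀ x y, ρ x y → r.r (π x) (π y)
  vert : ∀ x y, ρ x y → r'.r x y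
  inj : ∀ x y, ρ x y → π x = π y → x = y
  ex : ∀ x v, r.r (π x) v → ∃ y, π y = v ∧ ρ x y
  lt : ∀ x y x' y', ρ x y → ρ x' y' → π x = π x' → π y = π y' → x < x' → y < y'

namespace IsExpansion

variable {n m p : ℕ} {r : Setoid (Fin n)} {r' : Setoid (Fin m)} {r'' : Setoid (Fin p)}
  {π : Fin m → Fin n} {ρ : Fin m → Fin m → Prop} {π' : Fin p → Fin m} {ρ' : Fin p → Fin p → Prop}

theorem of_bijective (hπ : StrictMono π) (hs : Function.Surjective π) :
    IsExpansion r (r.comap π) π fun x y => r.r (π x) (π y) where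
  mono := hπ.monotone
  surj := hs
  refl _ := r.iseqv.refl _
  symm _ _ h := r.iseqv.symm h
  trans _ _ _ h h' := r.iseqv.trans h h'
  base _ _ h := h
  vert _ _ h := h
  inj _ _ _ h := hπ.injective h
  ex x v h := by
    obtain ⟨y, rfl⟩ := hs v
    exact ⟨y, rfl, h⟩
  lt x y x' y' _ _ h1 _ h3 := absurd (hπ.injective h1) (ne_of_lt h3)

theorem comp (h : IsExpansion r r' π ρ) (h' : IsExpansion r' r'' π' ρ') :
    IsExpansion r r'' (π ∘ π') fun x y => ρ' x y ∧ ρ (π' x) (π' y) where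
  mono := h.mono.comp h'.mono
  surj := h.surj.comp h'.surj
  refl _ := ⟨h'.refl _, h.refl _⟩
  symm _ _ hxy := ⟨h'.symm _ _ hxy.1, h.symm _ _ hxy.2⟩
  trans _ _ _ hxy hyw := ⟨h'.trans _ _ _ hxy.1 hyw.1, h.trans _ _ _ hxy.2 hyw.2⟩
  base _ _ hxy := h.base _ _ hxy.2
  vert _ _ hxy := h'.vert _ _ hxy.1
  inj _ _ hxy hπ := h'.inj _ _ hxy.1 (h.inj _ _ hxy.2 hπ)
  ex x v hv := by
    obtain ⟨u, hu, hxu⟩ := h.ex _ _ hv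
    obtain ⟨y, rfl, hxy⟩ := h'.ex _ _ (h.vert _ _ hxu)
    exact ⟨y, hu, hxy, hxu⟩
  lt x y x' y' hxy hxy' h1 h2 hlt := by
    rcases (h'.mono hlt.le).lt_or_eq with h3 | h3
    · have h4 := h.lt _ _ _ _ hxy.2 hxy'.2 h1 h2 h3
      by_contra hc
      exact absurd (h'.mono (not_lt.1 hc)) (not_le.2 h4)
    · have h4 : π' y = π' y' := by
        refine h.inj _ _ (h.trans _ _ _ (h.symm _ _ hxy.2) ?_) h2
        rw [h3]
        exact hxy'.2
      exact h'.lt _ _ _ _ hxy.1 hxy'.1 h3 h4 hlt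

theorem card_fiber_eq (h : IsExpansion r r' π ρ) {i j : Fin n} (hij : r.r i j) :
    (Finset.univ.filter fun x => π x = i).card = (Finset.univ.filter fun x => π x = j).card := by
  have key : ∀ i j : Fin n, r.r i j →
      (Finset.univ.filter fun x => π x = i).card ≤ (Finset.univ.filter fun x => π x = j).card := by
    intro i j hij
    have hex : ∀ x, π x = i → ∃ y, π y = j ∧ ρ x y := fun x hx => h.ex x j (hx ▸ hij)
    choose! f hf using hex
    refine Finset.card_le_card_of_injOn f ?_ ?_
    · intro x hx
      simp only [Finset.coe_filter, Finset.mem_univ, true_and, Set.mem_ofPred_eq] at hx ⊢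
      exact (hf x hx).1
    · intro x hx y hy hxy
      simp only [Finset.coe_filter, Finset.mem_univ, true_and, Set.mem_ofPred_eq] at hx hy
      refine h.inj x y (h.trans _ _ _ (hf x hx).2 (h.symm _ _ ?_)) (hx.trans hy.symm)
      rw [hxy]
      exact (hf y hy).2
  exact le_antisymm (key i j hij) (key j i (r.iseqv.symm hij))

/-- Since ρ respects the order within blocks, it injects the places before x into those before y,
and conversely. So partners have the same offset in their blocks. -/
theorem card_lt_eq (h : IsExpansion r r' π ρ) {x y : Fin m} (hxy : ρ x y) :
    (Finset.univ.filter fun u => π u = π x ∧ u < x).card =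
      (Finset.univ.filter fun u => π u = π y ∧ u < y).card := by
  have key : ∀ x y, ρ x y → (Finset.univ.filter fun u => π u = π x ∧ u < x).card ≤
      (Finset.univ.filter fun u => π u = π y ∧ u < y).card := by
    intro x y hxy
    have hex : ∀ u, π u = π x → ∃ v, π v = π y ∧ ρ u v := fun u hu =>
      h.ex u _ (hu ▸ h.base _ _ hxy)
    choose! f hf using hex
    refine Finset.card_le_card_of_injOn f ?_ ?_
    · intro u hu
      simp only [Finset.coe_filter, Finset.mem_univ, true_and, Set.mem_ofPred_eq] at hu ⊢
      exact ⟨(hf u hu.1).1, h.lt _ _ _ _ (hf u hu.1).2 hxy hu.1 (hf u hu.1).1 hu.2⟩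
    · intro u hu v hv huv
      simp only [Finset.coe_filter, Finset.mem_univ, true_and, Set.mem_ofPred_eq] at hu hv
      refine h.inj u v (h.trans _ _ _ (hf u hu.1).2 (h.symm _ _ ?_)) (hu.1.trans hv.1.symm)
      rw [huv]
      exact (hf v hv.1).2
  exact le_antisymm (key x y hxy) (key y x (h.symm _ _ hxy))

end IsExpansion

/-! ### Splittings, and problems aligned over a bipartite problem -/

namespace MatrixBimoduleProblem

variable {k : Type*} [Field k] {𝔄 𝔅 : MatrixBimoduleProblem k}

/-- An induced problem with the properties of labels that loop and edge reductions share. -/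
structure IsSplitting (𝔄 𝔅 : MatrixBimoduleProblem k) (π : Fin 𝔅.t → Fin 𝔄.t) (l : 𝔄.leads)
    {Λ κ : Type*} (lt : Λ → Λ → Prop) (lab : Fin 𝔄.t → Finset Λ) (kind : Λ → κ)
    (G : Λ → Λ → k) (ℓ : Fin 𝔅.t → Λ) : Prop
    extends IsInduced 𝔄 𝔅 π l lt lab kind G ℓ where
  sto : IsStrictTotalOrder Λ lt
  lab_vert : ∀ i j, 𝔄.vert.r i j → lab i = lab j
  lab_nonempty : ∀ i, (lab i).Nonempty
  kind_G : ∀ a b, G a b ≠ 0 → kind a = kind b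

theorem labelsAt_nonempty {Λ : Type*} {p q : Fin 𝔄.t} {LX LY : Finset Λ} (o : Λ) (hX : LX.Nonempty)
    (hY : LY.Nonempty) (i : Fin 𝔄.t) : (𝔄.labelsAt p q LX LY o i).Nonempty := by
  unfold labelsAt
  split_ifs
  exacts [hX, hY, Finset.singleton_nonempty o]

theorem IsInduced.edge_isSplitting {π : Fin 𝔅.t → Fin 𝔄.t} {l : 𝔄.leads}
    {LX LY : Finset (Fin 3)} (hX : LX.Nonempty) (hY : LY.Nonempty) {ℓ : Fin 𝔅.t → Fin 3}
    (h : IsInduced 𝔄 𝔅 π l (fun a b => a < b) (𝔄.labelsAt l.1.1 l.1.2 LX LY 1) id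
      (edgeBlock k) ℓ) :
    IsSplitting 𝔄 𝔅 π l (fun a b => a < b) (𝔄.labelsAt l.1.1 l.1.2 LX LY 1) id
      (edgeBlock k) ℓ where
  toIsInduced := h
  sto := inferInstanceAs (IsStrictTotalOrder (Fin 3) (· < ·))
  lab_vert _ _ h := labelsAt_vert h
  lab_nonempty := labelsAt_nonempty 1 hX hY
  kind_G _ _ h := edgeBlock_kind h

theorem weyr_labels_nonempty {S : Finset (k × ℕ)} (hS : S.Nonempty) (h1 : ∀ s ∈ S, 1 ≤ s.2)
    {L : Finset (WeyrLabel k)}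
    (hL : ∀ a, a ∈ L ↔ (a.ev, a.size) ∈ S ∧ 1 ≤ a.pos ∧ a.pos ≤ a.size) : L.Nonempty := by
  obtain ⟨s, hs⟩ := hS
  exact ⟨⟨s.1, s.2, 1⟩, (hL _).2 ⟨hs, le_rfl, h1 s hs⟩⟩

theorem IsInduced.loop_isSplitting [LinearOrder k] {π : Fin 𝔅.t → Fin 𝔄.t} {l : 𝔄.leads}
    {L : Finset (WeyrLabel k)} (hL : L.Nonempty) {ℓ : Fin 𝔅.t → WeyrLabel k}
    (h : IsInduced 𝔄 𝔅 π l WeyrLabel.lt (𝔄.labelsAt l.1.1 l.1.2 L L ⟨0, 1, 1⟩)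
      (fun a => (a.ev, a.size)) (weyrBlock k) ℓ) :
    IsSplitting 𝔄 𝔅 π l WeyrLabel.lt (𝔄.labelsAt l.1.1 l.1.2 L L ⟨0, 1, 1⟩)
      (fun a => (a.ev, a.size)) (weyrBlock k) ℓ where
  toIsInduced := h
  sto := WeyrLabel.isStrictTotalOrder
  lab_vert _ _ h := labelsAt_vert h
  lab_nonempty := labelsAt_nonempty _ hL hL
  kind_G _ _ h := weyrBlock_kind h

theorem IsSplitting.isExpansion {π : Fin 𝔅.t → Fin 𝔄.t} {l : 𝔄.leads} {Λ κ : Type*}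
    {lt : Λ → Λ → Prop} {lab : Fin 𝔄.t → Finset Λ} {kind : Λ → κ} {G : Λ → Λ → k}
    {ℓ : Fin 𝔅.t → Λ} (h : IsSplitting 𝔄 𝔅 π l lt lab kind G ℓ) :
    IsExpansion 𝔄.vert 𝔅.vert π fun x y => 𝔄.vert.r (π x) (π y) ∧ ℓ x = ℓ y where
  mono := h.isBlowUp.mono
  surj i := by
    obtain ⟨a, ha⟩ := h.lab_nonempty i
    obtain ⟨x, hx, -⟩ := (h.labels i a).1 ha
    exact ⟨x, hx⟩
  refl _ := ⟨vert_refl _ _, rfl⟩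
  symm _ _ hxy := ⟨vert_symm hxy.1, hxy.2.symm⟩
  trans _ _ _ hxy hyw := ⟨vert_trans hxy.1 hyw.1, hxy.2.trans hyw.2⟩
  base _ _ hxy := hxy.1
  vert _ _ hxy := (h.vert _ _).2 ⟨by rw [hxy.2], Or.inl hxy.1⟩
  inj _ _ hxy hπ := h.isBlowUp.inj hπ hxy.2
  ex x v hv := by
    obtain ⟨y, rfl, hy⟩ := (h.labels v (ℓ x)).1 (h.lab_vert _ _ hv ▸ h.isBlowUp.mem x)
    exact ⟨y, rfl, hv, hy.symm⟩
  lt x y x' y' hxy hxy' h1 h2 hlt := by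
    refine (h.order _ _).2 (Or.inr ⟨h2, ?_⟩)
    rw [← hxy.2, ← hxy'.2]
    rcases (h.order _ _).1 hlt with h3 | h3
    · exact absurd h1 (ne_of_lt h3)
    · exact h3.2

theorem IsRegularization.isExpansion {π : Fin 𝔅.t → Fin 𝔄.t} {l : 𝔄.leads}
    (h : IsRegularization 𝔄 𝔅 π l) :
    IsExpansion 𝔄.vert 𝔅.vert π fun x y => 𝔄.vert.r (π x) (π y) := by
  have := IsExpansion.of_bijective (r := 𝔄.vert) h.strictMono h.surjective
  have e : 𝔄.vert.comap π = 𝔅.vert := Setoid.ext fun x y => (h.vert x y).symm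
  rwa [e] at this

theorem IsReduction.exists_isExpansion [LinearOrder k] {π : Fin 𝔅.t → Fin 𝔄.t}
    (h : IsReduction 𝔄 𝔅 π) : ∃ ρ, IsExpansion 𝔄.vert 𝔅.vert π ρ := by
  obtain ⟨l, h | ⟨-, S, hS, h1, L, hL, ℓ, h⟩ | ⟨-, LX, LY, -, -, hX, hY, -, ℓ, h⟩⟩ := h
  · exact ⟨_, h.isExpansion⟩
  · exact ⟨_, (h.loop_isSplitting (weyr_labels_nonempty hS h1 hL)).isExpansion⟩
  · exact ⟨_, (h.edge_isSplitting hX hY).isExpansion⟩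

theorem IsSplitting.mem_leads {π : Fin 𝔅.t → Fin 𝔄.t} {l : 𝔄.leads} {Λ κ : Type*}
    {lt : Λ → Λ → Prop} {lab : Fin 𝔄.t → Finset Λ} {kind : Λ → κ} {G : Λ → Λ → k}
    {ℓ : Fin 𝔅.t → Λ} (h : IsSplitting 𝔄 𝔅 π l lt lab kind G ℓ) (m : Fin 𝔅.t × Fin 𝔅.t) :
    m ∈ 𝔅.leads ↔ (π m.1, π m.2) ∈ 𝔄.leads ∧ (π m.1, π m.2) ≠ l.1 :=
  have := h.sto
  h.toIsInduced.mem_leads h.lab_vert h.kind_G m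

theorem IsReduction.mem_leads [LinearOrder k] {π : Fin 𝔅.t → Fin 𝔄.t}
    (h : IsReduction 𝔄 𝔅 π) : ∃ l : 𝔄.leads, ∀ m : Fin 𝔅.t × Fin 𝔅.t,
      m ∈ 𝔅.leads ↔ (π m.1, π m.2) ∈ 𝔄.leads ∧ (π m.1, π m.2) ≠ l.1 := by
  obtain ⟨l, h | ⟨-, S, hS, h1, L, hL, ℓ, h⟩ | ⟨-, LX, LY, -, -, hX, hY, -, ℓ, h⟩⟩ := h
  · exact ⟨l, h.mem_leads⟩
  · exact ⟨l, (h.loop_isSplitting (weyr_labels_nonempty hS h1 hL)).mem_leads⟩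
  · exact ⟨l, (h.edge_isSplitting hX hY).mem_leads⟩

/-- Properties, over a bipartite problem `𝔄`, that all problems obtained from `𝔄` by reductions
have; `blk` is the block map, and `ρ` relates the same places in equivalent blocks. -/
structure Aligned (𝔄 : MatrixBimoduleProblem k) (T₂ : Set (Fin 𝔄.t)) (𝔇 : MatrixBimoduleProblem k)
    (blk : Fin 𝔇.t → Fin 𝔄.t) (ρ : Fin 𝔇.t → Fin 𝔇.t → Prop) : Prop where
  exp : IsExpansion 𝔄.vert 𝔇.vert blk ρ
  K1_bip : ∀ V ∈ 𝔇.K1, ∀ x y, V x y ≠ 0 → (blk x ∈ T₂ ↔ blk y ∈ T₂)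
  K1_same : ∀ V ∈ 𝔇.K1, ∀ x y x' y', ρ x x' → ρ y y' → blk x = blk y → blk x' = blk y' →
    V x y = V x' y'
  M1_compat : ∀ U ∈ 𝔇.M1, ∀ x₀ y₀, ∃ B ∈ 𝔄.M1, ∀ x y, ρ x x₀ → ρ y y₀ → U x y = B (blk x) (blk y)
  H_compat : ∀ x₀ y₀, ∃ B ∈ 𝔄.M1, ∀ x y, ρ x x₀ → ρ y y₀ → 𝔇.H x y = B (blk x) (blk y)

namespace Aligned

variable {T₂ : Set (Fin 𝔄.t)} {𝔇 𝔇' : MatrixBimoduleProblem k}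
  {blk : Fin 𝔇.t → Fin 𝔄.t} {ρ : Fin 𝔇.t → Fin 𝔇.t → Prop} {π : Fin 𝔇'.t → Fin 𝔇.t}

theorem refl (hbip : 𝔄.IsBipartite T₂) : Aligned 𝔄 T₂ 𝔄 id fun x y => 𝔄.vert.r x y where
  exp := by
    have := IsExpansion.of_bijective (r := 𝔄.vert) strictMono_id Function.surjective_id
    exact this
  K1_bip := hbip.K1
  K1_same V hV x y x' y' _ _ h1 h2 := by
    rw [𝔄.K1_upper V hV x y (ge_of_eq h1), 𝔄.K1_upper V hV x' y' (ge_of_eq h2)]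
  M1_compat U hU _ _ := ⟨U, hU, fun _ _ _ _ => rfl⟩
  H_compat _ _ := ⟨0, 𝔄.M1.zero_mem, fun _ _ _ _ => by rw [hbip.H]; rfl⟩

theorem M1_bip (h : Aligned 𝔄 T₂ 𝔇 blk ρ) (hbip : 𝔄.IsBipartite T₂)
    {U : Matrix (Fin 𝔇.t) (Fin 𝔇.t) k} (hU : U ∈ 𝔇.M1) {x y : Fin 𝔇.t} (hne : U x y ≠ 0) :
    blk x ∉ T₂ ∧ blk y ∈ T₂ := by
  obtain ⟨B, hB, hUB⟩ := h.M1_compat U hU x y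
  rw [hUB x y (h.exp.refl x) (h.exp.refl y)] at hne
  exact hbip.M1 B hB _ _ hne

theorem leads_bip (h : Aligned 𝔄 T₂ 𝔇 blk ρ) (hbip : 𝔄.IsBipartite T₂) {x : Fin 𝔇.t × Fin 𝔇.t}
    (hx : x ∈ 𝔇.leads) : blk x.1 ∉ T₂ ∧ blk x.2 ∈ T₂ :=
  h.M1_bip hbip (A_mem_M1 ⟨x, hx⟩) (𝔇.A_lead ⟨x, hx⟩).1

theorem regularization (h : Aligned 𝔄 T₂ 𝔇 blk ρ) {l : 𝔇.leads}
    (hr : IsRegularization 𝔇 𝔇' π l) :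
    Aligned 𝔄 T₂ 𝔇' (blk ∘ π) fun x y => 𝔇.vert.r (π x) (π y) ∧ ρ (π x) (π y) where
  exp := h.exp.comp hr.isExpansion
  K1_bip := by
    intro U hU x y hne
    obtain ⟨V, -, rfl⟩ := (hr.K1 U).1 hU
    exact h.K1_bip V.1 V.2 _ _ hne
  K1_same := by
    intro U hU x y x' y' hx hy h1 h2
    obtain ⟨V, -, rfl⟩ := (hr.K1 U).1 hU
    exact h.K1_same V.1 V.2 _ _ _ _ hx.2 hy.2 h1 h2
  M1_compat := by
    intro U hU x₀ y₀
    obtain ⟨B, hB, -, rfl⟩ := (hr.M1 U).1 hU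
    obtain ⟨B', hB', hBB⟩ := h.M1_compat B hB (π x₀) (π y₀)
    exact ⟨B', hB', fun x y hx hy => hBB _ _ hx.2 hy.2⟩
  H_compat := by
    intro x₀ y₀
    obtain ⟨B', hB', hBB⟩ := h.H_compat (π x₀) (π y₀)
    exact ⟨B', hB', fun x y hx hy => by rw [hr.H]; exact hBB _ _ hx.2 hy.2⟩

theorem splitting (h : Aligned 𝔄 T₂ 𝔇 blk ρ) {l : 𝔇.leads} {Λ κ : Type*}
    {lt : Λ → Λ → Prop} {lab : Fin 𝔇.t → Finset Λ} {kind : Λ → κ} {G : Λ → Λ → k}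
    {ℓ : Fin 𝔇'.t → Λ} (hs : IsSplitting 𝔇 𝔇' π l lt lab kind G ℓ) :
    Aligned 𝔄 T₂ 𝔇' (blk ∘ π)
      fun x y => (𝔇.vert.r (π x) (π y) ∧ ℓ x = ℓ y) ∧ ρ (π x) (π y) where
  exp := h.exp.comp hs.isExpansion
  K1_bip := by
    intro U hU x y hne
    obtain ⟨F, f, hF, hf, rfl⟩ := hs.mem_K1.1 hU
    rw [Matrix.add_apply, diagStar_apply, blow_apply] at hne
    split_ifs at hne with hπ
    · simp only [Function.comp_apply, hπ]
    · rw [zero_add] at hne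
      exact h.K1_bip _ (hf _ _) _ _ hne
  K1_same := by
    intro U hU x y x' y' hx hy h1 h2
    obtain ⟨F, f, hF, hf, rfl⟩ := hs.mem_K1.1 hU
    -- Partners of one index in one block of 𝔄 coincide, so the diagonal part is present at both
    -- positions or at neither.
    have hπ : π x = π y ↔ π x' = π y' := by
      constructor
      · intro hπ
        refine h.exp.inj _ _ (h.exp.trans _ _ _ (h.exp.symm _ _ hx.2) ?_) h2
        rw [hπ]; exact hy.2
      · intro hπ
        refine h.exp.inj _ _ (h.exp.trans _ _ _ hx.2 (h.exp.symm _ _ ?_)) h1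
        rw [hπ]; exact hy.2
    rw [Matrix.add_apply, Matrix.add_apply, diagStar_apply, blow_apply, diagStar_apply, blow_apply,
      ← hx.1.2, ← hy.1.2, h.K1_same _ (hf _ _) _ _ _ _ hx.2 hy.2 h1 h2, hF.vert _ _ hx.1.1]
    simp only [hπ]
  M1_compat := by
    intro U hU x₀ y₀
    obtain ⟨f, hf, rfl⟩ := hs.mem_M1.1 hU
    obtain ⟨B', hB', hBB⟩ := h.M1_compat _ (hf (ℓ x₀) (ℓ y₀)).1 (π x₀) (π y₀)
    exact ⟨B', hB', fun x y hx hy => by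
      rw [blow_apply, hx.1.2, hy.1.2]; exact hBB _ _ hx.2 hy.2⟩
  -- Along the partners of `x₀` and `y₀` the labels are constant, so the new `H` is there one fixed
  -- combination of the old `H` and of `A_l`.
  H_compat := by
    classical
    intro x₀ y₀
    obtain ⟨B₁, hB₁, e₁⟩ := h.H_compat (π x₀) (π y₀)
    obtain ⟨B₂, hB₂, e₂⟩ := h.M1_compat _ (A_mem_M1 l) (π x₀) (π y₀)
    refine ⟨(if ℓ x₀ = ℓ y₀ then (1 : k) else 0) • B₁ + G (ℓ x₀) (ℓ y₀) • B₂,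
      𝔄.M1.add_mem (𝔄.M1.smul_mem _ hB₁) (𝔄.M1.smul_mem _ hB₂), fun x y hx hy => ?_⟩
    rw [hs.H_apply, e₁ _ _ hx.2 hy.2, e₂ _ _ hx.2 hy.2, hx.1.2, hy.1.2]
    by_cases hℓ : ℓ x₀ = ℓ y₀ <;> simp [hℓ]

theorem reduction [LinearOrder k] (h : Aligned 𝔄 T₂ 𝔇 blk ρ) (hr : IsReduction 𝔇 𝔇' π) :
    ∃ ρ', Aligned 𝔄 T₂ 𝔇' (blk ∘ π) ρ' := by
  obtain ⟨l, hr | ⟨-, S, hS, h1, L, hL, ℓ, hr⟩ | ⟨-, LX, LY, -, -, hX, hY, -, ℓ, hr⟩⟩ := hr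
  · exact ⟨_, h.regularization hr⟩
  · exact ⟨_, h.splitting (hr.loop_isSplitting (weyr_labels_nonempty hS h1 hL))⟩
  · exact ⟨_, h.splitting (hr.edge_isSplitting hX hY)⟩

end Aligned

end MatrixBimoduleProblem

/-! ### The final matrix determines each reduction -/

theorem eq_of_card_lt_eq {n m : ℕ} {π : Fin m → Fin n} {y y' : Fin m} (hπ : π y = π y')
    (h : (Finset.univ.filter fun u => π u = π y ∧ u < y).card =
      (Finset.univ.filter fun u => π u = π y' ∧ u < y').card) : y = y' := by
  have key : ∀ y y' : Fin m, π y = π y' → y < y' →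
      (Finset.univ.filter fun u => π u = π y ∧ u < y).card <
      (Finset.univ.filter fun u => π u = π y' ∧ u < y').card := by
    intro y y' hπ hlt
    refine Finset.card_lt_card ((Finset.ssubset_iff_of_subset fun u hu => ?_).2 ⟨y, ?_, ?_⟩)
    · simp only [Finset.mem_filter, Finset.mem_univ, true_and] at hu ⊢
      exact ⟨hu.1.trans hπ, hu.2.trans hlt⟩
    · simpa using ⟨hπ, hlt⟩
    · simp
  rcases lt_trichotomy y y' with h1 | h1 | h1
  · exact absurd h (key _ _ hπ h1).ne
  · exact h1
  · exact absurd h (key _ _ hπ.symm h1).ne'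

/-- A partner is determined by its block and its offset, hence by π; different reductions with the
same block map have the same partners. -/
theorem IsExpansion.partner_unique {n m : ℕ} {r : Setoid (Fin n)} {r' r'' : Setoid (Fin m)}
    {π : Fin m → Fin n} {ρ ρ' : Fin m → Fin m → Prop} (h : IsExpansion r r' π ρ)
    (h' : IsExpansion r r'' π ρ') {x y y' : Fin m} (hxy : ρ x y) (hxy' : ρ' x y')
    (hπ : π y = π y') : y = y' :=
  eq_of_card_lt_eq hπ ((h.card_lt_eq hxy).symm.trans (h'.card_lt_eq hxy'))

namespace MatrixBimoduleProblem

variable {k : Type*} [Field k]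

/-- A sequence of reductions leads from the problem to one with the matrix `Hn`; the map is the
composed block map. -/
inductive Reach [LinearOrder k] {n : ℕ} (Hn : Matrix (Fin n) (Fin n) k) :
    (𝔇 : MatrixBimoduleProblem k) → (Fin n → Fin 𝔇.t) → Prop
  | refl (𝔇 : MatrixBimoduleProblem k) (π : Fin n → Fin 𝔇.t) (hπ : StrictMono π)
      (hs : Function.Surjective π) (hH : Hn = 𝔇.H.submatrix π π) : Reach Hn 𝔇 π
  | step {𝔇 𝔇' : MatrixBimoduleProblem k} {π : Fin 𝔇'.t → Fin 𝔇.t} {π' : Fin n → Fin 𝔇'.t}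
      (h : IsReduction 𝔇 𝔇' π) (h' : Reach Hn 𝔇' π') : Reach Hn 𝔇 (π ∘ π')

/-- `Hn` is the expansion of `H` at the positions that no solid arrow affects. -/
def ExpandsH (𝔇 : MatrixBimoduleProblem k) {n : ℕ} (Hn : Matrix (Fin n) (Fin n) k)
    (π : Fin n → Fin 𝔇.t) (ρ : Fin n → Fin n → Prop) : Prop :=
  ∀ x y, (∀ U ∈ 𝔇.M1, U (π x) (π y) = 0) →
    (ρ x y → Hn x y = 𝔇.H (π x) (π y)) ∧ (¬ ρ x y → Hn x y = 0)

variable {𝔇 𝔇₁ 𝔇₂ : MatrixBimoduleProblem k} {n : ℕ} {Hn : Matrix (Fin n) (Fin n) k}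

theorem ExpandsH.regularization {π : Fin 𝔇₁.t → Fin 𝔇.t} {l : 𝔇.leads}
    (hr : IsRegularization 𝔇 𝔇₁ π l) {π₁ : Fin n → Fin 𝔇₁.t} {ρ : Fin n → Fin n → Prop}
    (h : 𝔇₁.ExpandsH Hn π₁ ρ) :
    𝔇.ExpandsH Hn (π ∘ π₁) fun x y => ρ x y ∧ 𝔇.vert.r (π (π₁ x)) (π (π₁ y)) := by
  intro x y hM
  have hM' : ∀ U ∈ 𝔇₁.M1, U (π₁ x) (π₁ y) = 0 := by
    intro U hU
    obtain ⟨B, hB, -, rfl⟩ := (hr.M1 U).1 hU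
    exact hM B hB
  obtain ⟨h1, h2⟩ := h x y hM'
  rw [hr.H] at h1
  refine ⟨fun hρ => h1 hρ.1, fun hρ => ?_⟩
  by_cases h3 : ρ x y
  · rw [h1 h3]
    by_contra hne
    exact hρ ⟨h3, 𝔇.H_vert _ _ hne⟩
  · exact h2 h3

theorem ExpandsH.splitting {π : Fin 𝔇₁.t → Fin 𝔇.t} {l : 𝔇.leads} {Λ κ : Type*}
    {lt : Λ → Λ → Prop} {lab : Fin 𝔇.t → Finset Λ} {kind : Λ → κ} {G : Λ → Λ → k}
    {ℓ : Fin 𝔇₁.t → Λ} (hs : IsSplitting 𝔇 𝔇₁ π l lt lab kind G ℓ) {π₁ : Fin n → Fin 𝔇₁.t}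
    {ρ : Fin n → Fin n → Prop} (h : 𝔇₁.ExpandsH Hn π₁ ρ) :
    𝔇.ExpandsH Hn (π ∘ π₁)
      fun x y => ρ x y ∧ (𝔇.vert.r (π (π₁ x)) (π (π₁ y)) ∧ ℓ (π₁ x) = ℓ (π₁ y)) := by
  classical
  intro x y hM
  have hM' : ∀ U ∈ 𝔇₁.M1, U (π₁ x) (π₁ y) = 0 := by
    intro U hU
    obtain ⟨f, hf, rfl⟩ := hs.mem_M1.1 hU
    exact hM _ (hf _ _).1
  have hH := hs.H_apply (π₁ x) (π₁ y)
  have hA : 𝔇.A l (π (π₁ x)) (π (π₁ y)) = 0 := hM _ (A_mem_M1 l)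
  rw [hA, mul_zero, add_zero] at hH
  obtain ⟨h1, h2⟩ := h x y hM'
  rw [hH] at h1
  refine ⟨fun hρ => by rw [h1 hρ.1, if_pos hρ.2.2]; rfl, fun hρ => ?_⟩
  by_cases h3 : ρ x y
  · rw [h1 h3]
    split_ifs with h4
    · by_contra hne
      exact hρ ⟨h3, 𝔇.H_vert _ _ hne, h4⟩
    · rfl
  · exact h2 h3

/-- A reduction changes `H`, apart from expanding it, only by multiples of a matrix of ℳ₁. Where all
of ℳ₁ vanishes, later reductions therefore just copy the entry of `H` to related places and put
zeros elsewhere. -/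
theorem Reach.exists_isExpansion [LinearOrder k] {π : Fin n → Fin 𝔇.t} (h : Reach Hn 𝔇 π) :
    ∃ r' ρ, IsExpansion 𝔇.vert r' π ρ ∧ 𝔇.ExpandsH Hn π ρ := by
  induction h with
  | refl 𝔇 π hπ hs hH =>
    refine ⟨_, _, IsExpansion.of_bijective hπ hs, fun x y _ => ⟨fun _ => by rw [hH]; rfl, ?_⟩⟩
    intro hρ
    rw [hH]
    by_contra hne
    exact hρ (𝔇.H_vert _ _ hne)
  | step h _ ih =>
    obtain ⟨r', ρ, he, hH⟩ := ih
    obtain ⟨l, h | ⟨-, S, hS, h1, L, hL, ℓ, h⟩ | ⟨-, LX, LY, -, -, hX, hY, -, ℓ, h⟩⟩ := h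
    · exact ⟨_, _, h.isExpansion.comp he, hH.regularization h⟩
    · have hs := h.loop_isSplitting (weyr_labels_nonempty hS h1 hL)
      exact ⟨_, _, hs.isExpansion.comp he, hH.splitting hs⟩
    · have hs := h.edge_isSplitting hX hY
      exact ⟨_, _, hs.isExpansion.comp he, hH.splitting hs⟩

section Two

variable {π₁ : Fin 𝔇₁.t → Fin 𝔇.t} {π₂ : Fin 𝔇₂.t → Fin 𝔇.t} {l : 𝔇.leads} {Λ κ : Type*}
  {lt : Λ → Λ → Prop} {kind : Λ → κ} {G : Λ → Λ → k} {ℓ₁ : Fin 𝔇₁.t → Λ} {ℓ₂ : Fin 𝔇₂.t → Λ}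
  {σ₁ : Fin n → Fin 𝔇₁.t} {σ₂ : Fin n → Fin 𝔇₂.t}

/-- Partners carry equal labels in either splitting, and by `IsExpansion.partner_unique` the
partners are the same in both. So it is enough to compare labels over one index of each vertex. -/
theorem IsSplitting.label_transfer {lab₁ lab₂ : Fin 𝔇.t → Finset Λ}
    (h₁ : IsSplitting 𝔇 𝔇₁ π₁ l lt lab₁ kind G ℓ₁) (h₂ : IsSplitting 𝔇 𝔇₂ π₂ l lt lab₂ kind G ℓ₂)
    {r₁ r₂ : Setoid (Fin n)} {ρ₁ ρ₂ : Fin n → Fin n → Prop}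
    (e₁ : IsExpansion 𝔇₁.vert r₁ σ₁ ρ₁) (e₂ : IsExpansion 𝔇₂.vert r₂ σ₂ ρ₂)
    (hσ : ∀ x, π₁ (σ₁ x) = π₂ (σ₂ x)) {i i' : Fin 𝔇.t} (hi : 𝔇.vert.r i i')
    (h : ∀ x, π₁ (σ₁ x) = i' → ℓ₁ (σ₁ x) = ℓ₂ (σ₂ x)) (x : Fin n) (hx : π₁ (σ₁ x) = i) :
    ℓ₁ (σ₁ x) = ℓ₂ (σ₂ x) := by
  have hσ' : π₂ ∘ σ₂ = π₁ ∘ σ₁ := funext fun x => (hσ x).symm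
  have c₁ := h₁.isExpansion.comp e₁
  have c₂ := h₂.isExpansion.comp e₂
  rw [hσ'] at c₂
  have hv : 𝔇.vert.r ((π₁ ∘ σ₁) x) i' := by
    rw [Function.comp_apply, hx]; exact hi
  obtain ⟨y, hy, hxy⟩ := c₁.ex x i' hv
  obtain ⟨y', hy', hxy'⟩ := c₂.ex x i' hv
  obtain rfl := c₁.partner_unique c₂ hxy hxy' (hy.trans hy'.symm)
  rw [hxy.2.2, h y hy, ← hxy'.2.2]

/-- A new index is the pair of its old index and its label, and all data of the induced problem are
expressed through these pairs. -/
theorem IsSplitting.isIso_of_labels {lab : Fin 𝔇.t → Finset Λ}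
    (h₁ : IsSplitting 𝔇 𝔇₁ π₁ l lt lab kind G ℓ₁) (h₂ : IsSplitting 𝔇 𝔇₂ π₂ l lt lab kind G ℓ₂)
    (h : ∀ x, ℓ₁ (σ₁ x) = ℓ₂ (σ₂ x)) (hσ : ∀ x, π₁ (σ₁ x) = π₂ (σ₂ x)) :
    ∃ f, IsIso 𝔇₁ 𝔇₂ f ∧ (∀ u, π₂ (f u) = π₁ u) ∧ ∀ x, f (σ₁ x) = σ₂ x := by
  have hex : ∀ u, ∃ u', π₂ u' = π₁ u ∧ ℓ₂ u' = ℓ₁ u := fun u =>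
    (h₂.labels _ _).1 (h₁.isBlowUp.mem u)
  choose f hf using hex
  have hsurj : Function.Surjective f := by
    intro u'
    obtain ⟨u, hu, hu'⟩ := (h₁.labels _ _).1 (h₂.isBlowUp.mem u')
    exact ⟨u, h₂.isBlowUp.inj ((hf u).1.trans hu) ((hf u).2.trans hu')⟩
  refine ⟨f, ⟨?_, hsurj, ?_, ?_, ?_, ?_⟩, fun u => (hf u).1, fun x =>
    h₂.isBlowUp.inj ((hf _).1.trans (hσ x)) ((hf _).2.trans (h x))⟩
  · intro u v huv
    rw [h₂.order, (hf u).1, (hf v).1, (hf u).2, (hf v).2, ← h₁.order]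
    exact huv
  · intro u v
    rw [h₂.vert, h₁.vert, (hf u).1, (hf v).1, (hf u).2, (hf v).2]
  · intro U
    rw [h₁.mem_K1, h₂.mem_K1]
    refine exists_congr fun F => exists_congr fun g => and_congr_right fun _ =>
      and_congr_right fun _ => ?_
    constructor
    · rintro rfl
      ext u v
      simp only [Matrix.submatrix_apply, Matrix.add_apply, diagStar_apply, blow_apply, (hf _).1,
        (hf _).2]
    · intro hU
      ext u' v'
      obtain ⟨u, rfl⟩ := hsurj u'
      obtain ⟨v, rfl⟩ := hsurj v'
      have := congrFun (congrFun hU u) v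
      simpa only [Matrix.submatrix_apply, Matrix.add_apply, diagStar_apply, blow_apply, (hf _).1,
        (hf _).2] using this
  · intro U
    rw [h₁.mem_M1, h₂.mem_M1]
    refine exists_congr fun g => and_congr_right fun _ => ?_
    constructor
    · rintro rfl
      ext u v
      simp only [Matrix.submatrix_apply, blow_apply, (hf _).1, (hf _).2]
    · intro hU
      ext u' v'
      obtain ⟨u, rfl⟩ := hsurj u'
      obtain ⟨v, rfl⟩ := hsurj v'
      have := congrFun (congrFun hU u) v
      simpa only [Matrix.submatrix_apply, blow_apply, (hf _).1, (hf _).2] using this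
  · classical
    ext u v
    rw [Matrix.submatrix_apply, h₁.H_apply, h₂.H_apply, (hf u).1, (hf v).1, (hf u).2, (hf v).2]

theorem labelsAt_eq_of_labels {LX LY LX' LY' : Finset Λ} {o : Λ}
    (h₁ : IsSplitting 𝔇 𝔇₁ π₁ l lt (𝔇.labelsAt l.1.1 l.1.2 LX LY o) kind G ℓ₁)
    (h₂ : IsSplitting 𝔇 𝔇₂ π₂ l lt (𝔇.labelsAt l.1.1 l.1.2 LX' LY' o) kind G ℓ₂)
    (s₁ : Function.Surjective σ₁) (s₂ : Function.Surjective σ₂)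
    (hσ : ∀ x, π₁ (σ₁ x) = π₂ (σ₂ x))
    (h : ∀ x, π₁ (σ₁ x) = l.1.1 ∨ π₁ (σ₁ x) = l.1.2 → ℓ₁ (σ₁ x) = ℓ₂ (σ₂ x)) :
    𝔇.labelsAt l.1.1 l.1.2 LX LY o = 𝔇.labelsAt l.1.1 l.1.2 LX' LY' o := by
  have key : ∀ i, i = l.1.1 ∨ i = l.1.2 →
      𝔇.labelsAt l.1.1 l.1.2 LX LY o i = 𝔇.labelsAt l.1.1 l.1.2 LX' LY' o i := by
    intro i hi
    ext a
    rw [h₁.labels, h₂.labels]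
    constructor
    · rintro ⟨u, hu, rfl⟩
      obtain ⟨x, rfl⟩ := s₁ u
      exact ⟨σ₂ x, by rw [← hσ, hu], (h x (by rw [hu]; exact hi)).symm⟩
    · rintro ⟨u, hu, rfl⟩
      obtain ⟨x, rfl⟩ := s₂ u
      exact ⟨σ₁ x, by rw [hσ, hu], h x (by rw [hσ, hu]; exact hi)⟩
  funext i
  by_cases h1 : 𝔇.vert.r i l.1.1
  · rw [labelsAt_vert h1, key _ (Or.inl rfl), ← labelsAt_vert h1]
  · by_cases h2 : 𝔇.vert.r i l.1.2
    · rw [labelsAt_vert h2, key _ (Or.inr rfl), ← labelsAt_vert h2]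
    · rw [labelsAt_other h1 h2, labelsAt_other h1 h2]

theorem IsSplitting.isIso {LX LY LX' LY' : Finset Λ} {o : Λ}
    (h₁ : IsSplitting 𝔇 𝔇₁ π₁ l lt (𝔇.labelsAt l.1.1 l.1.2 LX LY o) kind G ℓ₁)
    (h₂ : IsSplitting 𝔇 𝔇₂ π₂ l lt (𝔇.labelsAt l.1.1 l.1.2 LX' LY' o) kind G ℓ₂)
    {r₁ r₂ : Setoid (Fin n)} {ρ₁ ρ₂ : Fin n → Fin n → Prop}
    (e₁ : IsExpansion 𝔇₁.vert r₁ σ₁ ρ₁) (e₂ : IsExpansion 𝔇₂.vert r₂ σ₂ ρ₂)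
    (hσ : ∀ x, π₁ (σ₁ x) = π₂ (σ₂ x))
    (h : ∀ x, π₁ (σ₁ x) = l.1.1 ∨ π₁ (σ₁ x) = l.1.2 → ℓ₁ (σ₁ x) = ℓ₂ (σ₂ x)) :
    ∃ f, IsIso 𝔇₁ 𝔇₂ f ∧ (∀ u, π₂ (f u) = π₁ u) ∧ ∀ x, f (σ₁ x) = σ₂ x := by
  have hlab := labelsAt_eq_of_labels h₁ h₂ e₁.surj e₂.surj hσ h
  rw [← hlab] at h₂
  refine h₁.isIso_of_labels h₂ (fun x => ?_) hσ
  by_cases c1 : 𝔇.vert.r (π₁ (σ₁ x)) l.1.1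
  · exact h₁.label_transfer h₂ e₁ e₂ hσ c1 (fun x hx => h x (Or.inl hx)) x rfl
  · by_cases c2 : 𝔇.vert.r (π₁ (σ₁ x)) l.1.2
    · exact h₁.label_transfer h₂ e₁ e₂ hσ c2 (fun x hx => h x (Or.inr hx)) x rfl
    · have m₁ := h₁.isBlowUp.mem (σ₁ x)
      have m₂ := h₂.isBlowUp.mem (σ₂ x)
      rw [← hσ] at m₂
      rw [labelsAt_other c1 c2, Finset.mem_singleton] at m₁ m₂
      rw [m₁, m₂]

end Two

theorem IsRegularization.isIso {π₁ : Fin 𝔇₁.t → Fin 𝔇.t} {π₂ : Fin 𝔇₂.t → Fin 𝔇.t} {l : 𝔇.leads}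
    (h₁ : IsRegularization 𝔇 𝔇₁ π₁ l) (h₂ : IsRegularization 𝔇 𝔇₂ π₂ l)
    {σ₁ : Fin n → Fin 𝔇₁.t} {σ₂ : Fin n → Fin 𝔇₂.t} (hσ : ∀ x, π₁ (σ₁ x) = π₂ (σ₂ x)) :
    ∃ f, IsIso 𝔇₁ 𝔇₂ f ∧ (∀ u, π₂ (f u) = π₁ u) ∧ ∀ x, f (σ₁ x) = σ₂ x := by
  have hex : ∀ u, ∃ u', π₂ u' = π₁ u := fun u => h₂.surjective _
  choose f hf using hex
  have hsurj : Function.Surjective f := by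
    intro u'
    obtain ⟨u, hu⟩ := h₁.surjective (π₂ u')
    exact ⟨u, h₂.strictMono.injective ((hf u).trans hu)⟩
  have hsub : ∀ (U : Matrix (Fin 𝔇₂.t) (Fin 𝔇₂.t) k) (V : Matrix (Fin 𝔇.t) (Fin 𝔇.t) k),
      U = V.submatrix π₂ π₂ ↔ U.submatrix f f = V.submatrix π₁ π₁ := by
    intro U V
    constructor
    · rintro rfl
      ext u v
      simp only [Matrix.submatrix_apply, hf]
    · intro hU
      ext u' v'
      obtain ⟨u, rfl⟩ := hsurj u'
      obtain ⟨v, rfl⟩ := hsurj v'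
      have := congrFun (congrFun hU u) v
      simpa only [Matrix.submatrix_apply, hf] using this
  refine ⟨f, ⟨?_, hsurj, ?_, ?_, ?_, ?_⟩, hf, fun x =>
    h₂.strictMono.injective ((hf _).trans (hσ x))⟩
  · intro u v huv
    rw [← h₂.strictMono.lt_iff_lt, hf, hf]
    exact h₁.strictMono huv
  · intro u v
    rw [h₂.vert, h₁.vert, hf, hf]
  · intro U
    rw [h₁.K1, h₂.K1]
    simp only [hsub]
  · intro U
    rw [h₁.M1, h₂.M1]
    simp only [hsub]
  · rw [h₁.H, ← (hsub 𝔇₂.H 𝔇.H).1 h₂.H]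

end MatrixBimoduleProblem

namespace MatrixBimoduleProblem

variable {k : Type*} [Field k] {𝔇 𝔇₁ 𝔇₂ : MatrixBimoduleProblem k} {n : ℕ}
  {Hn : Matrix (Fin n) (Fin n) k}

/-- After the splitting, ℳ₁ vanishes over the leading position of `a_l`. So the block of the final
matrix there still shows the chosen G. -/
theorem IsSplitting.expandsH_lead {π₁ : Fin 𝔇₁.t → Fin 𝔇.t} {l : 𝔇.leads} {Λ κ : Type*}
    {lt : Λ → Λ → Prop} {lab : Fin 𝔇.t → Finset Λ} {kind : Λ → κ} {G : Λ → Λ → k}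
    {ℓ₁ : Fin 𝔇₁.t → Λ} {σ₁ : Fin n → Fin 𝔇₁.t}
    (h₁ : IsSplitting 𝔇 𝔇₁ π₁ l lt lab kind G ℓ₁) {ρ : Fin n → Fin n → Prop}
    (hH : 𝔇₁.ExpandsH Hn σ₁ ρ) {x y : Fin n} (hx : π₁ (σ₁ x) = l.1.1)
    (hy : π₁ (σ₁ y) = l.1.2) :
    (ρ x y → Hn x y = 𝔇₁.H (σ₁ x) (σ₁ y)) ∧ (¬ ρ x y → Hn x y = 0) := by
  refine hH x y fun U hU => ?_
  obtain ⟨f, hf, rfl⟩ := h₁.mem_M1.1 hU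
  rw [blow_apply, hx, hy]
  exact (hf _ _).2

section Edge

variable {π₁ : Fin 𝔇₁.t → Fin 𝔇.t} {l : 𝔇.leads} {LX LY : Finset (Fin 3)}
  {ℓ₁ : Fin 𝔇₁.t → Fin 3} {σ₁ : Fin n → Fin 𝔇₁.t} {r : Setoid (Fin n)}
  {ρ : Fin n → Fin n → Prop}

theorem edge_entry (hpq : ¬ 𝔇.vert.r l.1.1 l.1.2)
    (h₁ : IsSplitting 𝔇 𝔇₁ π₁ l (fun a b => a < b) (𝔇.labelsAt l.1.1 l.1.2 LX LY 1) id
      (edgeBlock k) ℓ₁) {u v : Fin 𝔇₁.t} (hu : π₁ u = l.1.1) (hv : π₁ v = l.1.2) :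
    𝔇₁.H u v = edgeBlock k (ℓ₁ u) (ℓ₁ v) := by
  classical
  have hH : 𝔇.H l.1.1 l.1.2 = 0 := by
    by_contra hne
    exact hpq (𝔇.H_vert _ _ hne)
  rw [h₁.H_apply, hu, hv, hH, ite_self, zero_add, 𝔇.A_one, mul_one]

/-- The label 1 marks the row and the column of the entry 1 of G, and the expansion turns that entry
into partial identities. Hence the rows and columns with label 1 are exactly the non-zero ones of
the final block. -/
theorem edge_label_iff (hpq : ¬ 𝔇.vert.r l.1.1 l.1.2) (hXY : 1 ∈ LX ↔ 1 ∈ LY)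
    (h₁ : IsSplitting 𝔇 𝔇₁ π₁ l (fun a b => a < b) (𝔇.labelsAt l.1.1 l.1.2 LX LY 1) id
      (edgeBlock k) ℓ₁) (e : IsExpansion 𝔇₁.vert r σ₁ ρ) (hH : 𝔇₁.ExpandsH Hn σ₁ ρ) :
    (∀ x, π₁ (σ₁ x) = l.1.1 → (ℓ₁ (σ₁ x) = 1 ↔ ∃ y, π₁ (σ₁ y) = l.1.2 ∧ Hn x y ≠ 0)) ∧
    (∀ y, π₁ (σ₁ y) = l.1.2 → (ℓ₁ (σ₁ y) = 1 ↔ ∃ x, π₁ (σ₁ x) = l.1.1 ∧ Hn x y ≠ 0)) := by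
  have hne : ∀ x y, π₁ (σ₁ x) = l.1.1 → π₁ (σ₁ y) = l.1.2 → Hn x y ≠ 0 →
      ℓ₁ (σ₁ x) = 1 ∧ ℓ₁ (σ₁ y) = 1 := by
    intro x y hx hy hxy
    obtain ⟨c1, c2⟩ := h₁.expandsH_lead hH hx hy
    by_cases hρ : ρ x y
    · rw [c1 hρ, edge_entry hpq h₁ hx hy, edgeBlock] at hxy
      by_contra hc
      exact hxy (if_neg hc)
    · exact absurd (c2 hρ) hxy
  have hXmem : ∀ u, π₁ u = l.1.1 → ℓ₁ u ∈ LX := by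
    intro u hu
    have := h₁.isBlowUp.mem u
    rwa [hu, labelsAt_left (vert_refl _ _)] at this
  have hYmem : ∀ u, π₁ u = l.1.2 → ℓ₁ u ∈ LY := by
    intro u hu
    have := h₁.isBlowUp.mem u
    rwa [hu, labelsAt_right hpq (vert_refl _ _)] at this
  refine ⟨fun x hx => ⟨fun h1 => ?_, ?_⟩, fun y hy => ⟨fun h1 => ?_, ?_⟩⟩
  · obtain ⟨v, hv, hv'⟩ := (h₁.labels l.1.2 1).1 (by
      rw [labelsAt_right hpq (vert_refl _ _), ← hXY, ← h1]; exact hXmem _ hx)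
    obtain ⟨y, rfl, hxy⟩ := e.ex x v ((h₁.vert _ _).2 ⟨by rw [h1, hv'], Or.inr
      ⟨Or.inl (hx ▸ vert_refl _ _), Or.inr (hv ▸ vert_refl _ _)⟩⟩)
    refine ⟨y, hv, ?_⟩
    rw [(h₁.expandsH_lead hH hx hv).1 hxy, edge_entry hpq h₁ hx hv, h1, hv']
    simp [edgeBlock]
  · rintro ⟨y, hy, hxy⟩
    exact (hne x y hx hy hxy).1
  · obtain ⟨v, hv, hv'⟩ := (h₁.labels l.1.1 1).1 (by
      rw [labelsAt_left (vert_refl _ _), hXY, ← h1]; exact hYmem _ hy)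
    obtain ⟨x, rfl, hxy⟩ := e.ex y v ((h₁.vert _ _).2 ⟨by rw [h1, hv'], Or.inr
      ⟨Or.inr (hy ▸ vert_refl _ _), Or.inl (hv ▸ vert_refl _ _)⟩⟩)
    refine ⟨x, hv, ?_⟩
    rw [(h₁.expandsH_lead hH hv hy).1 (e.symm _ _ hxy), edge_entry hpq h₁ hv hy, h1, hv']
    simp [edgeBlock]
  · rintro ⟨x, hx, hxy⟩
    exact (hne x y hx hy hxy).2

end Edge

theorem edge_isIso {π₁ : Fin 𝔇₁.t → Fin 𝔇.t} {π₂ : Fin 𝔇₂.t → Fin 𝔇.t} {l : 𝔇.leads}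
    {LX LY LX' LY' : Finset (Fin 3)} {ℓ₁ : Fin 𝔇₁.t → Fin 3} {ℓ₂ : Fin 𝔇₂.t → Fin 3}
    {σ₁ : Fin n → Fin 𝔇₁.t} {σ₂ : Fin n → Fin 𝔇₂.t}
    (hpq : ¬ 𝔇.vert.r l.1.1 l.1.2) (hX : LX ⊆ {1, 2}) (hY : LY ⊆ {0, 1})
    (hXY : 1 ∈ LX ↔ 1 ∈ LY) (hX' : LX' ⊆ {1, 2}) (hY' : LY' ⊆ {0, 1}) (hXY' : 1 ∈ LX' ↔ 1 ∈ LY')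
    (h₁ : IsSplitting 𝔇 𝔇₁ π₁ l (fun a b => a < b) (𝔇.labelsAt l.1.1 l.1.2 LX LY 1) id
      (edgeBlock k) ℓ₁)
    (h₂ : IsSplitting 𝔇 𝔇₂ π₂ l (fun a b => a < b) (𝔇.labelsAt l.1.1 l.1.2 LX' LY' 1) id
      (edgeBlock k) ℓ₂)
    {r₁ r₂ : Setoid (Fin n)} {ρ₁ ρ₂ : Fin n → Fin n → Prop}
    (e₁ : IsExpansion 𝔇₁.vert r₁ σ₁ ρ₁) (e₂ : IsExpansion 𝔇₂.vert r₂ σ₂ ρ₂)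
    (H₁ : 𝔇₁.ExpandsH Hn σ₁ ρ₁) (H₂ : 𝔇₂.ExpandsH Hn σ₂ ρ₂)
    (hσ : ∀ x, π₁ (σ₁ x) = π₂ (σ₂ x)) :
    ∃ f, IsIso 𝔇₁ 𝔇₂ f ∧ (∀ u, π₂ (f u) = π₁ u) ∧ ∀ x, f (σ₁ x) = σ₂ x := by
  refine h₁.isIso h₂ e₁ e₂ hσ fun x hx => ?_
  obtain ⟨a₁, b₁⟩ := edge_label_iff hpq hXY h₁ e₁ H₁
  obtain ⟨a₂, b₂⟩ := edge_label_iff hpq hXY' h₂ e₂ H₂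
  simp only [← hσ] at a₂ b₂
  have m₁ := h₁.isBlowUp.mem (σ₁ x)
  have m₂ := h₂.isBlowUp.mem (σ₂ x)
  rw [← hσ] at m₂
  rcases hx with hx | hx
  · rw [hx, labelsAt_left (vert_refl _ _)] at m₁ m₂
    have c₁ := hX m₁
    have c₂ := hX' m₂
    have key := (a₁ x hx).trans (a₂ x hx).symm
    simp only [Finset.mem_insert, Finset.mem_singleton] at c₁ c₂
    rcases c₁ with c₁ | c₁ <;> rcases c₂ with c₂ | c₂ <;> rw [c₁, c₂] at key ⊢
    · simp at key
    · simp at key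
  · rw [hx, labelsAt_right hpq (vert_refl _ _)] at m₁ m₂
    have c₁ := hY m₁
    have c₂ := hY' m₂
    have key := (b₁ x hx).trans (b₂ x hx).symm
    simp only [Finset.mem_insert, Finset.mem_singleton] at c₁ c₂
    rcases c₁ with c₁ | c₁ <;> rcases c₂ with c₂ | c₂ <;> rw [c₁, c₂] at key ⊢
    · simp at key
    · simp at key

/-- The labelling `lam` of the index set `P` can be read off from the matrix `N`, which is the
expansion of a Weyr matrix plus `h` times the identity. -/
structure WeyrReading (P : Fin n → Prop) (N : Fin n → Fin n → k) (h : k)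
    (lam : Fin n → WeyrLabel k) : Prop where
  diag : ∀ x, P x → N x x = h + (lam x).ev
  next : ∀ x y, P x → P y → x ≠ y → N x y ≠ 0 →
    (lam x).size = (lam y).size ∧ (lam y).pos = (lam x).pos + 1
  one_le : ∀ x, P x → 1 ≤ (lam x).pos
  le_size : ∀ x, P x → (lam x).pos ≤ (lam x).size
  ex_pred : ∀ x, P x → 2 ≤ (lam x).pos → ∃ y, P y ∧ y ≠ x ∧ N y x ≠ 0
  ex_succ : ∀ x, P x → (lam x).pos < (lam x).size → ∃ y, P y ∧ x ≠ y ∧ N x y ≠ 0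

/-- The eigenvalue is read from the diagonal. The non-zero off-diagonal entries raise the position
by one within a Jordan block; the chain leading to x gives its position, and the chain starting at x
gives what is missing to the size. -/
theorem WeyrReading.unique {P : Fin n → Prop} {N : Fin n → Fin n → k} {h : k}
    {lam lam' : Fin n → WeyrLabel k} (w : WeyrReading P N h lam) (w' : WeyrReading P N h lam')
    (x : Fin n) (hx : P x) : lam x = lam' x := by
  have hpos : ∀ m x, P x → (lam x).pos = m → (lam' x).pos = m := by
    intro m
    induction m with
    | zero =>
      intro x hx h0
      have := w.one_le x hx
      omega
    | succ m ih =>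
      intro x hx hm
      have h1' := w'.one_le x hx
      by_cases h2 : 2 ≤ (lam x).pos
      · obtain ⟨y, hy, hne, hN⟩ := w.ex_pred x hx h2
        have e := (w.next y x hy hx hne hN).2
        have e' := (w'.next y x hy hx hne hN).2
        have := ih y hy (by omega)
        omega
      · by_cases h2' : 2 ≤ (lam' x).pos
        · obtain ⟨y, hy, hne, hN⟩ := w'.ex_pred x hx h2'
          have e := (w.next y x hy hx hne hN).2
          have := w.one_le y hy
          omega
        · have := w.one_le x hx
          omega
  -- Induction on the distance m from x to the end of its Jordan chain.
  have hsize : ∀ m x, P x → (lam x).size = (lam x).pos + m → (lam' x).size = (lam x).size := by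
    intro m
    induction m with
    | zero =>
      intro x hx hm
      have hp := hpos _ x hx rfl
      have hle := w'.le_size x hx
      by_contra hc
      obtain ⟨y, hy, hne, hN⟩ := w'.ex_succ x hx (by omega)
      have e := w.next x y hx hy hne hN
      have := w.le_size y hy
      omega
    | succ m ih =>
      intro x hx hm
      obtain ⟨y, hy, hne, hN⟩ := w.ex_succ x hx (by omega)
      have e := w.next x y hx hy hne hN
      have e' := w'.next x y hx hy hne hN
      have := ih y hy (by omega)
      omega
  have h1 := hpos _ x hx rfl
  have h2 := hsize ((lam x).size - (lam x).pos) x hx (by have := w.le_size x hx; omega)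
  have h3 : (lam x).ev = (lam' x).ev := add_left_cancel ((w.diag x hx).symm.trans (w'.diag x hx))
  rcases hlx : lam x with ⟨a, b, c⟩
  rcases hlx' : lam' x with ⟨a', b', c'⟩
  simp only [hlx, hlx'] at h1 h2 h3
  rw [h1, h2, h3]

section Loop

variable [LinearOrder k] {π₁ : Fin 𝔇₁.t → Fin 𝔇.t} {l : 𝔇.leads} {L : Finset (WeyrLabel k)}
  {ℓ₁ : Fin 𝔇₁.t → WeyrLabel k} {σ₁ : Fin n → Fin 𝔇₁.t} {r : Setoid (Fin n)}
  {ρ : Fin n → Fin n → Prop}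

/-- The rows lie over p and the columns over q, which may be different indices of one vertex.
Through `star`, which sends a row to its partner over q, the block becomes a square matrix indexed
by the rows. The scalar is the entry of the old `H` at (p, q). -/
theorem loop_weyrReading {S : Finset (k × ℕ)}
    (hL : ∀ a, a ∈ L ↔ (a.ev, a.size) ∈ S ∧ 1 ≤ a.pos ∧ a.pos ≤ a.size)
    (h₁ : IsSplitting 𝔇 𝔇₁ π₁ l WeyrLabel.lt (𝔇.labelsAt l.1.1 l.1.2 L L ⟨0, 1, 1⟩)
      (fun a => (a.ev, a.size)) (weyrBlock k) ℓ₁)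
    (e : IsExpansion 𝔇₁.vert r σ₁ ρ) (hH : 𝔇₁.ExpandsH Hn σ₁ ρ) {star : Fin n → Fin n}
    (hstar : ∀ x, π₁ (σ₁ x) = l.1.1 → π₁ (σ₁ (star x)) = l.1.2 ∧ ρ x (star x) ∧
      ℓ₁ (σ₁ x) = ℓ₁ (σ₁ (star x))) :
    WeyrReading (fun x => π₁ (σ₁ x) = l.1.1) (fun x y => Hn x (star y)) (𝔇.H l.1.1 l.1.2)
      fun x => ℓ₁ (σ₁ x) := by
  classical
  have hent : ∀ x y, π₁ (σ₁ x) = l.1.1 → π₁ (σ₁ y) = l.1.1 →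
      (ρ x y → Hn x (star y) = (if ℓ₁ (σ₁ x) = ℓ₁ (σ₁ y) then 𝔇.H l.1.1 l.1.2 else 0) +
        weyrBlock k (ℓ₁ (σ₁ x)) (ℓ₁ (σ₁ y))) ∧ (¬ ρ x y → Hn x (star y) = 0) := by
    intro x y hx hy
    obtain ⟨s1, s2, s3⟩ := hstar y hy
    obtain ⟨c1, c2⟩ := h₁.expandsH_lead hH hx s1
    refine ⟨fun hxy => ?_, fun hxy => c2 fun hc => hxy (e.trans _ _ _ hc (e.symm _ _ s2))⟩
    rw [c1 (e.trans _ _ _ hxy s2), h₁.H_apply, hx, s1, ← s3, 𝔇.A_one, mul_one]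
  have hmem : ∀ x, π₁ (σ₁ x) = l.1.1 → ℓ₁ (σ₁ x) ∈ L := by
    intro x hx
    have := h₁.isBlowUp.mem (σ₁ x)
    rwa [hx, labelsAt_left (vert_refl _ _)] at this
  have hex : ∀ x, π₁ (σ₁ x) = l.1.1 → ∀ m, 1 ≤ m → m ≤ (ℓ₁ (σ₁ x)).size →
      ∃ y, π₁ (σ₁ y) = l.1.1 ∧ ρ x y ∧
        ℓ₁ (σ₁ y) = ⟨(ℓ₁ (σ₁ x)).ev, (ℓ₁ (σ₁ x)).size, m⟩ := by
    intro x hx m hm hm'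
    obtain ⟨u, hu, hu'⟩ := (h₁.labels l.1.1 ⟨(ℓ₁ (σ₁ x)).ev, (ℓ₁ (σ₁ x)).size, m⟩).1 (by
      rw [labelsAt_left (vert_refl _ _)]
      exact (hL _).2 ⟨((hL _).1 (hmem x hx)).1, hm, hm'⟩)
    obtain ⟨y, rfl, hxy⟩ := e.ex x u ((h₁.vert _ _).2 ⟨by rw [hu'], Or.inl (by
      rw [hx, hu])⟩)
    exact ⟨y, hu, hxy, hu'⟩
  constructor
  · intro x hx
    rw [(hent x x hx hx).1 (e.refl x)]
    simp [weyrBlock]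
  · intro x y hx hy hne hN
    by_cases hxy : ρ x y
    · rw [(hent x y hx hy).1 hxy] at hN
      have hlab : ℓ₁ (σ₁ x) ≠ ℓ₁ (σ₁ y) := fun hc =>
        hne (e.inj x y hxy (h₁.isBlowUp.inj (hx.trans hy.symm) hc))
      rw [if_neg hlab, zero_add, weyrBlock] at hN
      split_ifs at hN with c1 c2 c3
      · refine absurd ?_ hlab
        rcases hlx : ℓ₁ (σ₁ x) with ⟨a, b, c⟩
        rcases hly : ℓ₁ (σ₁ y) with ⟨a', b', c'⟩
        simp only [hlx, hly] at c1 c2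
        rw [c1.1, c1.2, c2]
      · exact ⟨c1.2, c3⟩
      · exact absurd rfl hN
      · exact absurd rfl hN
    · exact absurd ((hent x y hx hy).2 hxy) hN
  · exact fun x hx => ((hL _).1 (hmem x hx)).2.1
  · exact fun x hx => ((hL _).1 (hmem x hx)).2.2
  · intro x hx h2
    have hle := ((hL _).1 (hmem x hx)).2.2
    obtain ⟨y, hy, hxy, hlab⟩ := hex x hx ((ℓ₁ (σ₁ x)).pos - 1) (by omega) (by omega)
    have hne : ℓ₁ (σ₁ y) ≠ ℓ₁ (σ₁ x) := by
      intro hc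
      have := congrArg WeyrLabel.pos (hlab.symm.trans hc)
      dsimp only at this
      omega
    refine ⟨y, hy, fun hc => hne (by rw [hc]), ?_⟩
    rw [(hent y x hy hx).1 (e.symm _ _ hxy), if_neg hne, zero_add, hlab]
    have h1 : ¬ (ℓ₁ (σ₁ x)).pos - 1 = (ℓ₁ (σ₁ x)).pos := by omega
    have h3 : (ℓ₁ (σ₁ x)).pos = (ℓ₁ (σ₁ x)).pos - 1 + 1 := by omega
    simp only [weyrBlock, and_self, if_true, if_neg h1, if_pos h3]
    exact one_ne_zero
  · intro x hx h2
    obtain ⟨y, hy, hxy, hlab⟩ := hex x hx ((ℓ₁ (σ₁ x)).pos + 1) (by omega) (by omega)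
    have hne : ℓ₁ (σ₁ x) ≠ ℓ₁ (σ₁ y) := by
      intro hc
      have := congrArg WeyrLabel.pos (hc.trans hlab)
      dsimp only at this
      omega
    refine ⟨y, hy, fun hc => hne (by rw [hc]), ?_⟩
    rw [(hent x y hx hy).1 hxy, if_neg hne, zero_add, hlab]
    have h1 : ¬ (ℓ₁ (σ₁ x)).pos = (ℓ₁ (σ₁ x)).pos + 1 := by omega
    simp only [weyrBlock, and_self, if_true, if_neg h1]
    exact one_ne_zero

theorem loop_isIso {π₂ : Fin 𝔇₂.t → Fin 𝔇.t} {L₂ : Finset (WeyrLabel k)}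
    {ℓ₂ : Fin 𝔇₂.t → WeyrLabel k} {σ₂ : Fin n → Fin 𝔇₂.t}
    {S S₂ : Finset (k × ℕ)} (hpq : 𝔇.vert.r l.1.1 l.1.2)
    (hL : ∀ a, a ∈ L ↔ (a.ev, a.size) ∈ S ∧ 1 ≤ a.pos ∧ a.pos ≤ a.size)
    (hL₂ : ∀ a, a ∈ L₂ ↔ (a.ev, a.size) ∈ S₂ ∧ 1 ≤ a.pos ∧ a.pos ≤ a.size)
    (h₁ : IsSplitting 𝔇 𝔇₁ π₁ l WeyrLabel.lt (𝔇.labelsAt l.1.1 l.1.2 L L ⟨0, 1, 1⟩)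
      (fun a => (a.ev, a.size)) (weyrBlock k) ℓ₁)
    (h₂ : IsSplitting 𝔇 𝔇₂ π₂ l WeyrLabel.lt (𝔇.labelsAt l.1.1 l.1.2 L₂ L₂ ⟨0, 1, 1⟩)
      (fun a => (a.ev, a.size)) (weyrBlock k) ℓ₂)
    {r₁ r₂ : Setoid (Fin n)} {ρ₁ ρ₂ : Fin n → Fin n → Prop}
    (e₁ : IsExpansion 𝔇₁.vert r₁ σ₁ ρ₁) (e₂ : IsExpansion 𝔇₂.vert r₂ σ₂ ρ₂)
    (H₁ : 𝔇₁.ExpandsH Hn σ₁ ρ₁) (H₂ : 𝔇₂.ExpandsH Hn σ₂ ρ₂)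
    (hσ : ∀ x, π₁ (σ₁ x) = π₂ (σ₂ x)) :
    ∃ f, IsIso 𝔇₁ 𝔇₂ f ∧ (∀ u, π₂ (f u) = π₁ u) ∧ ∀ x, f (σ₁ x) = σ₂ x := by
  have hσ' : π₂ ∘ σ₂ = π₁ ∘ σ₁ := funext fun x => (hσ x).symm
  have c₁ := h₁.isExpansion.comp e₁
  have c₂ := h₂.isExpansion.comp e₂
  rw [hσ'] at c₂
  -- One common `star` for both splittings, so that the same square matrix is read twice.
  have hex : ∀ x, (π₁ ∘ σ₁) x = l.1.1 → ∃ y, (π₁ ∘ σ₁) y = l.1.2 ∧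
      (ρ₁ x y ∧ (𝔇.vert.r (π₁ (σ₁ x)) (π₁ (σ₁ y)) ∧ ℓ₁ (σ₁ x) = ℓ₁ (σ₁ y))) ∧
      (ρ₂ x y ∧ (𝔇.vert.r (π₂ (σ₂ x)) (π₂ (σ₂ y)) ∧ ℓ₂ (σ₂ x) = ℓ₂ (σ₂ y))) := by
    intro x hx
    obtain ⟨y, hy, hxy⟩ := c₁.ex x l.1.2 (by rw [hx]; exact hpq)
    obtain ⟨y', hy', hxy'⟩ := c₂.ex x l.1.2 (by rw [hx]; exact hpq)
    obtain rfl := c₁.partner_unique c₂ hxy hxy' (hy.trans hy'.symm)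
    exact ⟨y, hy, hxy, hxy'⟩
  choose! star hstar using hex
  have w₁ := loop_weyrReading hL h₁ e₁ H₁ (star := star) fun x hx =>
    ⟨(hstar x hx).1, (hstar x hx).2.1.1, (hstar x hx).2.1.2.2⟩
  have w₂ := loop_weyrReading hL₂ h₂ e₂ H₂ (star := star) fun x hx => by
    rw [← hσ] at hx
    exact ⟨(hσ _).symm.trans (hstar x hx).1, (hstar x hx).2.2.1, (hstar x hx).2.2.2.2⟩
  simp only [← hσ] at w₂
  refine h₁.isIso h₂ e₁ e₂ hσ fun x hx => ?_
  rcases hx with hx | hx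
  · exact w₁.unique w₂ x hx
  · exact h₁.label_transfer h₂ e₁ e₂ hσ (vert_symm hpq) (fun x hx => w₁.unique w₂ x hx) x hx

end Loop

/-- The first arrow is unique, and the kind of reduction is decided by whether δ vanishes and
whether the arrow is a loop. For a regularization there is no choice left; in the other cases the
labels are read from `Hn`. -/
theorem IsReduction.isIso_of_reach [LinearOrder k] {π₁ : Fin 𝔇₁.t → Fin 𝔇.t}
    {π₂ : Fin 𝔇₂.t → Fin 𝔇.t} {σ₁ : Fin n → Fin 𝔇₁.t} {σ₂ : Fin n → Fin 𝔇₂.t}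
    (h₁ : IsReduction 𝔇 𝔇₁ π₁) (h₂ : IsReduction 𝔇 𝔇₂ π₂) (R₁ : Reach Hn 𝔇₁ σ₁)
    (R₂ : Reach Hn 𝔇₂ σ₂) (hσ : ∀ x, π₁ (σ₁ x) = π₂ (σ₂ x)) :
    ∃ f, IsIso 𝔇₁ 𝔇₂ f ∧ (∀ u, π₂ (f u) = π₁ u) ∧ ∀ x, f (σ₁ x) = σ₂ x := by
  obtain ⟨r₁, ρ₁, e₁, H₁⟩ := R₁.exists_isExpansion
  obtain ⟨r₂, ρ₂, e₂, H₂⟩ := R₂.exists_isExpansion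
  obtain ⟨l₁, h₁⟩ := h₁
  obtain ⟨l₂, h₂⟩ := h₂
  have hl : l₁ = l₂ := by
    have f₁ : 𝔇.IsFirstArrow l₁ := by
      rcases h₁ with h | ⟨-, S, -, -, L, -, ℓ, h⟩ | ⟨-, LX, LY, -, -, -, -, -, ℓ, h⟩ <;>
        exact h.first
    have f₂ : 𝔇.IsFirstArrow l₂ := by
      rcases h₂ with h | ⟨-, S, -, -, L, -, ℓ, h⟩ | ⟨-, LX, LY, -, -, -, -, -, ℓ, h⟩ <;>
        exact h.first
    exact f₁.unique f₂
  subst hl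
  rcases h₁ with h₁ | ⟨v₁, S₁, hS₁, p₁, L₁, hL₁, ℓ₁, h₁⟩ |
    ⟨v₁, LX₁, LY₁, s₁, s₁', n₁, n₁', q₁, ℓ₁, h₁⟩ <;>
  rcases h₂ with h₂ | ⟨v₂, S₂, hS₂, p₂, L₂, hL₂, ℓ₂, h₂⟩ |
    ⟨v₂, LX₂, LY₂, s₂, s₂', n₂, n₂', q₂, ℓ₂, h₂⟩
  · exact h₁.isIso h₂ hσ
  · exact absurd h₂.delta h₁.delta
  · exact absurd h₂.delta h₁.delta
  · exact absurd h₁.delta h₂.delta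
  · exact loop_isIso v₁ hL₁ hL₂ (h₁.loop_isSplitting (weyr_labels_nonempty hS₁ p₁ hL₁))
      (h₂.loop_isSplitting (weyr_labels_nonempty hS₂ p₂ hL₂)) e₁ e₂ H₁ H₂ hσ
  · exact absurd v₁ v₂
  · exact absurd h₁.delta h₂.delta
  · exact absurd v₂ v₁
  · exact edge_isIso v₁ s₁ s₁' q₁ s₂ s₂' q₂ (h₁.edge_isSplitting n₁ n₁')
      (h₂.edge_isSplitting n₂ n₂') e₁ e₂ H₁ H₂ hσ

end MatrixBimoduleProblem

/-! ### The border vertex and its invariant -/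

namespace MatrixBimoduleProblem

variable {k : Type*} [Field k]

/-- `x` is the first index of a block in the vertex of `z`. -/
def IsFront (𝔄 : MatrixBimoduleProblem k) (z : Fin 𝔄.t) {t : ℕ} (blk : Fin t → Fin 𝔄.t)
    (x : Fin t) : Prop :=
  𝔄.vert.r (blk x) z ∧ ∀ y, blk y = blk x → x ≤ y

/-- `𝔅` is `𝔄` with the first arrow `a_l` removed and `𝒦₁` replaced by `ker δ(a_l)`. -/
structure IsShrink (𝔄 𝔅 : MatrixBimoduleProblem k) (π : Fin 𝔅.t → Fin 𝔄.t) (l : 𝔄.leads) :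
    Prop where
  strictMono : StrictMono π
  surjective : Function.Surjective π
  vert : ∀ x y, 𝔅.vert.r x y ↔ 𝔄.vert.r (π x) (π y)
  K1 : ∀ U, U ∈ 𝔅.K1 ↔ ∃ V ∈ 𝔄.kerDelta l, U = V.submatrix π π
  H : 𝔅.H = 𝔄.H.submatrix π π

variable {𝔄 𝔅 : MatrixBimoduleProblem k}

theorem IsRegularization.isShrink {π : Fin 𝔅.t → Fin 𝔄.t} {l : 𝔄.leads}
    (h : IsRegularization 𝔄 𝔅 π l) : IsShrink 𝔄 𝔅 π l where
  strictMono := h.strictMono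
  surjective := h.surjective
  vert := h.vert
  K1 U := by
    rw [h.K1]
    constructor
    · rintro ⟨V, hV, rfl⟩
      exact ⟨V.1, ⟨V.2, hV⟩, rfl⟩
    · rintro ⟨V, hV, rfl⟩
      exact ⟨⟨V, hV.1⟩, hV.2, rfl⟩
  H := h.H

theorem removeFirst_isShrink {l : 𝔄.leads} (hl : 𝔄.IsFirstArrow l) :
    IsShrink 𝔄 (𝔄.removeFirst l hl) id l where
  strictMono := strictMono_id
  surjective := Function.surjective_id
  vert _ _ := Iff.rfl
  K1 U := ⟨fun h => ⟨U, h, rfl⟩, by rintro ⟨V, hV, rfl⟩; exact hV⟩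
  H := rfl

theorem removeFirst_isRegularization {l : 𝔄.leads} (hl : 𝔄.IsFirstArrow l)
    (hδ : 𝔄.deltaFirst l ≠ 0) : IsRegularization 𝔄 (𝔄.removeFirst l hl) id l where
  first := hl
  delta := hδ
  strictMono := strictMono_id
  surjective := Function.surjective_id
  vert _ _ := Iff.rfl
  K1 U := by
    rw [(removeFirst_isShrink hl).K1]
    constructor
    · rintro ⟨V, hV, rfl⟩
      exact ⟨⟨V, hV.1⟩, hV.2, rfl⟩
    · rintro ⟨V, hV, rfl⟩
      exact ⟨V.1, ⟨V.2, hV⟩, rfl⟩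
  M1 U := by
    rw [removeFirst_M1]
    constructor
    · exact fun h => ⟨U, h.1, h.2, rfl⟩
    · rintro ⟨B, hB, hB', rfl⟩
      exact ⟨hB, hB'⟩
  H := rfl

-- For G = (0) every index keeps one label, so nothing is split, the strictly upper F are zero, and
-- the induced problem merely loses `a_l`. As δ vanishes, its kernel is all of 𝒦₁.
open Classical in
theorem removeFirst_isInduced {l : 𝔄.leads} (hl : 𝔄.IsFirstArrow l)
    (hδ : 𝔄.deltaFirst l = 0) (hpq : ¬ 𝔄.vert.r l.1.1 l.1.2) :
    ∃ ℓ, IsInduced 𝔄 (𝔄.removeFirst l hl) id l (fun a b => a < b)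
      (𝔄.labelsAt l.1.1 l.1.2 {2} {0} 1) id (edgeBlock k) ℓ := by
  obtain ⟨ℓ, hℓ⟩ : ∃ ℓ : Fin 𝔄.t → Fin 3, ℓ = fun x => if 𝔄.vert.r x l.1.1 then 2 else
    if 𝔄.vert.r x l.1.2 then 0 else 1 := ⟨_, rfl⟩
  have hp : ∀ x, 𝔄.vert.r x l.1.1 → ℓ x = 2 := fun x hx => by simp [hℓ, hx]
  have hq : ∀ x, 𝔄.vert.r x l.1.2 → ℓ x = 0 := fun x hx => by
    have : ¬ 𝔄.vert.r x l.1.1 := fun h => hpq (vert_trans (vert_symm h) hx)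
    simp [hℓ, hx, this]
  have ho : ∀ x, ¬ 𝔄.vert.r x l.1.1 → ¬ 𝔄.vert.r x l.1.2 → ℓ x = 1 := fun x h h' => by
    simp [hℓ, h, h']
  have hlab : ∀ x, 𝔄.labelsAt l.1.1 l.1.2 {2} {0} 1 x = {ℓ x} := by
    intro x
    by_cases h1 : 𝔄.vert.r x l.1.1
    · rw [labelsAt_left h1, hp x h1]
    · by_cases h2 : 𝔄.vert.r x l.1.2
      · rw [labelsAt_right hpq h2, hq x h2]
      · rw [labelsAt_other h1 h2, ho x h1 h2]
  have hℓv : ∀ x y, 𝔄.vert.r x y → ℓ x = ℓ y := by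
    intro x y hxy
    have := hlab x
    rw [labelsAt_vert hxy, hlab y] at this
    exact (Finset.singleton_injective this).symm
  have hblow : IsBlowUp (fun a b : Fin 3 => a < b) (𝔄.labelsAt l.1.1 l.1.2 {2} {0} 1)
      (id : Fin 𝔄.t → Fin 𝔄.t) ℓ := by
    constructor
    · intro x y
      constructor
      · exact fun h => Or.inl h
      · rintro (h | ⟨h, h'⟩)
        · exact h
        · rw [show x = y from h] at h'
          exact absurd h' (lt_irrefl _)
    · intro i a
      rw [hlab, Finset.mem_singleton]
      constructor
      · rintro rfl
        exact ⟨i, rfl, rfl⟩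
      · rintro ⟨x, rfl, rfl⟩
        rfl
  have hstep : ∀ N : Submodule k (Matrix (Fin 𝔄.t) (Fin 𝔄.t) k),
      (∀ U ∈ N, ∀ f g : Fin 𝔄.t → k, (∀ i j, 𝔄.vert.r i j → f i = f j) →
        (∀ i j, 𝔄.vert.r i j → g i = g j) → scaleBy f g U ∈ N) →
      ∀ f : Fin 3 → Fin 3 → Matrix (Fin 𝔄.t) (Fin 𝔄.t) k, (∀ a b, f a b ∈ N) →
        blow id ℓ f ∈ N := by
    intro N hN f hf
    rw [blow_eq_sum hblow]
    refine N.sum_mem fun a _ => N.sum_mem fun b _ => ?_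
    have : slice id ℓ a b (f a b) = scaleBy (fun i => if ℓ i = a then 1 else 0)
        (fun i => if ℓ i = b then 1 else 0) (f a b) := by
      ext x y
      simp only [slice_apply, scaleBy, Matrix.of_apply, id]
      by_cases h1 : ℓ x = a <;> by_cases h2 : ℓ y = b <;> simp [h1, h2]
    rw [this]
    exact hN _ (hf a b) _ _ (fun i j hij => by rw [hℓv i j hij])
      fun i j hij => by rw [hℓv i j hij]
  refine ⟨ℓ, hl, hδ, hblow.order, hblow.labels, ?_, ?_, ?_, ?_⟩
  · intro x y
    constructor
    · exact fun h => ⟨hℓv x y h, Or.inl h⟩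
    · rintro ⟨h1, h2 | ⟨h2 | h2, h3 | h3⟩⟩
      · exact h2
      · exact vert_trans h2 (vert_symm h3)
      · simp only [id] at h1 h2 h3
        rw [hp _ h2, hq _ h3] at h1
        exact absurd h1 (by decide)
      · simp only [id] at h1 h2 h3
        rw [hq _ h2, hp _ h3] at h1
        exact absurd h1 (by decide)
      · exact vert_trans h2 (vert_symm h3)
  · refine Eq.trans (b := 𝔄.inducedK1 id l _ _ _ ℓ) (?_ : 𝔄.kerDelta l = _)
      (span_eq_inducedK1 hblow).symm
    refine le_antisymm (fun V hV => ?_) ?_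
    · refine ⟨_, fun _ _ => V, IsUpperEndo.zero, fun _ _ => hV.1, ?_⟩
      ext x y
      simp [diagStar_apply, blow_apply]
    · rintro _ ⟨F, f, hF, hf, rfl⟩
      have hF0 : diagStar id ℓ F = 0 := by
        ext x y
        rw [diagStar_apply, Matrix.zero_apply]
        split_ifs with hxy
        · by_contra hne
          have hm : ℓ x ∈ 𝔄.labelsAt l.1.1 l.1.2 {2} {0} 1 x := by simp [hlab]
          have hxy' : x = y := hxy
          rw [← hxy'] at hne
          exact lt_irrefl _ (hF.upper x _ hm _ hm hne)
        · rfl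
      rw [hF0, zero_add]
      have := hstep 𝔄.K1 (fun U hU f g hf hg => K1_scaleBy hU hf hg) f hf
      exact ⟨this, deltaFirst_eq_zero_iff.1 hδ _ this⟩
  · refine Eq.trans (removeFirst_M1 l hl) (Eq.trans (b := 𝔄.inducedM1 id l ℓ) (?_ : 𝔄.M1Off l = _)
      (span_eq_inducedM1 hblow).symm)
    refine le_antisymm (fun U hU => ⟨fun _ _ => U, fun _ _ => hU, rfl⟩) ?_
    · rintro _ ⟨f, hf, rfl⟩
      exact hstep (𝔄.M1Off l) (fun U hU f g hf hg => M1Off_scaleBy hU hf hg) f hf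
  · intro x y
    have h0 : edgeBlock k (ℓ x) (ℓ y) * 𝔄.A l x y = 0 := by
      by_contra hne
      have h1 := (A_vert (right_ne_zero_of_mul hne)).1
      have h2 := left_ne_zero_of_mul hne
      rw [hp x h1, edgeBlock, if_neg fun hc => absurd hc.1 (by decide)] at h2
      exact h2 rfl
    refine ⟨fun _ => ?_, fun hne => ?_⟩
    · exact ((add_zero _).symm.trans (congrArg _ h0.symm))
    · refine Eq.trans ?_ h0.symm
      by_contra hH
      exact hne (hℓv x y (𝔄.H_vert x y hH))

/-- Removal of the first arrow, if it is not a loop, is a reduction in any case: a regularization if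
δ is non-zero, the edge reduction G = (0) if it is zero. Arrows in border columns are deleted in
this way. -/
theorem removeFirst_isReduction [LinearOrder k] {l : 𝔄.leads} (hl : 𝔄.IsFirstArrow l)
    (hpq : ¬ 𝔄.vert.r l.1.1 l.1.2) : IsReduction 𝔄 (𝔄.removeFirst l hl) id := by
  classical
  by_cases hδ : 𝔄.deltaFirst l = 0
  · refine ⟨l, Or.inr (Or.inr ⟨hpq, {2}, {0}, by simp, by simp, by simp, by simp, by simp,
      removeFirst_isInduced hl hδ hpq⟩)⟩
  · exact ⟨l, Or.inl (removeFirst_isRegularization hl hδ)⟩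

/-- The border vertex consists of the first indices of the blocks in the vertex of `z`; the columns
of `H` are zero there, all other indices of these blocks are equivalent to indices outside `T₂`,
and the entries in the first row of the main diagonal block are independent. -/
structure FrontInv (𝔄 : MatrixBimoduleProblem k) (T₂ : Set (Fin 𝔄.t)) (z : Fin 𝔄.t)
    (𝔇 : MatrixBimoduleProblem k) (blk : Fin 𝔇.t → Fin 𝔄.t) : Prop where
  cls : ∀ w, 𝔄.IsFront z blk w → ∀ w', 𝔇.vert.r w w' ↔ 𝔄.IsFront z blk w'
  H_zero : ∀ w, 𝔄.IsFront z blk w → ∀ x, 𝔇.H x w = 0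
  linked : ∀ x, 𝔄.vert.r (blk x) z → ¬ 𝔄.IsFront z blk x → ∃ u, blk u ∉ T₂ ∧ 𝔇.vert.r x u
  free : ∀ w b, 𝔄.IsFront z blk w → blk w = z → blk b = z → b ≠ w →
    ∃ V ∈ 𝔇.K1, V w b = 1 ∧ ∀ b', blk b' = z → b' ≠ b → V w b' = 0

namespace FrontInv

variable {T₂ : Set (Fin 𝔄.t)} {z : Fin 𝔄.t} {𝔇 𝔇' : MatrixBimoduleProblem k}
  {blk : Fin 𝔇.t → Fin 𝔄.t} {π : Fin 𝔇'.t → Fin 𝔇.t} {l : 𝔇.leads}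

theorem refl (z : Fin 𝔄.t) (hbip : 𝔄.IsBipartite T₂) : FrontInv 𝔄 T₂ z 𝔄 id where
  cls w hw w' := by
    refine ⟨fun h => ⟨vert_trans (vert_symm h) hw.1, fun y hy => hy.ge⟩, fun h => ?_⟩
    exact vert_trans hw.1 (vert_symm h.1)
  H_zero w hw x := by rw [hbip.H]; rfl
  linked x hx hx' := absurd ⟨hx, fun y hy => hy.ge⟩ hx'
  free w b hw h1 h2 h3 := absurd (h2.trans h1.symm) h3

/-- Only the freeness of the first row needs an argument: the matrices witnessing it must survive in
the kernel of δ. Their corners in the rows of the border vertex do. -/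
theorem shrink (h : FrontInv 𝔄 T₂ z 𝔇 blk) (hs : IsShrink 𝔇 𝔇' π l)
    (hp : ¬ 𝔄.IsFront z blk l.1.1) : FrontInv 𝔄 T₂ z 𝔇' (blk ∘ π) := by
  have hfront : ∀ w, 𝔄.IsFront z (blk ∘ π) w ↔ 𝔄.IsFront z blk (π w) := by
    intro w
    refine and_congr_right fun _ => ⟨fun hw y hy => ?_, fun hw y hy => ?_⟩
    · obtain ⟨y, rfl⟩ := hs.surjective y
      exact hs.strictMono.monotone (hw y hy)
    · exact hs.strictMono.le_iff_le.1 (hw (π y) hy)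
  constructor
  · intro w hw w'
    rw [hs.vert, hfront w', h.cls _ ((hfront w).1 hw)]
  · intro w hw x
    rw [hs.H]
    exact h.H_zero _ ((hfront w).1 hw) _
  · intro x hx hx'
    obtain ⟨u, hu, hxu⟩ := h.linked (π x) hx fun hc => hx' ((hfront x).2 hc)
    obtain ⟨u, rfl⟩ := hs.surjective u
    exact ⟨u, hu, (hs.vert _ _).2 hxu⟩
  · intro w b hw h1 h2 h3
    have hw' := (hfront w).1 hw
    obtain ⟨V, hV, hV1, hV0⟩ := h.free (π w) (π b) hw' h1 h2 fun hc =>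
      h3 (hs.strictMono.injective hc)
    have hc : ∀ u v, ¬ 𝔇.vert.r u (π w) → corner 𝔇.vert (π w) (π b) V u v = 0 := by
      intro u v huv
      simp [corner, huv]
    refine ⟨(corner 𝔇.vert (π w) (π b) V).submatrix π π, (hs.K1 _).2 ⟨_, ⟨𝔇.K1_corner V hV _ _, ?_⟩,
      rfl⟩, ?_, ?_⟩
    -- At (p, q) the product with `H` on the right vanishes because row p of the corner is zero, and
    -- the product with `H` on the left because it only meets columns of `H` in the border vertex.
    · rw [Matrix.sub_apply, Matrix.mul_apply, Matrix.mul_apply]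
      rw [Finset.sum_eq_zero, Finset.sum_eq_zero, sub_zero]
      · intro u _
        by_cases hu : 𝔇.vert.r u (π w)
        · rw [h.H_zero u ((h.cls _ hw' u).1 (vert_symm hu)), zero_mul]
        · rw [hc _ _ hu, mul_zero]
      · intro u _
        rw [hc, zero_mul]
        exact fun hu => hp ((h.cls _ hw' _).1 (vert_symm hu))
    · simp [corner, hV1]
    · intro b' hb' hne
      have := hV0 (π b') hb' fun hc => hne (hs.strictMono.injective hc)
      simp [corner, this]

end FrontInv

end MatrixBimoduleProblem

namespace MatrixBimoduleProblem

variable {k : Type*} [Field k] {𝔄 : MatrixBimoduleProblem k}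

theorem IsInduced.slice_mem_K1 {𝔅 : MatrixBimoduleProblem k} {π : Fin 𝔅.t → Fin 𝔄.t} {l : 𝔄.leads}
    {Λ κ : Type*} {lt : Λ → Λ → Prop} {lab : Fin 𝔄.t → Finset Λ} {kind : Λ → κ} {G : Λ → Λ → k}
    {ℓ : Fin 𝔅.t → Λ} (h : IsInduced 𝔄 𝔅 π l lt lab kind G ℓ)
    {V : Matrix (Fin 𝔄.t) (Fin 𝔄.t) k} (hV : V ∈ 𝔄.K1) (a b : Λ) : slice π ℓ a b V ∈ 𝔅.K1 := by
  rw [h.K1]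
  exact Submodule.subset_span (Or.inr ⟨V, hV, a, b, rfl⟩)

theorem IsInduced.diagStar_mem_K1 {𝔅 : MatrixBimoduleProblem k} {π : Fin 𝔅.t → Fin 𝔄.t}
    {l : 𝔄.leads} {Λ κ : Type*} {lt : Λ → Λ → Prop} {lab : Fin 𝔄.t → Finset Λ} {kind : Λ → κ}
    {G : Λ → Λ → k} {ℓ : Fin 𝔅.t → Λ} (h : IsInduced 𝔄 𝔅 π l lt lab kind G ℓ)
    {F : Fin 𝔄.t → Λ → Λ → k} (hF : 𝔄.IsUpperEndo lt lab l G F) : diagStar π ℓ F ∈ 𝔅.K1 := by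
  rw [h.K1]
  exact Submodule.subset_span (Or.inl ⟨F, hF, rfl⟩)

namespace FrontInv

variable {T₂ : Set (Fin 𝔄.t)} {z : Fin 𝔄.t} {𝔇 𝔇' : MatrixBimoduleProblem k}
  {blk : Fin 𝔇.t → Fin 𝔄.t} {π : Fin 𝔇'.t → Fin 𝔇.t} {l : 𝔇.leads} {Λ κ : Type*}
  {lt : Λ → Λ → Prop} {lab : Fin 𝔇.t → Finset Λ} {kind : Λ → κ} {G : Λ → Λ → k}
  {ℓ : Fin 𝔇'.t → Λ}

theorem isFront_of_comp (hs : IsSplitting 𝔇 𝔇' π l lt lab kind G ℓ) {w : Fin 𝔇'.t}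
    (hw : 𝔄.IsFront z (blk ∘ π) w) : 𝔄.IsFront z blk (π w) := by
  refine ⟨hw.1, fun y hy => ?_⟩
  obtain ⟨y, rfl⟩ := hs.isExpansion.surj y
  exact hs.isBlowUp.mono (hw.2 y hy)

theorem exists_slice (h : FrontInv 𝔄 T₂ z 𝔇 blk) (hs : IsSplitting 𝔇 𝔇' π l lt lab kind G ℓ)
    {w b : Fin 𝔇'.t} (hw : 𝔄.IsFront z blk (π w)) (h1 : blk (π w) = z) (h2 : blk (π b) = z)
    (h3 : π b ≠ π w) :
    ∃ V ∈ 𝔇'.K1, V w b = 1 ∧ ∀ b', blk (π b') = z → b' ≠ b → V w b' = 0 := by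
  classical
  obtain ⟨V, hV, hV1, hV0⟩ := h.free _ _ hw h1 h2 h3
  refine ⟨_, hs.slice_mem_K1 hV (ℓ w) (ℓ b), ?_, fun b' hb' hne => ?_⟩
  · rw [slice_apply, if_pos ⟨rfl, rfl⟩, hV1]
  · rw [slice_apply]
    split_ifs with hc
    · exact hV0 _ hb' fun hπ => hne (hs.isBlowUp.inj hπ hc.2)
    · rfl

theorem linked_of_not_front (h : FrontInv 𝔄 T₂ z 𝔇 blk)
    (hs : IsSplitting 𝔇 𝔇' π l lt lab kind G ℓ) {x : Fin 𝔇'.t} (hx : 𝔄.vert.r (blk (π x)) z)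
    (hx' : ¬ 𝔄.IsFront z blk (π x)) : ∃ u, blk (π u) ∉ T₂ ∧ 𝔇'.vert.r x u := by
  obtain ⟨u, hu, hxu⟩ := h.linked (π x) hx hx'
  obtain ⟨y, rfl, hy⟩ := hs.isExpansion.ex x u hxu
  exact ⟨y, hu, hs.isExpansion.vert _ _ hy⟩

theorem label_eq (h : FrontInv 𝔄 T₂ z 𝔇 blk)
    (hs : IsSplitting 𝔇 𝔇' π l lt lab kind G ℓ) (hp : ¬ 𝔄.IsFront z blk l.1.1)
    (hq : ¬ 𝔄.IsFront z blk l.1.2) {o : Λ}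
    (hlab : ∀ i, ¬ 𝔇.vert.r i l.1.1 → ¬ 𝔇.vert.r i l.1.2 → lab i = {o}) {w : Fin 𝔇'.t}
    (hw : 𝔄.IsFront z blk (π w)) : ℓ w = o := by
  have := hs.isBlowUp.mem w
  rwa [hlab _ (fun hc => hp ((h.cls _ hw _).1 hc)) fun hc => hq ((h.cls _ hw _).1 hc),
    Finset.mem_singleton] at this

theorem isFront_comp_iff (h : FrontInv 𝔄 T₂ z 𝔇 blk)
    (hs : IsSplitting 𝔇 𝔇' π l lt lab kind G ℓ) (hp : ¬ 𝔄.IsFront z blk l.1.1)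
    (hq : ¬ 𝔄.IsFront z blk l.1.2) {o : Λ}
    (hlab : ∀ i, ¬ 𝔇.vert.r i l.1.1 → ¬ 𝔇.vert.r i l.1.2 → lab i = {o}) {w : Fin 𝔇'.t} :
    𝔄.IsFront z (blk ∘ π) w ↔ 𝔄.IsFront z blk (π w) := by
  refine ⟨isFront_of_comp hs, fun hw => ⟨hw.1, fun y hy => ?_⟩⟩
  rcases (hw.2 (π y) hy).lt_or_eq with h1 | h1
  · exact ((hs.order _ _).2 (Or.inl h1)).le
  · refine (hs.isBlowUp.inj h1 ?_).le
    rw [h.label_eq hs hp hq hlab hw, h.label_eq hs hp hq hlab (h1 ▸ hw)]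

/-- The border vertex is neither X nor Y, so its indices carry the single label o. They are not
split, and the matrix G does not touch their columns. -/
theorem splitting_of_not_front (h : FrontInv 𝔄 T₂ z 𝔇 blk)
    (hs : IsSplitting 𝔇 𝔇' π l lt lab kind G ℓ) (hp : ¬ 𝔄.IsFront z blk l.1.1)
    (hq : ¬ 𝔄.IsFront z blk l.1.2) {o : Λ}
    (hlab : ∀ i, ¬ 𝔇.vert.r i l.1.1 → ¬ 𝔇.vert.r i l.1.2 → lab i = {o}) :
    FrontInv 𝔄 T₂ z 𝔇' (blk ∘ π) := by
  classical
  have hnp : ∀ w, 𝔄.IsFront z blk w → ¬ 𝔇.vert.r w l.1.1 := fun w hw hc => hp ((h.cls w hw _).1 hc)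
  have hnq : ∀ w, 𝔄.IsFront z blk w → ¬ 𝔇.vert.r w l.1.2 := fun w hw hc => hq ((h.cls w hw _).1 hc)
  have hℓ : ∀ w, 𝔄.IsFront z blk (π w) → ℓ w = o := fun w => h.label_eq hs hp hq hlab
  have hinj : ∀ w y, 𝔄.IsFront z blk (π w) → π y = π w → y = w := fun w y hw hy =>
    hs.isBlowUp.inj hy (by rw [hℓ w hw, hℓ y (hy ▸ hw)])
  have hfront := fun w => h.isFront_comp_iff hs hp hq hlab (w := w)
  constructor
  · intro w hw w'
    have hw' := (hfront w).1 hw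
    rw [hs.vert, hfront w', ← h.cls _ hw']
    constructor
    · rintro ⟨-, h1 | ⟨h1 | h1, -⟩⟩
      exacts [h1, absurd h1 (hnp _ hw'), absurd h1 (hnq _ hw')]
    · intro h1
      exact ⟨by rw [hℓ w hw', hℓ w' ((h.cls _ hw' _).1 h1)], Or.inl h1⟩
  · intro w hw x
    have hw' := (hfront w).1 hw
    rw [hs.H_apply, h.H_zero _ hw', ite_self, zero_add]
    by_contra hne
    exact hnq _ hw' (A_vert (right_ne_zero_of_mul hne)).2
  · intro x hx hx'
    exact h.linked_of_not_front hs hx fun hc => hx' ((hfront x).2 hc)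
  · intro w b hw h1 h2 h3
    have hw' := (hfront w).1 hw
    exact h.exists_slice hs hw' h1 h2 fun hc => h3 (hinj w b hw' hc)

theorem label_edge {LX LY : Finset (Fin 3)} {ℓ : Fin 𝔇'.t → Fin 3}
    (h : FrontInv 𝔄 T₂ z 𝔇 blk)
    (hs : IsSplitting 𝔇 𝔇' π l (fun a b => a < b) (𝔇.labelsAt l.1.1 l.1.2 LX LY 1) id
      (edgeBlock k) ℓ) (hpq : ¬ 𝔇.vert.r l.1.1 l.1.2) (hY : LY ⊆ {0, 1})
    (hq : 𝔄.IsFront z blk l.1.2) {w : Fin 𝔇'.t} (hw : 𝔄.IsFront z blk (π w)) :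
    ℓ w = 0 ∨ ℓ w = 1 := by
  have := hs.isBlowUp.mem w
  rw [labelsAt_right hpq (vert_symm ((h.cls _ hq _).2 hw))] at this
  simpa using hY this

/-- The label 0 precedes 1, so the part labelled 0 of a split border index becomes the new first
index of its block. -/
theorem isFront_edge_iff {LX LY : Finset (Fin 3)} {ℓ : Fin 𝔇'.t → Fin 3}
    (h : FrontInv 𝔄 T₂ z 𝔇 blk)
    (hs : IsSplitting 𝔇 𝔇' π l (fun a b => a < b) (𝔇.labelsAt l.1.1 l.1.2 LX LY 1) id
      (edgeBlock k) ℓ) (hpq : ¬ 𝔇.vert.r l.1.1 l.1.2) (hY : LY ⊆ {0, 1})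
    (h0 : 0 ∈ LY) (hq : 𝔄.IsFront z blk l.1.2) {w : Fin 𝔇'.t} :
    𝔄.IsFront z (blk ∘ π) w ↔ 𝔄.IsFront z blk (π w) ∧ ℓ w = 0 := by
  have hlabq : ∀ w, 𝔄.IsFront z blk w → 𝔇.labelsAt l.1.1 l.1.2 LX LY 1 w = LY := fun w hw =>
    labelsAt_right hpq (vert_symm ((h.cls _ hq _).2 hw))
  have hℓ : ∀ w, 𝔄.IsFront z blk (π w) → ℓ w = 0 ∨ ℓ w = 1 := fun w =>
    h.label_edge hs hpq hY hq
  constructor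
  · intro hw
    have hw' := isFront_of_comp hs hw
    obtain ⟨y, hy, hy'⟩ := (hs.labels (π w) 0).1 (by rw [hlabq _ hw']; exact h0)
    refine ⟨hw', (hℓ w hw').resolve_right fun hc => ?_⟩
    have : y < w := (hs.order _ _).2 (Or.inr ⟨hy, by rw [hy', hc]; decide⟩)
    exact absurd (hw.2 y (congrArg blk hy)) (not_le.2 this)
  · rintro ⟨hw, hw0⟩
    refine ⟨hw.1, fun y hy => ?_⟩
    rcases (hw.2 (π y) hy).lt_or_eq with h1 | h1
    · exact ((hs.order _ _).2 (Or.inl h1)).le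
    · rcases hℓ y (h1 ▸ hw) with h2 | h2
      · exact (hs.isBlowUp.inj h1 (hw0.trans h2.symm)).le
      · exact ((hs.order _ _).2 (Or.inr ⟨h1, by rw [h2, hw0]; decide⟩)).le

/-- The part labelled 0 inherits the role of the border, since column 0 of G is zero. A part
labelled 1 joins the vertex of the row of the entry 1, which lies over an index outside `T₂`: this
is the source of `linked`. -/
theorem edge_of_front {LX LY : Finset (Fin 3)} {ℓ : Fin 𝔇'.t → Fin 3}
    (h : FrontInv 𝔄 T₂ z 𝔇 blk)
    (hs : IsSplitting 𝔇 𝔇' π l (fun a b => a < b) (𝔇.labelsAt l.1.1 l.1.2 LX LY 1) id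
      (edgeBlock k) ℓ) (hpq : ¬ 𝔇.vert.r l.1.1 l.1.2) (hX : LX ⊆ {1, 2}) (hY : LY ⊆ {0, 1})
    (h01 : 1 ∈ LX ↔ 1 ∈ LY) (h0 : 0 ∈ LY) (hp : blk l.1.1 ∉ T₂)
    (hq : 𝔄.IsFront z blk l.1.2) : FrontInv 𝔄 T₂ z 𝔇' (blk ∘ π) := by
  classical
  have hfq : ∀ w, 𝔄.IsFront z blk w ↔ 𝔇.vert.r w l.1.2 := fun w =>
    (h.cls _ hq w).symm.trans ⟨vert_symm, vert_symm⟩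
  have hlabq : ∀ w, 𝔄.IsFront z blk w → 𝔇.labelsAt l.1.1 l.1.2 LX LY 1 w = LY := fun w hw =>
    labelsAt_right hpq ((hfq w).1 hw)
  have hℓ : ∀ w, 𝔄.IsFront z blk (π w) → ℓ w = 0 ∨ ℓ w = 1 := fun w =>
    h.label_edge hs hpq hY hq
  have hfront := fun w => h.isFront_edge_iff hs hpq hY h0 hq (w := w)
  constructor
  · intro w hw w'
    obtain ⟨hw, hw0⟩ := (hfront w).1 hw
    rw [hs.vert, hfront w']
    constructor
    · rintro ⟨h1, h2⟩
      have h1 : ℓ w' = 0 := h1.symm.trans hw0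
      refine ⟨?_, h1⟩
      rcases h2 with h2 | ⟨-, h2 | h2⟩
      · exact (h.cls _ hw _).1 h2
      · have := hs.isBlowUp.mem w'
        rw [labelsAt_left h2] at this
        have := hX this
        rw [h1] at this
        exact absurd this (by decide)
      · exact (hfq _).2 h2
    · rintro ⟨h1, h2⟩
      exact ⟨hw0.trans h2.symm, Or.inl ((h.cls _ hw _).2 h1)⟩
  · intro w hw x
    obtain ⟨hw, hw0⟩ := (hfront w).1 hw
    rw [hs.H_apply, h.H_zero _ hw, ite_self, zero_add, edgeBlock, hw0,
      if_neg fun hc => absurd hc.2 (by decide), zero_mul]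
  · intro x hx hx'
    by_cases hf : 𝔄.IsFront z blk (π x)
    · have h1 := (hℓ x hf).resolve_left fun hc => hx' ((hfront x).2 ⟨hf, hc⟩)
      have h2 := hs.isBlowUp.mem x
      rw [hlabq _ hf, h1, ← h01, ← labelsAt_left (q := l.1.2) (LX := LX) (LY := LY) (o := 1)
        (vert_refl 𝔇 l.1.1)] at h2
      obtain ⟨u, hu, hu'⟩ := (hs.labels _ _).1 h2
      refine ⟨u, by rw [Function.comp_apply, hu]; exact hp, (hs.vert _ _).2 ⟨h1.trans hu'.symm,
        Or.inr ⟨Or.inr ((hfq _).1 hf), Or.inl ?_⟩⟩⟩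
      rw [hu]
    · exact h.linked_of_not_front hs hx hf
  · intro w b hw h1 h2 h3
    obtain ⟨hw, hw0⟩ := (hfront w).1 hw
    by_cases hπ : π b = π w
    · have hb : ℓ b = 1 := (hℓ b (hπ ▸ hw)).resolve_left fun hc =>
        h3 (hs.isBlowUp.inj hπ (hc.trans hw0.symm))
      -- The elementary matrix at the labels (0, 1) over Y, with `F_X = 0`. It is admissible because
      -- `G F_Y` only involves column 0 of G. It frees the entry between the two parts of one border
      -- index.
      have hF : 𝔇.IsUpperEndo (fun a b => a < b) (𝔇.labelsAt l.1.1 l.1.2 LX LY 1) l (edgeBlock k)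
          fun i a b => if 𝔇.vert.r i l.1.2 ∧ a = 0 ∧ b = 1 then 1 else 0 := by
        constructor
        · intro i j hij
          simp only [vert_congr_left hij]
        · intro i a _ b _ hne
          split_ifs at hne with hc
          · rw [hc.2.1, hc.2.2]; decide
          · exact absurd rfl hne
        · intro a _ b _
          rw [Finset.sum_eq_zero, Finset.sum_eq_zero]
          · intro c _
            by_cases hc : c = 0
            · rw [edgeBlock, hc, if_neg fun hc => absurd hc.2 (by decide), zero_mul]
            · rw [if_neg fun hc' => hc hc'.2.1, mul_zero]
          · intro c _
            rw [if_neg fun hc => hpq hc.1, zero_mul]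
      refine ⟨_, hs.diagStar_mem_K1 hF, ?_, fun b' hb' hne => ?_⟩
      · rw [diagStar_apply, if_pos hπ.symm, if_pos ⟨(hfq _).1 hw, hw0, hb⟩]
      · rw [diagStar_apply]
        split_ifs with hc hc'
        · exact absurd (hs.isBlowUp.inj (hc.symm.trans hπ.symm) (hc'.2.2.trans hb.symm)) hne
        · rfl
        · rfl
    · exact h.exists_slice hs hw h1 h2 hπ

end FrontInv

end MatrixBimoduleProblem

/-! ### Restriction to a part of the index set, and bordered problems -/

namespace MatrixBimoduleProblem

variable {k : Type*} [Field k] {𝔅 𝔖 𝔅' 𝔖' : MatrixBimoduleProblem k}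

theorem mem_removeFirst_leads {l : 𝔅.leads} (hl : 𝔅.IsFirstArrow l) (m : Fin 𝔅.t × Fin 𝔅.t) :
    m ∈ (𝔅.removeFirst l hl).leads ↔ m ∈ 𝔅.leads ∧ m ≠ l.1 :=
  Finset.mem_erase.trans and_comm

/-- `𝔅` is obtained from `𝔖` by restriction of all matrices to the image of `e`. -/
structure IsRestriction (𝔅 𝔖 : MatrixBimoduleProblem k) (e : Fin 𝔅.t → Fin 𝔖.t) : Prop where
  strictMono : StrictMono e
  vert : ∀ x y, 𝔖.vert.r (e x) (e y) ↔ 𝔅.vert.r x y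
  H : ∀ x y, 𝔖.H (e x) (e y) = 𝔅.H x y
  leads : ∀ x y, (e x, e y) ∈ 𝔖.leads ↔ (x, y) ∈ 𝔅.leads
  K1_restrict : ∀ V ∈ 𝔖.K1, V.submatrix e e ∈ 𝔅.K1
  K1_lift : ∀ V ∈ 𝔅.K1, ∃ V' ∈ 𝔖.K1, V'.submatrix e e = V
  M1_restrict : ∀ U ∈ 𝔖.M1, U.submatrix e e ∈ 𝔅.M1

namespace IsRestriction

variable {e : Fin 𝔅.t → Fin 𝔖.t}

theorem refl (𝔅 : MatrixBimoduleProblem k) : IsRestriction 𝔅 𝔅 id where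
  strictMono := strictMono_id
  vert _ _ := Iff.rfl
  H _ _ := rfl
  leads _ _ := Iff.rfl
  K1_restrict _ h := h
  K1_lift V h := ⟨V, h, rfl⟩
  M1_restrict _ h := h

/-- The restriction of `𝔖.A lS` lies in ℳ₁ of 𝔅, and its entries at the leads of 𝔅 are those of a
normalized base matrix: 1 at `lB` and 0 elsewhere. -/
theorem A_apply (h : IsRestriction 𝔅 𝔖 e) {lB : 𝔅.leads} {lS : 𝔖.leads}
    (hl : lS.1 = (e lB.1.1, e lB.1.2)) (x y : Fin 𝔅.t) : 𝔖.A lS (e x) (e y) = 𝔅.A lB x y := by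
  classical
  have hM := h.M1_restrict _ (A_mem_M1 lS)
  have := M1_repr_apply hM x y
  rw [Matrix.submatrix_apply] at this
  rw [this, Finset.sum_eq_single lB]
  · have h1 := 𝔖.A_one lS
    rw [hl] at h1
    rw [Matrix.submatrix_apply, h1, one_mul]
  · intro m _ hm
    have hm' := (h.leads m.1.1 m.1.2).2 m.2
    have := 𝔖.A_zero ⟨_, hm'⟩ lS fun hc => hm ?_
    · rw [Matrix.submatrix_apply, this, zero_mul]
    · have hc := (congrArg Subtype.val hc).trans hl
      simp only [Prod.mk.injEq, h.strictMono.injective.eq_iff] at hc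
      exact Subtype.ext (Prod.ext hc.1 hc.2)
  · intro hc
    exact absurd (Finset.mem_univ _) hc

theorem M1Off_restrict (h : IsRestriction 𝔅 𝔖 e) {lB : 𝔅.leads} {lS : 𝔖.leads}
    (hl : lS.1 = (e lB.1.1, e lB.1.2)) {U : Matrix (Fin 𝔖.t) (Fin 𝔖.t) k} (hU : U ∈ 𝔖.M1Off lS) :
    U.submatrix e e ∈ 𝔅.M1Off lB := by
  refine ⟨h.M1_restrict U hU.1, ?_⟩
  have := hU.2
  rwa [hl] at this

/-- The image of e is a union of vertices and `H` relates only equivalent indices, so the sums in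
the matrix products do not leave the image. -/
theorem d_apply (h : IsRestriction 𝔅 𝔖 e) (hcl : ∀ x u, 𝔖.vert.r (e x) u → u ∈ Set.range e)
    (V : Matrix (Fin 𝔖.t) (Fin 𝔖.t) k) (x y : Fin 𝔅.t) :
    (V * 𝔖.H - 𝔖.H * V) (e x) (e y) =
      (V.submatrix e e * 𝔅.H - 𝔅.H * V.submatrix e e) x y := by
  have key : ∀ g : Fin 𝔖.t → k, (∀ u, g u ≠ 0 → u ∈ Set.range e) → ∑ u, g u = ∑ v, g (e v) := by
    intro g hg
    rw [← Finset.sum_image (f := g) (s := Finset.univ) (g := e) h.strictMono.injective.injOn]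
    refine (Finset.sum_subset (Finset.subset_univ _) fun u _ hu => ?_).symm
    by_contra hc
    obtain ⟨v, rfl⟩ := hg u hc
    exact hu (Finset.mem_image_of_mem _ (Finset.mem_univ v))
  simp only [Matrix.sub_apply, Matrix.mul_apply]
  rw [key, key]
  · simp only [h.H, Matrix.submatrix_apply]
  · intro u hu
    exact hcl x u (𝔖.H_vert _ _ (left_ne_zero_of_mul hu))
  · intro u hu
    exact hcl y u (vert_symm (𝔖.H_vert _ _ (right_ne_zero_of_mul hu)))

theorem mem_kerDelta (h : IsRestriction 𝔅 𝔖 e)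
    (hcl : ∀ x u, 𝔖.vert.r (e x) u → u ∈ Set.range e) {lB : 𝔅.leads} {lS : 𝔖.leads}
    (hl : lS.1 = (e lB.1.1, e lB.1.2)) {V : Matrix (Fin 𝔖.t) (Fin 𝔖.t) k} (hV : V ∈ 𝔖.K1) :
    V ∈ 𝔖.kerDelta lS ↔ V.submatrix e e ∈ 𝔅.kerDelta lB := by
  have := h.d_apply hcl V lB.1.1 lB.1.2
  rw [MatrixBimoduleProblem.mem_kerDelta, MatrixBimoduleProblem.mem_kerDelta, hl, this]
  exact ⟨fun hh => ⟨h.K1_restrict V hV, hh.2⟩, fun hh => ⟨hV, hh.2⟩⟩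

theorem deltaFirst_eq_zero (h : IsRestriction 𝔅 𝔖 e)
    (hcl : ∀ x u, 𝔖.vert.r (e x) u → u ∈ Set.range e) {lB : 𝔅.leads} {lS : 𝔖.leads}
    (hl : lS.1 = (e lB.1.1, e lB.1.2)) : 𝔖.deltaFirst lS = 0 ↔ 𝔅.deltaFirst lB = 0 := by
  rw [deltaFirst_eq_zero_iff, deltaFirst_eq_zero_iff]
  constructor
  · intro h0 V hV
    obtain ⟨V', hV', rfl⟩ := h.K1_lift V hV
    exact ((h.mem_kerDelta hcl hl hV').1 ⟨hV', h0 V' hV'⟩).2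
  · intro h0 V hV
    exact ((h.mem_kerDelta hcl hl hV).2 ⟨h.K1_restrict V hV, h0 _ (h.K1_restrict V hV)⟩).2

theorem regularization (h : IsRestriction 𝔅 𝔖 e)
    (hcl : ∀ x u, 𝔖.vert.r (e x) u → u ∈ Set.range e) {lB : 𝔅.leads} {lS : 𝔖.leads}
    (hl : lS.1 = (e lB.1.1, e lB.1.2)) (hS : 𝔖.IsFirstArrow lS) {π : Fin 𝔅'.t → Fin 𝔅.t}
    (hB : IsRegularization 𝔅 𝔅' π lB) :
    IsRestriction 𝔅' (𝔖.removeFirst lS hS) (fun x => e (π x)) where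
  strictMono := h.strictMono.comp hB.strictMono
  vert x y := (h.vert _ _).trans (hB.vert x y).symm
  H x y := (h.H _ _).trans (by rw [hB.H]; rfl)
  leads x y := by
    refine (mem_removeFirst_leads hS (e (π x), e (π y))).trans ?_
    rw [h.leads, hB.mem_leads, hl]
    simp only [ne_eq, h.strictMono.injective.eq_iff, Prod.ext_iff]
  K1_restrict V hV := by
    rw [hB.isShrink.K1]
    exact ⟨_, (h.mem_kerDelta hcl hl hV.1).1 hV, rfl⟩
  K1_lift V hV := by
    obtain ⟨W, hW, rfl⟩ := (hB.isShrink.K1 _).1 hV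
    obtain ⟨W', hW', rfl⟩ := h.K1_lift W hW.1
    exact ⟨W', (h.mem_kerDelta hcl hl hW').2 hW, rfl⟩
  M1_restrict U hU := by
    have hU' : U ∈ 𝔖.M1Off lS := by rwa [removeFirst_M1] at hU
    have := h.M1Off_restrict hl hU'
    exact (hB.M1 _).2 ⟨_, this.1, this.2, rfl⟩

variable {Λ κ : Type*} {lt : Λ → Λ → Prop} {kind : Λ → κ} {G : Λ → Λ → k}
  {labB : Fin 𝔅.t → Finset Λ} {labS : Fin 𝔖.t → Finset Λ} {lB : 𝔅.leads} {lS : 𝔖.leads}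
  {πB : Fin 𝔅'.t → Fin 𝔅.t} {πS : Fin 𝔖'.t → Fin 𝔖.t} {ℓB : Fin 𝔅'.t → Λ} {ℓS : Fin 𝔖'.t → Λ}

/-- The label sets of the two splittings may differ; what is needed is only that endomorphisms
restrict and lift. In the branching step this is applied with e the identity and different labels
for Y. -/
theorem splitting (h : IsRestriction 𝔅 𝔖 e) (hl : lS.1 = (e lB.1.1, e lB.1.2))
    (hB : IsSplitting 𝔅 𝔅' πB lB lt labB kind G ℓB) (hS : IsSplitting 𝔖 𝔖' πS lS lt labS kind G ℓS)
    (hres : ∀ F, 𝔖.IsUpperEndo lt labS lS G F → 𝔅.IsUpperEndo lt labB lB G fun i => F (e i))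
    (hlift : ∀ F, 𝔅.IsUpperEndo lt labB lB G F → ∃ F', 𝔖.IsUpperEndo lt labS lS G F' ∧
      ∀ i, ∀ a ∈ labB i, ∀ b ∈ labB i, F' (e i) a b = F i a b)
    {e' : Fin 𝔅'.t → Fin 𝔖'.t} (hπ : ∀ x, πS (e' x) = e (πB x)) (hℓ : ∀ x, ℓS (e' x) = ℓB x) :
    IsRestriction 𝔅' 𝔖' e' where
  strictMono x y hxy := by
    rw [hS.order, hπ, hπ, hℓ, hℓ, h.strictMono.lt_iff_lt, h.strictMono.injective.eq_iff]
    exact (hB.order x y).1 hxy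
  vert x y := by
    rw [hS.vert, hB.vert, hℓ, hℓ, hπ, hπ, hl]
    simp only [h.vert]
  H x y := by
    classical
    rw [hS.H_apply, hB.H_apply, hℓ, hℓ, hπ, hπ, h.H, h.A_apply hl]
  leads x y := by
    rw [hS.mem_leads, hB.mem_leads, hπ, hπ, h.leads, hl]
    simp only [ne_eq, h.strictMono.injective.eq_iff, Prod.ext_iff]
  K1_restrict V hV := by
    classical
    obtain ⟨F, f, hF, hf, rfl⟩ := hS.mem_K1.1 hV
    refine hB.mem_K1.2 ⟨_, fun a b => (f a b).submatrix e e, hres F hF,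
      fun a b => h.K1_restrict _ (hf a b), ?_⟩
    ext x y
    simp only [Matrix.submatrix_apply, Matrix.add_apply, diagStar_apply, blow_apply, hπ, hℓ,
      h.strictMono.injective.eq_iff]
  K1_lift V hV := by
    classical
    obtain ⟨F, f, hF, hf, rfl⟩ := hB.mem_K1.1 hV
    obtain ⟨F', hF', hFF⟩ := hlift F hF
    choose g hg hgf using fun a b => h.K1_lift _ (hf a b)
    refine ⟨_, hS.mem_K1.2 ⟨F', g, hF', hg, rfl⟩, ?_⟩
    ext x y
    simp only [Matrix.submatrix_apply, Matrix.add_apply, diagStar_apply, blow_apply, hπ, hℓ,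
      h.strictMono.injective.eq_iff, ← hgf]
    by_cases hxy : πB x = πB y
    · rw [if_pos hxy, if_pos hxy, hFF _ _ (hB.isBlowUp.mem x) _ (hxy ▸ hB.isBlowUp.mem y)]
    · rw [if_neg hxy, if_neg hxy]
  M1_restrict U hU := by
    obtain ⟨f, hf, rfl⟩ := hS.mem_M1.1 hU
    refine hB.mem_M1.2 ⟨fun a b => (f a b).submatrix e e, fun a b => h.M1Off_restrict hl (hf a b),
      ?_⟩
    ext x y
    simp only [Matrix.submatrix_apply, blow_apply, hπ, hℓ]

end IsRestriction

end MatrixBimoduleProblem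

theorem exists_first_of_surjective {m n : ℕ} {f : Fin m → Fin n} (hf : Function.Surjective f)
    (i : Fin n) : ∃ y, f y = i ∧ ∀ y', f y' = i → y ≤ y' := by
  have hne : (Finset.univ.filter fun y => f y = i).Nonempty := by
    obtain ⟨y, hy⟩ := hf i
    exact ⟨y, by simpa using hy⟩
  exact ⟨Finset.min' _ hne, by simpa using Finset.min'_mem _ hne,
    fun y' hy' => Finset.min'_le _ _ (by simpa using hy')⟩

namespace MatrixBimoduleProblem

variable {k : Type*} [Field k]

/-- `𝔖` arises from `𝔅` by adding an index in front of each block in the vertex of `z`; in the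
columns added, there are the leading positions that satisfy `Q`. -/
structure IsBorderMap (𝔄 : MatrixBimoduleProblem k) (z : Fin 𝔄.t) (𝔅 : MatrixBimoduleProblem k)
    (bB : Fin 𝔅.t → Fin 𝔄.t) (𝔖 : MatrixBimoduleProblem k) (bS : Fin 𝔖.t → Fin 𝔄.t)
    (e : Fin 𝔅.t → Fin 𝔖.t) (Q : Fin 𝔅.t × Fin 𝔅.t → Prop) : Prop
    extends IsRestriction 𝔅 𝔖 e where
  blk : ∀ x, bS (e x) = bB x
  range : ∀ w, w ∉ Set.range e ↔ 𝔄.IsFront z bS w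
  leads_front : ∀ w, 𝔄.IsFront z bS w → ∀ y, bB y = bS w → (∀ y', bB y' = bB y → y ≤ y') →
    ∀ x, (e x, w) ∈ 𝔖.leads ↔ (x, y) ∈ 𝔅.leads ∧ Q (x, y)

variable {𝔄 𝔅 𝔖 𝔅' 𝔖' : MatrixBimoduleProblem k} {T₂ : Set (Fin 𝔄.t)} {z : Fin 𝔄.t}
  {bB : Fin 𝔅.t → Fin 𝔄.t} {bS : Fin 𝔖.t → Fin 𝔄.t} {e : Fin 𝔅.t → Fin 𝔖.t}
  {Q : Fin 𝔅.t × Fin 𝔅.t → Prop} {ρB : Fin 𝔅.t → Fin 𝔅.t → Prop}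
  {ρS : Fin 𝔖.t → Fin 𝔖.t → Prop} {lB : 𝔅.leads} {lS : 𝔖.leads}

theorem IsFront.mem (hbip : 𝔄.IsBipartite T₂) (hz : z ∈ T₂) {w : Fin 𝔖.t}
    (hw : 𝔄.IsFront z bS w) : bS w ∈ T₂ :=
  (hbip.vert _ _ hw.1).2 hz

theorem Aligned.lead_row_not_front (h : Aligned 𝔄 T₂ 𝔖 bS ρS) (hbip : 𝔄.IsBipartite T₂)
    (hz : z ∈ T₂) {m : Fin 𝔖.t × Fin 𝔖.t} (hm : m ∈ 𝔖.leads) : ¬ 𝔄.IsFront z bS m.1 :=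
  fun hc => (h.leads_bip hbip hm).1 (hc.mem hbip hz)

namespace IsBorderMap

theorem closed (h : IsBorderMap 𝔄 z 𝔅 bB 𝔖 bS e Q) (hS : FrontInv 𝔄 T₂ z 𝔖 bS) (x : Fin 𝔅.t)
    (u : Fin 𝔖.t) (hu : 𝔖.vert.r (e x) u) : u ∈ Set.range e := by
  by_contra hc
  exact (h.range (e x)).2 ((hS.cls u ((h.range u).1 hc) _).1 (vert_symm hu)) ⟨x, rfl⟩

theorem lead_cases (h : IsBorderMap 𝔄 z 𝔅 bB 𝔖 bS e Q) (hB : Function.Surjective bB)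
    (hS : Aligned 𝔄 T₂ 𝔖 bS ρS) (hbip : 𝔄.IsBipartite T₂) (hz : z ∈ T₂)
    {m : Fin 𝔖.t × Fin 𝔖.t} (hm : m ∈ 𝔖.leads) :
    (∃ x y, m = (e x, e y) ∧ (x, y) ∈ 𝔅.leads) ∨
      ∃ x y w, m = (e x, w) ∧ 𝔄.IsFront z bS w ∧ bB y = bS w ∧ (∀ y', bB y' = bB y → y ≤ y') ∧
        (x, y) ∈ 𝔅.leads ∧ Q (x, y) := by
  obtain ⟨m1, m2⟩ := m
  have h1 : m1 ∈ Set.range e := by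
    by_contra hc
    exact hS.lead_row_not_front hbip hz hm ((h.range m1).1 hc)
  obtain ⟨x, rfl⟩ := h1
  by_cases h2 : m2 ∈ Set.range e
  · obtain ⟨y, rfl⟩ := h2
    exact Or.inl ⟨x, y, rfl, (h.leads x y).1 hm⟩
  · obtain ⟨y, hy, hy'⟩ := exists_first_of_surjective hB (bS m2)
    have h2' := (h.range m2).1 h2
    have hy'' : ∀ y', bB y' = bB y → y ≤ y' := fun y' hh => hy' y' (hh.trans hy)
    exact Or.inr ⟨x, y, m2, rfl, h2', hy, hy'', (h.leads_front m2 h2' y hy hy'' x).1 hm⟩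

/-- Once the arrow directly in front of `a_1` in the border is gone, every remaining border arrow
stands in a higher row, or in the same row and in a later block. -/
theorem isFirstArrow (h : IsBorderMap 𝔄 z 𝔅 bB 𝔖 bS e (· ≠ lB.1)) (hl : 𝔅.IsFirstArrow lB)
    (hB : Aligned 𝔄 T₂ 𝔅 bB ρB) (hS : Aligned 𝔄 T₂ 𝔖 bS ρS) (hbip : 𝔄.IsBipartite T₂)
    (hz : z ∈ T₂) : 𝔖.IsFirstArrow ⟨(e lB.1.1, e lB.1.2), (h.leads _ _).2 lB.2⟩ := by
  intro m
  rcases h.lead_cases hB.exp.surj hS hbip hz m.2 with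
    ⟨x, y, hm, hxy⟩ | ⟨x, y, w, hm, hw, hy, hy', hxy, hQ⟩
  · rw [hm]
    rcases hl ⟨_, hxy⟩ with h1 | ⟨h1, h2⟩
    · exact Or.inl (h.strictMono h1)
    · exact Or.inr ⟨congrArg e h1, h.strictMono.monotone h2⟩
  · rw [hm]
    rcases hl ⟨_, hxy⟩ with h1 | ⟨h1, h2⟩
    · exact Or.inl (h.strictMono h1)
    · refine Or.inr ⟨congrArg e h1, ?_⟩
      have h3 : lB.1.2 ≠ y := fun hc => hQ (Prod.ext h1.symm hc.symm)
      have h4 : lB.1.2 < y := lt_of_le_of_ne h2 h3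
      have h5 : bB lB.1.2 < bB y := lt_of_le_of_ne (hB.exp.mono h2) fun hc =>
        absurd (hy' _ hc) (not_le.2 h4)
      by_contra hc
      have := hS.exp.mono (not_le.1 hc).le
      rw [h.blk, ← hy] at this
      exact absurd h5 (not_lt.2 this)

theorem off_of_not_front (h : IsBorderMap 𝔄 z 𝔅 bB 𝔖 bS e fun _ => True)
    (hq : ¬ 𝔄.IsFront z bB lB.1.2) : IsBorderMap 𝔄 z 𝔅 bB 𝔖 bS e (· ≠ lB.1) where
  toIsRestriction := h.toIsRestriction
  blk := h.blk
  range := h.range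
  leads_front w hw y hy hy' x := by
    rw [h.leads_front w hw y hy hy' x]
    refine and_congr_right fun _ => ⟨fun _ hc => hq ?_, fun _ => trivial⟩
    rw [← hc]
    exact ⟨hy.symm ▸ hw.1, hy'⟩

/-- If `a_1` lies in the first column of a block in Z, the first arrow of the bordered problem is
the one in the same row and in the border column of that block. It can be removed without spoiling
the bordering. -/
theorem exists_removeFirst (h : IsBorderMap 𝔄 z 𝔅 bB 𝔖 bS e fun _ => True)
    (hl : 𝔅.IsFirstArrow lB) (hB : Aligned 𝔄 T₂ 𝔅 bB ρB) (hS : Aligned 𝔄 T₂ 𝔖 bS ρS)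
    (hF : FrontInv 𝔄 T₂ z 𝔖 bS) (hbip : 𝔄.IsBipartite T₂) (hz : z ∈ T₂)
    (hq : 𝔄.IsFront z bB lB.1.2) :
    ∃ (l₀ : 𝔖.leads) (hl₀ : 𝔖.IsFirstArrow l₀), l₀.1.1 ∈ Set.range e ∧ 𝔄.IsFront z bS l₀.1.2 ∧
      IsBorderMap 𝔄 z 𝔅 bB (𝔖.removeFirst l₀ hl₀) bS e (· ≠ lB.1) := by
  classical
  obtain ⟨w, hw, hw'⟩ := exists_first_of_surjective hS.exp.surj (bB lB.1.2)
  have hwf : 𝔄.IsFront z bS w := ⟨hw.symm ▸ hq.1, fun y hy => hw' y (hy.trans hw)⟩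
  have hwr := (h.range w).2 hwf
  have hmem : (e lB.1.1, w) ∈ 𝔖.leads :=
    (h.leads_front w hwf lB.1.2 hw.symm hq.2 lB.1.1).2 ⟨lB.2, trivial⟩
  have hl₀ : 𝔖.IsFirstArrow ⟨_, hmem⟩ := by
    intro m
    rcases h.lead_cases hB.exp.surj hS hbip hz m.2 with
      ⟨x, y, hm, hxy⟩ | ⟨x, y, w', hm, hwf', hy, hy', hxy, -⟩
    · rw [hm]
      rcases hl ⟨_, hxy⟩ with h1 | ⟨h1, h2⟩
      · exact Or.inl (h.strictMono h1)
      · exact Or.inr ⟨congrArg e h1, (hw' _ (h.blk _)).trans (h.strictMono.monotone h2)⟩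
    · rw [hm]
      rcases hl ⟨_, hxy⟩ with h1 | ⟨h1, h2⟩
      · exact Or.inl (h.strictMono h1)
      · refine Or.inr ⟨congrArg e h1, ?_⟩
        have h3 : bB lB.1.2 ≤ bB y := hB.exp.mono h2
        rcases h3.lt_or_eq with h3 | h3
        · by_contra hc
          have := hS.exp.mono (not_le.1 hc).le
          rw [hw, ← hy] at this
          exact absurd h3 (not_lt.2 this)
        · exact hw' w' (hy.symm.trans h3.symm)
  -- A lift may be given zero columns in the border vertex without changing its restriction. Then
  -- its d vanishes at the removed position, since column w of `H` and of the lift are both zero; so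
  -- it lies in the kernel of δ.
  have hlift : ∀ V ∈ 𝔅.K1, ∃ V' ∈ 𝔖.kerDelta ⟨_, hmem⟩, V'.submatrix e e = V := by
    intro V hV
    obtain ⟨W, hW, rfl⟩ := h.K1_lift V hV
    refine ⟨scaleBy (fun _ => 1) (fun u => if 𝔄.IsFront z bS u then 0 else 1) W,
      ⟨K1_scaleBy hW (fun _ _ _ => rfl) fun i j hij => ?_, ?_⟩, ?_⟩
    · by_cases hi : 𝔄.IsFront z bS i
      · rw [if_pos hi, if_pos ((hF.cls i hi j).1 hij)]
      · rw [if_neg hi, if_neg fun hj => hi ((hF.cls j hj i).1 (vert_symm hij))]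
    · rw [Matrix.sub_apply, Matrix.mul_apply, Matrix.mul_apply, Finset.sum_eq_zero,
        Finset.sum_eq_zero, sub_zero]
      · intro u _
        simp [scaleBy, hwf]
      · intro u _
        rw [hF.H_zero w hwf, mul_zero]
    · ext x y
      have : ¬ 𝔄.IsFront z bS (e y) := fun hc => (h.range _).2 hc ⟨y, rfl⟩
      simp [scaleBy, this]
  refine ⟨⟨_, hmem⟩, hl₀, ⟨_, rfl⟩, hwf, ?_⟩
  refine
    { strictMono := h.strictMono
      vert := h.vert
      H := h.H
      leads := fun x y => ?_
      K1_restrict := fun V hV => h.K1_restrict V hV.1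
      K1_lift := hlift
      M1_restrict := fun U hU => ?_
      blk := h.blk
      range := h.range
      leads_front := fun w' hwf' y hy hy' x => ?_ }
  · refine (mem_removeFirst_leads hl₀ (e x, e y)).trans ((and_iff_left ?_).trans (h.leads x y))
    exact fun hc => hwr ⟨y, congrArg Prod.snd hc⟩
  · have : U ∈ 𝔖.M1Off ⟨_, hmem⟩ := by rwa [removeFirst_M1] at hU
    exact h.M1_restrict U this.1
  · refine (mem_removeFirst_leads hl₀ (e x, w')).trans ?_
    rw [h.leads_front w' hwf' y hy hy', and_true]
    refine and_congr_right fun _ => not_congr ?_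
    rw [Prod.ext_iff, Prod.ext_iff]
    refine and_congr h.strictMono.injective.eq_iff ⟨fun hc => ?_, fun hc => ?_⟩
    · have hc : w' = w := hc
      have h1 : bB y = bB lB.1.2 := by rw [hy, hc, hw]
      exact le_antisymm (hy' _ h1.symm) (hq.2 _ h1)
    · have hc : y = lB.1.2 := hc
      have h1 : bS w = bS w' := by rw [← hy, hc, hw]
      exact le_antisymm (hwf'.2 _ h1) (hwf.2 _ h1.symm)

theorem regularization (h : IsBorderMap 𝔄 z 𝔅 bB 𝔖 bS e (· ≠ lB.1)) (hF : FrontInv 𝔄 T₂ z 𝔖 bS)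
    (hl : lS.1 = (e lB.1.1, e lB.1.2)) (hS : 𝔖.IsFirstArrow lS) {π : Fin 𝔅'.t → Fin 𝔅.t}
    (hB : IsRegularization 𝔅 𝔅' π lB) :
    IsBorderMap 𝔄 z 𝔅' (bB ∘ π) (𝔖.removeFirst lS hS) bS (fun x => e (π x)) fun _ => True where
  toIsRestriction := h.toIsRestriction.regularization (h.closed hF) hl hS hB
  blk x := h.blk (π x)
  range w := by
    refine Iff.trans ?_ (h.range w)
    refine not_congr ⟨?_, ?_⟩
    · rintro ⟨x, rfl⟩
      exact ⟨_, rfl⟩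
    · rintro ⟨x, rfl⟩
      obtain ⟨x, rfl⟩ := hB.surjective x
      exact ⟨x, rfl⟩
  leads_front w hw y hy hy' x := by
    have hy'' : ∀ y', bB y' = bB (π y) → π y ≤ y' := by
      intro y' hh
      obtain ⟨y', rfl⟩ := hB.surjective y'
      exact hB.strictMono.monotone (hy' y' hh)
    refine (mem_removeFirst_leads hS (e (π x), w)).trans ?_
    rw [and_true, hB.mem_leads]
    refine (and_iff_left ?_).trans (h.leads_front w hw (π y) hy hy'' (π x))
    rw [hl]
    exact fun hc => (h.range w).2 hw ⟨_, (congrArg Prod.snd hc).symm⟩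

end IsBorderMap

end MatrixBimoduleProblem

/-! ### Splittings of bordered problems and the branching step -/

namespace MatrixBimoduleProblem

variable {k : Type*} [Field k]

theorem exists_isSplitting {𝔄 : MatrixBimoduleProblem k} {l : 𝔄.leads} {Λ κ : Type*}
    {lt : Λ → Λ → Prop} {kind : Λ → κ} {G : Λ → Λ → k} {lab : Fin 𝔄.t → Finset Λ}
    (hl : 𝔄.IsFirstArrow l) (hδ : 𝔄.deltaFirst l = 0) (hlt : IsStrictTotalOrder Λ lt)
    (hlab : ∀ i j, 𝔄.vert.r i j → lab i = lab j) (hne : ∀ i, (lab i).Nonempty)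
    (hG : ∀ a b, G a b ≠ 0 → kind a = kind b) :
    ∃ (𝔅 : MatrixBimoduleProblem k) (π : Fin 𝔅.t → Fin 𝔄.t) (ℓ : Fin 𝔅.t → Λ),
      IsSplitting 𝔄 𝔅 π l lt lab kind G ℓ := by
  obtain ⟨t', π, ℓ, h⟩ := exists_isBlowUp lt hlt lab
  have hi : 𝔄.Inducible π l lt lab kind G ℓ := ⟨h, hl, hδ, hlab, hG⟩
  exact ⟨induce hi, π, ℓ, isInduced_induce hi, hlt, hlab, hne, hG⟩

variable {𝔄 𝔅 𝔖 𝔅' 𝔖' : MatrixBimoduleProblem k} {T₂ : Set (Fin 𝔄.t)} {z : Fin 𝔄.t}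
  {bB : Fin 𝔅.t → Fin 𝔄.t} {bS : Fin 𝔖.t → Fin 𝔄.t} {e : Fin 𝔅.t → Fin 𝔖.t}
  {lB : 𝔅.leads} {lS : 𝔖.leads}
  {Λ κ : Type*} {lt : Λ → Λ → Prop} {kind : Λ → κ} {G : Λ → Λ → k} {LX LY : Finset Λ} {o : Λ}
  {πB : Fin 𝔅'.t → Fin 𝔅.t} {ℓB : Fin 𝔅'.t → Λ} {πS : Fin 𝔖'.t → Fin 𝔖.t} {ℓS : Fin 𝔖'.t → Λ}

theorem IsRestriction.labelsAt_eq (h : IsRestriction 𝔅 𝔖 e) (p q i : Fin 𝔅.t) :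
    𝔖.labelsAt (e p) (e q) LX LY o (e i) = 𝔅.labelsAt p q LX LY o i := by
  unfold labelsAt
  by_cases h1 : 𝔅.vert.r i p
  · rw [if_pos h1, if_pos ((h.vert _ _).2 h1)]
  · rw [if_neg h1, if_neg fun hc => h1 ((h.vert _ _).1 hc)]
    by_cases h2 : 𝔅.vert.r i q
    · rw [if_pos h2, if_pos ((h.vert _ _).2 h2)]
    · rw [if_neg h2, if_neg fun hc => h2 ((h.vert _ _).1 hc)]

theorem IsRestriction.isUpperEndo_comp (h : IsRestriction 𝔅 𝔖 e)
    (hl : lS.1 = (e lB.1.1, e lB.1.2)) {F : Fin 𝔖.t → Λ → Λ → k}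
    (hF : 𝔖.IsUpperEndo lt (𝔖.labelsAt lS.1.1 lS.1.2 LX LY o) lS G F) :
    𝔅.IsUpperEndo lt (𝔅.labelsAt lB.1.1 lB.1.2 LX LY o) lB G fun i => F (e i) := by
  have hlab : ∀ i, 𝔖.labelsAt lS.1.1 lS.1.2 LX LY o (e i) =
      𝔅.labelsAt lB.1.1 lB.1.2 LX LY o i := by
    intro i
    rw [hl]
    exact h.labelsAt_eq _ _ i
  constructor
  · exact fun i j hij => hF.vert _ _ ((h.vert _ _).2 hij)
  · intro i
    rw [← hlab]
    exact hF.upper (e i)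
  · have := hF.comm
    simpa only [← hlab, hl] using this

-- Extension by zero: the complement of the image of e is a union of vertices and contains neither
-- end of the arrow, so no condition relates the two parts.
open Classical in
theorem IsRestriction.exists_isUpperEndo (h : IsRestriction 𝔅 𝔖 e)
    (hcl : ∀ x u, 𝔖.vert.r (e x) u → u ∈ Set.range e)
    (hl : lS.1 = (e lB.1.1, e lB.1.2)) {F : Fin 𝔅.t → Λ → Λ → k}
    (hF : 𝔅.IsUpperEndo lt (𝔅.labelsAt lB.1.1 lB.1.2 LX LY o) lB G F) :
    ∃ F', 𝔖.IsUpperEndo lt (𝔖.labelsAt lS.1.1 lS.1.2 LX LY o) lS G F' ∧ ∀ i, F' (e i) = F i := by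
  have hlab : ∀ i, 𝔖.labelsAt lS.1.1 lS.1.2 LX LY o (e i) =
      𝔅.labelsAt lB.1.1 lB.1.2 LX LY o i := by
    intro i
    rw [hl]
    exact h.labelsAt_eq _ _ i
  let F' : Fin 𝔖.t → Λ → Λ → k := Function.extend e F fun _ _ _ => 0
  have h1 : ∀ i, F' (e i) = F i := h.strictMono.injective.extend_apply F _
  have h2 : ∀ j, j ∉ Set.range e → F' j = fun _ _ => 0 := fun j hj =>
    Function.extend_apply' F _ j fun hc => hj hc
  refine ⟨F', ⟨fun i j hij => ?_, fun i => ?_, ?_⟩, h1⟩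
  · by_cases hi : i ∈ Set.range e
    · obtain ⟨i, rfl⟩ := hi
      obtain ⟨j, rfl⟩ := hcl i j hij
      rw [h1, h1, hF.vert _ _ ((h.vert _ _).1 hij)]
    · have hj : j ∉ Set.range e := by
        rintro ⟨j, rfl⟩
        exact hi (hcl j i (vert_symm hij))
      rw [h2 i hi, h2 j hj]
  · by_cases hi : i ∈ Set.range e
    · obtain ⟨i, rfl⟩ := hi
      rw [h1, hlab]
      exact hF.upper i
    · intro a _ b _ hne
      rw [h2 i hi] at hne
      exact absurd rfl hne
  · have := hF.comm
    simpa only [← hlab, ← h1, hl] using this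

theorem exists_lift_of_labels (hB : IsBlowUp lt (𝔅.labelsAt lB.1.1 lB.1.2 LX LY o) πB ℓB)
    {labS : Fin 𝔖.t → Finset Λ} (hS : IsBlowUp lt labS πS ℓS)
    (hsub : ∀ i, 𝔅.labelsAt lB.1.1 lB.1.2 LX LY o i ⊆ labS (e i)) :
    ∃ e' : Fin 𝔅'.t → Fin 𝔖'.t, ∀ x, πS (e' x) = e (πB x) ∧ ℓS (e' x) = ℓB x := by
  have : ∀ x, ∃ w, πS w = e (πB x) ∧ ℓS w = ℓB x := fun x =>
    (hS.labels _ _).1 (hsub _ (hB.mem x))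
  choose e' he' using this
  exact ⟨e', he'⟩

/-- The same labels are used on both sides. The border vertex is neither end of the arrow, hence is
not split and remains the complement of the image. -/
theorem IsBorderMap.splitting (h : IsBorderMap 𝔄 z 𝔅 bB 𝔖 bS e (· ≠ lB.1))
    (hF : FrontInv 𝔄 T₂ z 𝔖 bS) (hl : lS.1 = (e lB.1.1, e lB.1.2))
    (hB : IsSplitting 𝔅 𝔅' πB lB lt (𝔅.labelsAt lB.1.1 lB.1.2 LX LY o) kind G ℓB)
    (hS : IsSplitting 𝔖 𝔖' πS lS lt (𝔖.labelsAt lS.1.1 lS.1.2 LX LY o) kind G ℓS) :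
    FrontInv 𝔄 T₂ z 𝔖' (bS ∘ πS) ∧
      ∃ e', IsBorderMap 𝔄 z 𝔅' (bB ∘ πB) 𝔖' (bS ∘ πS) e' fun _ => True := by
  have hlab : ∀ i, 𝔖.labelsAt lS.1.1 lS.1.2 LX LY o (e i) =
      𝔅.labelsAt lB.1.1 lB.1.2 LX LY o i := by
    intro i
    rw [hl]
    exact h.labelsAt_eq _ _ i
  have hnf : ∀ i, ¬ 𝔄.IsFront z bS (e i) := fun i hc => (h.range _).2 hc ⟨i, rfl⟩
  have hp : ¬ 𝔄.IsFront z bS lS.1.1 := by rw [hl]; exact hnf _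
  have hq : ¬ 𝔄.IsFront z bS lS.1.2 := by rw [hl]; exact hnf _
  have ho : ∀ i, ¬ 𝔖.vert.r i lS.1.1 → ¬ 𝔖.vert.r i lS.1.2 →
      𝔖.labelsAt lS.1.1 lS.1.2 LX LY o i = {o} := fun i h1 h2 => labelsAt_other h1 h2
  refine ⟨hF.splitting_of_not_front hS hp hq ho, ?_⟩
  obtain ⟨e', he'⟩ := exists_lift_of_labels (e := e) hB.isBlowUp hS.isBlowUp fun i => (hlab i).ge
  have hfront := fun w => hF.isFront_comp_iff hS hp hq ho (w := w)
  have hrange : ∀ w, w ∈ Set.range e' ↔ πS w ∈ Set.range e := by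
    intro w
    constructor
    · rintro ⟨x, rfl⟩
      exact ⟨_, (he' x).1.symm⟩
    · rintro ⟨i, hi⟩
      have := hS.isBlowUp.mem w
      rw [← hi, hlab] at this
      obtain ⟨x, rfl, hx⟩ := (hB.labels _ _).1 this
      exact ⟨x, hS.isBlowUp.inj ((he' x).1.trans hi) ((he' x).2.trans hx)⟩
  refine ⟨e', h.toIsRestriction.splitting hl hB hS (fun F hF => h.isUpperEndo_comp hl hF)
    (fun F hF' => ?_) (fun x => (he' x).1) fun x => (he' x).2, fun x => ?_, fun w => ?_, ?_⟩
  · obtain ⟨F', h1, h2⟩ := h.exists_isUpperEndo (h.closed hF) hl hF'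
    exact ⟨F', h1, fun i a _ b _ => by rw [h2]⟩
  · rw [Function.comp_apply, (he' x).1, h.blk]
    rfl
  · rw [hrange, h.range, hfront]
  · intro w hw y hy hy' x
    have hw' := (hfront w).1 hw
    have hy'' : ∀ y', bB y' = bB (πB y) → πB y ≤ y' := by
      intro y' hh
      obtain ⟨y', rfl⟩ := hB.isExpansion.surj y'
      exact hB.isBlowUp.mono (hy' y' hh)
    rw [and_true, hS.mem_leads, hB.mem_leads, (he' x).1, ← h.leads_front _ hw' (πB y) hy hy'' (πB x)]
    refine and_iff_left ?_
    rw [hl]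
    exact fun hc => (h.range _).2 hw' ⟨_, (congrArg Prod.snd hc).symm⟩

/-- The branching step. The two problems come from the same 𝔅 by G and by (0 G). The additional
label 0 of Y gives precisely one new index in front of each block in Z. -/
theorem FrontInv.isBorderMap_edge {LX : Finset (Fin 3)} {ℓB : Fin 𝔅'.t → Fin 3}
    {ℓS : Fin 𝔖'.t → Fin 3} {πS : Fin 𝔖'.t → Fin 𝔅.t} (hF : FrontInv 𝔄 T₂ z 𝔅 bB)
    (hB : IsSplitting 𝔅 𝔅' πB lB (fun a b => a < b) (𝔅.labelsAt lB.1.1 lB.1.2 LX {1} 1) id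
      (edgeBlock k) ℓB)
    (hS : IsSplitting 𝔅 𝔖' πS lB (fun a b => a < b) (𝔅.labelsAt lB.1.1 lB.1.2 LX {0, 1} 1) id
      (edgeBlock k) ℓS)
    (hpq : ¬ 𝔅.vert.r lB.1.1 lB.1.2) (hq : 𝔄.IsFront z bB lB.1.2) :
    ∃ e', IsBorderMap 𝔄 z 𝔅' (bB ∘ πB) 𝔖' (bB ∘ πS) e' fun _ => True := by
  have hG0 : ∀ a, edgeBlock k a 0 = 0 := fun a => if_neg fun hc => absurd hc.2 (by decide)
  have hlabX : ∀ LY : Finset (Fin 3), 𝔅.labelsAt lB.1.1 lB.1.2 LX LY 1 lB.1.1 = LX := fun LY =>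
    labelsAt_left (vert_refl _ _)
  have hlabY : ∀ LY : Finset (Fin 3), 𝔅.labelsAt lB.1.1 lB.1.2 LX LY 1 lB.1.2 = LY := fun LY =>
    labelsAt_right hpq (vert_refl _ _)
  have hlabn : ∀ i, ¬ 𝔄.IsFront z bB i → 𝔅.labelsAt lB.1.1 lB.1.2 LX {0, 1} 1 i =
      𝔅.labelsAt lB.1.1 lB.1.2 LX {1} 1 i := by
    intro i hi
    have h2 : ¬ 𝔅.vert.r i lB.1.2 := fun hc => hi ((hF.cls _ hq _).1 (vert_symm hc))
    by_cases h1 : 𝔅.vert.r i lB.1.1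
    · rw [labelsAt_left h1, labelsAt_left h1]
    · rw [labelsAt_other h1 h2, labelsAt_other h1 h2]
  have hlabf : ∀ i, 𝔄.IsFront z bB i → ∀ LY : Finset (Fin 3),
      𝔅.labelsAt lB.1.1 lB.1.2 LX LY 1 i = LY := fun i hi LY =>
    labelsAt_right hpq (vert_symm ((hF.cls _ hq _).2 hi))
  have hsub : ∀ i, 𝔅.labelsAt lB.1.1 lB.1.2 LX {1} 1 i ⊆ 𝔅.labelsAt lB.1.1 lB.1.2 LX {0, 1} 1 i := by
    intro i
    by_cases hi : 𝔄.IsFront z bB i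
    · rw [hlabf i hi, hlabf i hi]; decide
    · rw [hlabn i hi]
  have hfront := fun w => hF.isFront_edge_iff hS hpq subset_rfl (by decide) hq (w := w)
  obtain ⟨e', he'⟩ := exists_lift_of_labels (e := id) hB.isBlowUp hS.isBlowUp hsub
  have hrange : ∀ w, w ∈ Set.range e' ↔
      ℓS w ∈ 𝔅.labelsAt lB.1.1 lB.1.2 LX {1} 1 (πS w) := by
    intro w
    constructor
    · rintro ⟨x, rfl⟩
      rw [(he' x).1, (he' x).2]
      exact hB.isBlowUp.mem x
    · intro hw
      obtain ⟨x, h1, h2⟩ := (hB.labels _ _).1 hw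
      exact ⟨x, hS.isBlowUp.inj ((he' x).1.trans h1) ((he' x).2.trans h2)⟩
  refine ⟨e', (IsRestriction.refl 𝔅).splitting rfl hB hS (fun F hF => ?_)
    (fun F hF' => ?_) (fun x => (he' x).1) fun x => (he' x).2, fun x => ?_, fun w => ?_, ?_⟩
  -- Restriction of F to the labels without 0 keeps the commutation relation, because column 0 of G
  -- is zero.
  · refine ⟨hF.vert, fun i a ha b hb => hF.upper i a (hsub i ha) b (hsub i hb), ?_⟩
    have := hF.comm
    rw [hlabX, hlabY] at this ⊢
    intro a ha b hb
    rw [id, this a ha b (Finset.mem_insert_of_mem hb), Finset.sum_insert (by decide), hG0, zero_mul,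
      zero_add]
    rfl
  · classical
    -- F is lifted by zeros in the row and the column of the additional label.
    refine ⟨fun i a b => if a ∈ 𝔅.labelsAt lB.1.1 lB.1.2 LX {1} 1 i ∧
      b ∈ 𝔅.labelsAt lB.1.1 lB.1.2 LX {1} 1 i then F i a b else 0, ⟨fun i j hij => ?_,
        fun i a _ b _ hne => ?_, ?_⟩, fun i a ha b hb => if_pos ⟨ha, hb⟩⟩
    · rw [labelsAt_vert hij, hF'.vert _ _ hij]
    · split_ifs at hne with hc
      · exact hF'.upper i a hc.1 b hc.2 hne
      · exact absurd rfl hne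
    · have := hF'.comm
      rw [hlabX, hlabY] at this
      simp only [hlabX, hlabY]
      intro a ha b hb
      have hl : ∑ c ∈ LX, (if a ∈ LX ∧ c ∈ LX then F lB.1.1 a c else 0) * edgeBlock k c b =
          ∑ c ∈ LX, F lB.1.1 a c * edgeBlock k c b :=
        Finset.sum_congr rfl fun c hc => by rw [if_pos ⟨ha, hc⟩]
      rw [hl, Finset.sum_insert (by decide), hG0, zero_mul, zero_add, Finset.sum_singleton]
      rcases Finset.mem_insert.1 hb with rfl | hb
      · rw [if_neg fun hc => absurd hc.2 (by decide), mul_zero]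
        exact Finset.sum_eq_zero fun c _ => by rw [hG0, mul_zero]
      · rw [this a ha b hb, Finset.sum_singleton, if_pos ⟨Finset.mem_singleton_self 1, hb⟩]
  · rw [Function.comp_apply, (he' x).1]
    rfl
  · rw [hrange, hfront]
    have hm := hS.isBlowUp.mem w
    by_cases hi : 𝔄.IsFront z bB (πS w)
    · rw [hlabf _ hi] at hm ⊢
      simp only [hi, true_and]
      revert hm
      generalize ℓS w = a
      revert a
      decide
    · rw [hlabn _ hi] at hm
      simp [hi, hm]
  · intro w hw y hy hy' x
    have hw' := ((hfront w).1 hw).1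
    have h1 : πB y = πS w := by
      refine le_antisymm ?_ (hw'.2 _ hy)
      obtain ⟨y', h2⟩ := hB.isExpansion.surj (πS w)
      rw [← h2]
      refine hB.isBlowUp.mono (hy' y' ?_)
      rw [hy, Function.comp_apply, h2]
      rfl
    rw [and_true, hS.mem_leads, hB.mem_leads, (he' x).1, h1]
    rfl

end MatrixBimoduleProblem

/-! ### One step of the parallel sequence -/

namespace MatrixBimoduleProblem

variable {k : Type*} [Field k]
  {𝔄 𝔅 𝔖 𝔅' : MatrixBimoduleProblem k} {T₂ : Set (Fin 𝔄.t)} {z : Fin 𝔄.t}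
  {bB : Fin 𝔅.t → Fin 𝔄.t} {bS : Fin 𝔖.t → Fin 𝔄.t} {e : Fin 𝔅.t → Fin 𝔖.t}
  {ρB : Fin 𝔅.t → Fin 𝔅.t → Prop} {ρS : Fin 𝔖.t → Fin 𝔖.t → Prop} {lB : 𝔅.leads}
  {πB : Fin 𝔅'.t → Fin 𝔅.t}

theorem exists_edge_isSplitting {l : 𝔅.leads} (hl : 𝔅.IsFirstArrow l) (hδ : 𝔅.deltaFirst l = 0)
    {LX LY : Finset (Fin 3)} (hX : LX.Nonempty) (hY : LY.Nonempty) :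
    ∃ (𝔅' : MatrixBimoduleProblem k) (π : Fin 𝔅'.t → Fin 𝔅.t) (ℓ : Fin 𝔅'.t → Fin 3),
      IsSplitting 𝔅 𝔅' π l (fun a b => a < b) (𝔅.labelsAt l.1.1 l.1.2 LX LY 1) id
        (edgeBlock k) ℓ :=
  exists_isSplitting hl hδ (inferInstanceAs (IsStrictTotalOrder (Fin 3) (· < ·)))
    (fun _ _ hij => labelsAt_vert hij) (labelsAt_nonempty _ hX hY) fun _ _ => edgeBlock_kind

variable [LinearOrder k]

theorem exists_loop_isSplitting {l : 𝔅.leads} (hl : 𝔅.IsFirstArrow l) (hδ : 𝔅.deltaFirst l = 0)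
    {L : Finset (WeyrLabel k)} (hL : L.Nonempty) :
    ∃ (𝔅' : MatrixBimoduleProblem k) (π : Fin 𝔅'.t → Fin 𝔅.t) (ℓ : Fin 𝔅'.t → WeyrLabel k),
      IsSplitting 𝔅 𝔅' π l WeyrLabel.lt (𝔅.labelsAt l.1.1 l.1.2 L L ⟨0, 1, 1⟩)
        (fun a => (a.ev, a.size)) (weyrBlock k) ℓ :=
  exists_isSplitting hl hδ WeyrLabel.isStrictTotalOrder (fun _ _ hij => labelsAt_vert hij)
    (labelsAt_nonempty _ hL hL) fun _ _ => weyrBlock_kind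

/-- The first arrows correspond, δ vanishes on both sides or on neither, and they are loops
simultaneously. So a reduction of the same kind with the same labels is available for the bordered
problem. -/
theorem IsBorderMap.exists_reduction_of_off (h : IsBorderMap 𝔄 z 𝔅 bB 𝔖 bS e (· ≠ lB.1))
    (hB : Aligned 𝔄 T₂ 𝔅 bB ρB) (hS : Aligned 𝔄 T₂ 𝔖 bS ρS) (hF : FrontInv 𝔄 T₂ z 𝔖 bS)
    (hbip : 𝔄.IsBipartite T₂) (hz : z ∈ T₂)
    (hr : IsRegularization 𝔅 𝔅' πB lB ∨ IsLoopReduction 𝔅 𝔅' πB lB ∨ IsEdgeReduction 𝔅 𝔅' πB lB) :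
    ∃ (𝔖' : MatrixBimoduleProblem k) (πS : Fin 𝔖'.t → Fin 𝔖.t), IsReduction 𝔖 𝔖' πS ∧
      FrontInv 𝔄 T₂ z 𝔖' (bS ∘ πS) ∧
        ∃ e', IsBorderMap 𝔄 z 𝔅' (bB ∘ πB) 𝔖' (bS ∘ πS) e' fun _ => True := by
  have hfB : 𝔅.IsFirstArrow lB := by
    obtain hr | ⟨-, S, hS, h1, L, hL, ℓ, hr⟩ | ⟨-, LX, LY, -, -, hX, hY, -, ℓ, hr⟩ := hr
    exacts [hr.first, hr.first, hr.first]
  obtain ⟨lS, hl⟩ : ∃ lS : 𝔖.leads, lS = ⟨(e lB.1.1, e lB.1.2), (h.leads _ _).2 lB.2⟩ := ⟨_, rfl⟩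
  have hfS : 𝔖.IsFirstArrow lS := hl ▸ h.isFirstArrow hfB hB hS hbip hz
  replace hl : lS.1 = (e lB.1.1, e lB.1.2) := congrArg Subtype.val hl
  have hcl := h.closed hF
  have hδ := h.deltaFirst_eq_zero hcl hl
  have hv : 𝔖.vert.r lS.1.1 lS.1.2 ↔ 𝔅.vert.r lB.1.1 lB.1.2 := by
    rw [hl]; exact h.vert _ _
  obtain hr | ⟨hpq, S, hS', h1, L, hL, ℓ, hr⟩ | ⟨hpq, LX, LY, hX', hY', hX, hY, h01, ℓ, hr⟩ := hr
  · refine ⟨𝔖.removeFirst lS hfS, id,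
      ⟨lS, Or.inl (removeFirst_isRegularization hfS fun hc => hr.delta (hδ.1 hc))⟩,
      hF.shrink (removeFirst_isShrink hfS) (hS.lead_row_not_front hbip hz lS.2), _,
      h.regularization hF hl hfS hr⟩
  · have hne := weyr_labels_nonempty hS' h1 hL
    obtain ⟨𝔖', πS, ℓS, hs⟩ := exists_loop_isSplitting hfS (hδ.2 hr.delta) hne
    exact ⟨𝔖', πS, ⟨lS, Or.inr (Or.inl ⟨hv.2 hpq, S, hS', h1, L, hL, ℓS, hs.toIsInduced⟩)⟩,
      h.splitting hF hl (hr.loop_isSplitting hne) hs⟩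
  · obtain ⟨𝔖', πS, ℓS, hs⟩ := exists_edge_isSplitting hfS (hδ.2 hr.delta) hX hY
    exact ⟨𝔖', πS, ⟨lS, Or.inr (Or.inr ⟨fun hc => hpq (hv.1 hc), LX, LY, hX', hY', hX, hY, h01, ℓS,
      hs.toIsInduced⟩)⟩, h.splitting hF hl (hr.edge_isSplitting hX hY) hs⟩

/-- Isolates the one kind of reduction that destroys the border: an edge reduction ending in the
border vertex for which G has no zero column. A loop at that vertex is impossible, since the row of
a lead lies outside `T₂`. -/
theorem FrontInv.reduction_cases (hF : FrontInv 𝔄 T₂ z 𝔅 bB) (hB : Aligned 𝔄 T₂ 𝔅 bB ρB)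
    (hbip : 𝔄.IsBipartite T₂) (hz : z ∈ T₂) (hr : IsReduction 𝔅 𝔅' πB) :
    FrontInv 𝔄 T₂ z 𝔅' (bB ∘ πB) ∨
      ∃ (l : 𝔅.leads) (LX : Finset (Fin 3)) (ℓ : Fin 𝔅'.t → Fin 3), ¬ 𝔅.vert.r l.1.1 l.1.2 ∧
        LX ⊆ {1, 2} ∧ 1 ∈ LX ∧ 𝔄.IsFront z bB l.1.2 ∧
        IsSplitting 𝔅 𝔅' πB l (fun a b => a < b) (𝔅.labelsAt l.1.1 l.1.2 LX {1} 1) id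
          (edgeBlock k) ℓ := by
  obtain ⟨l, hr⟩ := hr
  have hp := hB.lead_row_not_front hbip hz l.2
  obtain hr | ⟨hpq, S, hS', h1, L, hL, ℓ, hr⟩ | ⟨hpq, LX, LY, hX', hY', hX, hY, h01, ℓ, hr⟩ := hr
  · exact Or.inl (hF.shrink hr.isShrink hp)
  · refine Or.inl (hF.splitting_of_not_front (hr.loop_isSplitting (weyr_labels_nonempty hS' h1 hL))
      hp (fun hc => hp ((hF.cls _ hc _).1 (vert_symm hpq))) fun i h1 h2 => labelsAt_other h1 h2)
  · have hs := hr.edge_isSplitting hX hY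
    by_cases hq : 𝔄.IsFront z bB l.1.2
    · by_cases h0 : 0 ∈ LY
      · exact Or.inl (hF.edge_of_front hs hpq hX' hY' h01 h0 (hB.leads_bip hbip l.2).1 hq)
      · have hLY : LY = {1} := by
          revert h0 hY hY'
          clear * -
          revert LY
          decide
        subst hLY
        exact Or.inr ⟨l, LX, ℓ, hpq, hX', h01.2 (by decide), hq, hs⟩
    · exact Or.inl (hF.splitting_of_not_front hs hp hq fun i h1 h2 => labelsAt_other h1 h2)

theorem FrontInv.exists_reduction (hF : FrontInv 𝔄 T₂ z 𝔅 bB) (hB : Aligned 𝔄 T₂ 𝔅 bB ρB)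
    (hbip : 𝔄.IsBipartite T₂) (hz : z ∈ T₂) (hr : IsReduction 𝔅 𝔅' πB) :
    FrontInv 𝔄 T₂ z 𝔅' (bB ∘ πB) ∨
      ∃ (𝔖' : MatrixBimoduleProblem k) (πS : Fin 𝔖'.t → Fin 𝔅.t), IsReduction 𝔅 𝔖' πS ∧
        FrontInv 𝔄 T₂ z 𝔖' (bB ∘ πS) ∧
          ∃ e', IsBorderMap 𝔄 z 𝔅' (bB ∘ πB) 𝔖' (bB ∘ πS) e' fun _ => True := by
  refine (hF.reduction_cases hB hbip hz hr).imp_right ?_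
  rintro ⟨l, LX, ℓ, hpq, hX', h1, hq, hs⟩
  have hX : LX.Nonempty := ⟨1, h1⟩
  obtain ⟨𝔖', πS, ℓS, hs'⟩ := exists_edge_isSplitting hs.first hs.delta (LY := {0, 1}) hX (by decide)
  have h01 : 1 ∈ LX ↔ (1 : Fin 3) ∈ ({0, 1} : Finset (Fin 3)) := by simpa using h1
  exact ⟨𝔖', πS, ⟨l, Or.inr (Or.inr ⟨hpq, LX, {0, 1}, hX', subset_rfl, hX, by decide, h01, ℓS,
    hs'.toIsInduced⟩)⟩, hF.edge_of_front hs' hpq hX' subset_rfl h01 (by decide)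
      (hB.leads_bip hbip l.2).1 hq, hF.isBorderMap_edge hs hs' hpq hq⟩

/-- In the exceptional case the first index of a block in Z receives the label 1 and thereby joins
an index outside `T₂`. For uniqueness this is compared with a bordered problem, where such an
equivalence cannot occur. -/
theorem FrontInv.reduction_or_linked (hF : FrontInv 𝔄 T₂ z 𝔅 bB) (hB : Aligned 𝔄 T₂ 𝔅 bB ρB)
    (hbip : 𝔄.IsBipartite T₂) (hz : z ∈ T₂) (hr : IsReduction 𝔅 𝔅' πB) :
    FrontInv 𝔄 T₂ z 𝔅' (bB ∘ πB) ∨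
      ∃ w u, 𝔄.IsFront z (bB ∘ πB) w ∧ bB (πB u) ∉ T₂ ∧ 𝔅'.vert.r w u := by
  refine (hF.reduction_cases hB hbip hz hr).imp_right ?_
  rintro ⟨l, LX, ℓ, hpq, hX', h1, hq, hs⟩
  have hY := labelsAt_right (LX := LX) (LY := {1}) (o := 1) hpq (vert_refl 𝔅 l.1.2)
  obtain ⟨w, hw, hw1⟩ := (hs.labels l.1.2 1).1 (by rw [hY]; decide)
  obtain ⟨u, hu, hu1⟩ := (hs.labels l.1.1 1).1 (by rw [labelsAt_left (vert_refl 𝔅 l.1.1)]; exact h1)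
  refine ⟨w, u, ⟨by rw [Function.comp_apply, hw]; exact hq.1, fun y hy => ?_⟩,
    by rw [hu]; exact (hB.leads_bip hbip l.2).1,
    (hs.vert _ _).2 ⟨hw1.trans hu1.symm, Or.inr ⟨Or.inr (by rw [hw]), Or.inl (by rw [hu])⟩⟩⟩
  rw [Function.comp_apply, Function.comp_apply, hw] at hy
  rcases (hq.2 (πB y) hy).lt_or_eq with h2 | h2
  · exact ((hs.order _ _).2 (Or.inl (by rw [hw]; exact h2))).le
  · have h3 := hs.isBlowUp.mem y
    rw [← h2, hY, Finset.mem_singleton] at h3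
    exact (hs.isBlowUp.inj (hw.trans h2) (hw1.trans h3.symm)).le

/-- An aligned problem, as a problem over `𝔄`. -/
def Aligned.toOver (hB : Aligned 𝔄 T₂ 𝔅 bB ρB) : Over 𝔄 where
  prob := 𝔅
  blk := bB
  blk_mono := hB.exp.mono
  card_vert _ _ h := hB.exp.card_fiber_eq h

namespace Over

/-- The properties of the terms of a sequence and of the sequence parallel to it. -/
structure ParallelInv (T₂ : Set (Fin 𝔄.t)) (z : Fin 𝔄.t) (𝔅 𝔖 : Over 𝔄) : Prop where
  aligned_left : ∃ ρ, Aligned 𝔄 T₂ 𝔅.prob 𝔅.blk ρ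
  aligned_right : ∃ ρ, Aligned 𝔄 T₂ 𝔖.prob 𝔖.blk ρ
  front : FrontInv 𝔄 T₂ z 𝔖.prob 𝔖.blk
  cases : 𝔖 = 𝔅 ∨ ∃ e, IsBorderMap 𝔄 z 𝔅.prob 𝔅.blk 𝔖.prob 𝔖.blk e fun _ => True

/-- While the two problems are equal, the reduction is copied, unless it is the exceptional one,
where branching takes place. Once they differ, it is repeated on the bordered problem. -/
theorem ParallelInv.exists_step {𝔅 𝔅' 𝔖 : Over 𝔄} (h : ParallelInv T₂ z 𝔅 𝔖)
    (hbip : 𝔄.IsBipartite T₂) (hz : z ∈ T₂) (hr : Red 𝔅 𝔅') :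
    ∃ 𝔖', (Red 𝔖 𝔖' ∨ ∃ 𝔇, Red 𝔖 𝔇 ∧ Red 𝔇 𝔖') ∧ ParallelInv T₂ z 𝔅' 𝔖' := by
  obtain ⟨⟨ρB, hB⟩, ⟨ρS, hS⟩, hF, hc⟩ := h
  obtain ⟨πB, hr, hblk⟩ := hr
  have hB' := hB.reduction hr
  rw [← hblk] at hB'
  rcases hc with rfl | ⟨e, he⟩
  · rcases hF.exists_reduction hB hbip hz hr with h1 | ⟨𝔖', πS, h1, h2, e', h3⟩
    · rw [← hblk] at h1
      exact ⟨𝔅', Or.inl ⟨πB, hr, hblk⟩, hB', hB', h1, Or.inl rfl⟩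
    · obtain ⟨ρ', hS'⟩ := hS.reduction h1
      rw [← hblk] at h3
      exact ⟨hS'.toOver, Or.inl ⟨πS, h1, rfl⟩, hB', ⟨ρ', hS'⟩, h2, Or.inr ⟨e', h3⟩⟩
  · obtain ⟨lB, hr'⟩ := hr
    have hfB : 𝔅.prob.IsFirstArrow lB := by
      obtain hr | ⟨-, S, hS, h1, L, hL, ℓ, hr⟩ | ⟨-, LX, LY, -, -, hX, hY, -, ℓ, hr⟩ := hr'
      exacts [hr.first, hr.first, hr.first]
    by_cases hq : 𝔄.IsFront z 𝔅.blk lB.1.2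
    -- Here the step consists of two reductions: deletion of the arrow in the border column, then
    -- the reduction that corresponds to the given one.
    · obtain ⟨l₀, hl₀, hr0, hf0, h0⟩ := he.exists_removeFirst hfB hB hS hF hbip hz hq
      have hred : IsReduction 𝔖.prob (𝔖.prob.removeFirst l₀ hl₀) id := by
        refine removeFirst_isReduction hl₀ fun hc => ?_
        exact hS.lead_row_not_front hbip hz l₀.2 ((hF.cls _ hf0 _).1 (vert_symm hc))
      obtain ⟨ρ₀, hS₀⟩ := hS.reduction hred
      have hF₀ := hF.shrink (removeFirst_isShrink hl₀) (hS.lead_row_not_front hbip hz l₀.2)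
      obtain ⟨𝔖', πS, h1, h2, e', h3⟩ := h0.exists_reduction_of_off hB hS₀ hF₀ hbip hz hr'
      obtain ⟨ρ', hS'⟩ := hS₀.reduction h1
      rw [← hblk] at h3
      exact ⟨hS'.toOver, Or.inr ⟨hS₀.toOver, ⟨id, hred, rfl⟩, ⟨πS, h1, rfl⟩⟩, hB', ⟨ρ', hS'⟩, h2,
        Or.inr ⟨e', h3⟩⟩
    · obtain ⟨𝔖', πS, h1, h2, e', h3⟩ :=
        (he.off_of_not_front hq).exists_reduction_of_off hB hS hF hbip hz hr'
      obtain ⟨ρ', hS'⟩ := hS.reduction h1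
      rw [← hblk] at h3
      exact ⟨hS'.toOver, Or.inl ⟨πS, h1, rfl⟩, hB', ⟨ρ', hS'⟩, h2, Or.inr ⟨e', h3⟩⟩

theorem exists_parallelInv {s : ℕ} {B : Fin (s + 1) → Over 𝔄} (hbip : 𝔄.IsBipartite T₂)
    (hz : z ∈ T₂) (hB0 : B 0 = base 𝔄) (hB : ∀ i : Fin s, (B i.castSucc).Red (B i.succ)) :
    ∃ 𝔖 : Fin (s + 1) → Over 𝔄, 𝔖 0 = base 𝔄 ∧
      (∀ i : Fin s, Red (𝔖 i.castSucc) (𝔖 i.succ) ∨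
        ∃ 𝔇, Red (𝔖 i.castSucc) 𝔇 ∧ Red 𝔇 (𝔖 i.succ)) ∧
      ∀ i, ParallelInv T₂ z (B i) (𝔖 i) := by
  induction s with
  | zero =>
    refine ⟨fun _ => Over.base 𝔄, rfl, fun i => i.elim0, fun i => ?_⟩
    obtain rfl : i = 0 := Fin.ext (by omega)
    rw [hB0]
    exact ⟨⟨_, Aligned.refl hbip⟩, ⟨_, Aligned.refl hbip⟩, FrontInv.refl z hbip, Or.inl rfl⟩
  | succ s ih =>
    obtain ⟨𝔖, h0, h1, h2⟩ := ih (B := fun i => B i.castSucc) hB0 fun i => hB i.castSucc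
    obtain ⟨𝔖', h3, h4⟩ := (h2 (Fin.last s)).exists_step hbip hz (hB (Fin.last s))
    refine ⟨Fin.snoc (α := fun _ => Over 𝔄) 𝔖 𝔖', ?_, fun i => ?_, fun i => ?_⟩
    · rw [← Fin.castSucc_zero, Fin.snoc_castSucc, h0]
    · refine Fin.lastCases ?_ (fun i => ?_) i
      · rw [Fin.snoc_castSucc, Fin.succ_last, Fin.snoc_last]
        exact h3
      · rw [Fin.snoc_castSucc, Fin.succ_castSucc, Fin.snoc_castSucc]
        exact h1 i
    · refine Fin.lastCases ?_ (fun i => ?_) i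
      · rw [Fin.snoc_last]; exact h4
      · rw [Fin.snoc_castSucc]; exact h2 i

end Over

end MatrixBimoduleProblem

/-! ### Dual bases and the free first row -/

/-- The `v i` are independent because they are dual to the `φ i`, and modulo them the space is
spanned by members of C in the common kernel of all `φ i`. Completing the `v i` by such members
gives a basis whose coordinates at the `v i` are the `φ i`. -/
theorem exists_basis_of_dual {K W ι₀ : Type*} [Field K] [AddCommGroup W] [Module K W]
    [Module.Finite K W] [Fintype ι₀] [DecidableEq ι₀] (φ : ι₀ → W →ₗ[K] K) (v : ι₀ → W)
    (hφ : ∀ i j, φ i (v j) = if i = j then 1 else 0) (C : Set W) (hv : ∀ i, v i ∈ C)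
    (hC : ∀ u, (∀ i, φ i u = 0) → u ∈ Submodule.span K {u | u ∈ C ∧ ∀ i, φ i u = 0}) :
    ∃ (ι : Type) (b : Module.Basis ι K W), (∀ i, b i ∈ C) ∧
      ∃ f : ι₀ → ι, Function.Injective f ∧ ∀ i u, b.coord (f i) u = φ i u := by
  classical
  have hlin : LinearIndependent K v := by
    rw [Fintype.linearIndependent_iff]
    intro g hg i
    have := congrArg (φ i) hg
    simpa [hφ] using this
  have hs : LinearIndepOn K id (Set.range v) := hlin.linearIndepOn_id
  let N : Set W := {u | u ∈ C ∧ ∀ i, φ i u = 0}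
  have hspan : ⊤ ≤ Submodule.span K (Set.range v ∪ N) := by
    intro u _
    have h1 : ∑ i, φ i u • v i ∈ Submodule.span K (Set.range v ∪ N) :=
      Submodule.sum_mem _ fun i _ => Submodule.smul_mem _ _
        (Submodule.subset_span (Or.inl ⟨i, rfl⟩))
    have h2 : u - ∑ i, φ i u • v i ∈ Submodule.span K (Set.range v ∪ N) := by
      refine Submodule.span_mono Set.subset_union_right (hC _ fun i => ?_)
      simp [hφ]
    simpa using Submodule.add_mem _ h1 h2
  let b := Module.Basis.extendLe hs Set.subset_union_left hspan
  have hb : ∀ x, b x = x := Module.Basis.extendLe_apply_self hs Set.subset_union_left hspan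
  have hfin := Module.Finite.finite_basis b
  obtain ⟨n, ⟨ε⟩⟩ := Finite.exists_equiv_fin (hs.extend (Set.subset_union_left (t := N)))
  have hmem : ∀ i, v i ∈ hs.extend (Set.subset_union_left (t := N)) := fun i =>
    hs.subset_extend _ ⟨i, rfl⟩
  refine ⟨Fin n, b.reindex ε, fun i => ?_, fun i => ε ⟨v i, hmem i⟩, fun i j hij => ?_, ?_⟩
  · rw [Module.Basis.reindex_apply, hb]
    rcases hs.extend_subset _ (ε.symm i).2 with ⟨j, hj⟩ | hj
    · rw [← hj]; exact hv j
    · exact hj.1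
  · have := congrArg Subtype.val (ε.injective hij)
    exact hlin.injective this
  · intro i u
    have : (b.reindex ε).coord (ε ⟨v i, hmem i⟩) = φ i := by
      refine b.ext fun x => ?_
      rw [Module.Basis.coord_apply, Module.Basis.repr_reindex_apply, Equiv.symm_apply_apply,
        Module.Basis.repr_self, hb]
      rcases hs.extend_subset _ x.2 with ⟨j, hj⟩ | hj
      · rw [← hj, hφ, Finsupp.single_apply]
        have : x = ⟨v i, hmem i⟩ ↔ i = j := by
          rw [Subtype.ext_iff, ← hj, hlin.injective.eq_iff, eq_comm]
        simp only [this]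
      · rw [hj.2 i, Finsupp.single_apply, if_neg]
        rintro rfl
        have := hj.2 i
        rw [hφ, if_pos rfl] at this
        exact one_ne_zero this
    rw [this]

namespace MatrixBimoduleProblem

variable {k : Type*} [Field k] {𝔄 : MatrixBimoduleProblem k} {T₂ : Set (Fin 𝔄.t)} {z : Fin 𝔄.t}

namespace Over

/-- The number of indices in front of `x` in its block. -/
def offset (𝔇 : Over 𝔄) (x : Fin 𝔇.prob.t) : ℕ :=
  (Finset.univ.filter fun u => 𝔇.blk u = 𝔇.blk x ∧ u < x).card

variable {𝔇 𝔅 𝔖 : Over 𝔄}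

theorem blk_idx (i : Fin 𝔄.t) (a : Fin (𝔇.size i)) : 𝔇.blk (𝔇.idx i a) = i := by
  have := Finset.orderEmbOfFin_mem (Finset.univ.filter fun x => 𝔇.blk x = i) rfl a
  exact (Finset.mem_filter.1 this).2

theorem idx_strictMono (i : Fin 𝔄.t) : StrictMono (𝔇.idx i) :=
  (Finset.orderEmbOfFin (Finset.univ.filter fun x => 𝔇.blk x = i) rfl).strictMono

theorem exists_idx (x : Fin 𝔇.prob.t) : ∃ a, 𝔇.idx (𝔇.blk x) a = x := by
  have := Finset.range_orderEmbOfFin (Finset.univ.filter fun u => 𝔇.blk u = 𝔇.blk x) rfl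
  have hx : x ∈ Set.range (Finset.orderEmbOfFin
      (Finset.univ.filter fun u => 𝔇.blk u = 𝔇.blk x) rfl) := by
    rw [this]; simp
  exact hx

theorem exists_idx_of_blk {i : Fin 𝔄.t} {x : Fin 𝔇.prob.t} (hx : 𝔇.blk x = i) :
    ∃ a, 𝔇.idx i a = x := by
  subst hx
  exact exists_idx x

theorem offset_idx (i : Fin 𝔄.t) (a : Fin (𝔇.size i)) : 𝔇.offset (𝔇.idx i a) = a := by
  have : (Finset.univ.filter fun u => 𝔇.blk u = 𝔇.blk (𝔇.idx i a) ∧ u < 𝔇.idx i a) =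
      (Finset.Iio a).image (𝔇.idx i) := by
    ext u
    simp only [Finset.mem_filter, Finset.mem_univ, true_and, Finset.mem_image, Finset.mem_Iio,
      blk_idx]
    constructor
    · rintro ⟨hu, h⟩
      obtain ⟨c, rfl⟩ := exists_idx_of_blk hu
      exact ⟨c, (idx_strictMono _).lt_iff_lt.1 h, rfl⟩
    · rintro ⟨c, hc, rfl⟩
      exact ⟨blk_idx _ _, idx_strictMono _ hc⟩
  rw [offset, this, Finset.card_image_of_injective _ (idx_strictMono i).injective, Fin.card_Iio]

theorem idx_eq {i : Fin 𝔄.t} {a : Fin (𝔇.size i)} {x : Fin 𝔇.prob.t} (hx : 𝔇.blk x = i)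
    (ha : 𝔇.offset x = a) : 𝔇.idx i a = x := by
  obtain ⟨c, rfl⟩ := exists_idx_of_blk hx
  rw [offset_idx] at ha
  rw [Fin.ext ha]

theorem offset_eq_zero_iff {x : Fin 𝔇.prob.t} : 𝔇.offset x = 0 ↔ 𝔇.IsFirstInBlock x := by
  rw [offset, Finset.card_eq_zero, Finset.filter_eq_empty_iff]
  constructor
  · intro h y hy
    by_contra hc
    exact h (Finset.mem_univ y) ⟨hy, not_le.1 hc⟩
  · intro h y _ hy
    exact absurd (h y hy.1) (not_le.2 hy.2)

/-- Partners have equal offsets, so the relation ρ is just equality of the places in equivalent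
blocks. -/
theorem idx_related {ρ : Fin 𝔇.prob.t → Fin 𝔇.prob.t → Prop} {r' : Setoid (Fin 𝔇.prob.t)}
    (h : IsExpansion 𝔄.vert r' 𝔇.blk ρ) {i j : Fin 𝔄.t} (hij : 𝔄.vert.r i j) (a : Fin (𝔇.size i))
    (b : Fin (𝔇.size j)) (hab : (a : ℕ) = b) : ρ (𝔇.idx i a) (𝔇.idx j b) := by
  obtain ⟨y, hy, hρ⟩ := h.ex (𝔇.idx i a) j (by rw [blk_idx]; exact hij)
  rwa [idx_eq hy]
  rw [← hab, ← offset_idx i a]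
  exact (h.card_lt_eq hρ).symm

/-- Freeness: the entries of the first row are functionals dual to corners of the matrices in
`FrontInv.free`, and C in `exists_basis_of_dual` consists of the matrices that are their own corner.
-/
theorem hasFreeFirstRow {ρ : Fin 𝔇.prob.t → Fin 𝔇.prob.t → Prop}
    (h : Aligned 𝔄 T₂ 𝔇.prob 𝔇.blk ρ) (hF : FrontInv 𝔄 T₂ z 𝔇.prob 𝔇.blk) :
    HasFreeFirstRow z 𝔇 where
  same := by
    classical
    intro U hU q hq a b a' b' ha hb
    have hρa := idx_related h.exp hq a a' ha
    have hρb := idx_related h.exp hq b b' hb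
    obtain ⟨U₀, hU₀, U₁, hU₁, rfl⟩ := Submodule.mem_sup.1 hU
    rw [Matrix.add_apply, Matrix.add_apply, h.K1_same U₁ hU₁ _ _ _ _ hρa hρb
      (by rw [blk_idx, blk_idx]) (by rw [blk_idx, blk_idx])]
    congr 1
    refine Submodule.span_induction (p := fun U _ => U (𝔇.idx q a) (𝔇.idx q b) =
      U (𝔇.idx z a') (𝔇.idx z b')) ?_ rfl ?_ ?_ hU₀
    · rintro _ ⟨x, rfl⟩
      have hab : 𝔇.idx q a = 𝔇.idx q b ↔ 𝔇.idx z a' = 𝔇.idx z b' := by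
        rw [(idx_strictMono _).injective.eq_iff, (idx_strictMono _).injective.eq_iff, Fin.ext_iff,
          Fin.ext_iff, ha, hb]
      have hv := vert_congr_left (m := x) (h.exp.vert _ _ hρa)
      rw [E, Matrix.diagonal_apply, Matrix.diagonal_apply]
      simp only [hab, hv]
    · intro U V _ _ hU hV
      rw [Matrix.add_apply, Matrix.add_apply, hU, hV]
    · intro c U _ hU
      rw [Matrix.smul_apply, Matrix.smul_apply, hU]
  upper := by
    classical
    intro U hU a b hab
    have hlt := idx_strictMono (𝔇 := 𝔇) z hab
    obtain ⟨U₀, hU₀, U₁, hU₁, rfl⟩ := Submodule.mem_sup.1 hU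
    rw [Matrix.add_apply, 𝔇.prob.K1_upper U₁ hU₁ _ _ hlt.le, add_zero]
    refine Submodule.span_induction (p := fun U _ => U (𝔇.idx z a) (𝔇.idx z b) = 0)
      ?_ rfl ?_ ?_ hU₀
    · rintro _ ⟨x, rfl⟩
      rw [E, Matrix.diagonal_apply, if_neg hlt.ne']
    · intro U V _ _ hU hV
      rw [Matrix.add_apply, hU, hV, add_zero]
    · intro c U _ hU
      rw [Matrix.smul_apply, hU, smul_zero]
  free := by
    classical
    obtain ⟨w, hw, hw'⟩ := exists_first_of_surjective h.exp.surj z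
    have hwf : 𝔄.IsFront z 𝔇.blk w := ⟨by rw [hw], fun y hy => hw' y (hy.trans hw)⟩
    have hw0 : ∀ a : Fin (𝔇.size z), (a : ℕ) = 0 → 𝔇.idx z a = w := fun a ha =>
      idx_eq hw (ha ▸ offset_eq_zero_iff.2 hwf.2)
    have hbw : ∀ b : {b : Fin (𝔇.size z) // 0 < (b : ℕ)}, 𝔇.idx z b.1 ≠ w := by
      intro b hc
      have := offset_idx z b.1
      rw [hc, offset_eq_zero_iff.2 hwf.2] at this
      exact absurd b.2 (by omega)
    have hex := fun b : {b : Fin (𝔇.size z) // 0 < (b : ℕ)} =>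
      hF.free w (𝔇.idx z b.1) hwf hw (blk_idx _ _) (hbw b)
    choose V hV hV1 hV0 using hex
    have := exists_basis_of_dual (W := 𝔇.prob.K1) (ι₀ := {b : Fin (𝔇.size z) // 0 < (b : ℕ)})
      (fun b => (Matrix.entryLinearMap k k w (𝔇.idx z b.1)).comp 𝔇.prob.K1.subtype)
      (fun b => ⟨corner 𝔇.prob.vert w (𝔇.idx z b.1) (V b), 𝔇.prob.K1_corner _ (hV b) _ _⟩)
      ?_ {U | ∃ x y, corner 𝔇.prob.vert x y U.1 = U.1} (fun b => ⟨_, _, corner_corner _ _ _ _⟩) ?_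
    · obtain ⟨ι, B, hB, f, hf, hfB⟩ := this
      refine ⟨ι, B, hB, f, hf, fun a b ha U => ?_⟩
      rw [hfB, hw0 a ha]
      rfl
    · intro b c
      show corner 𝔇.prob.vert w (𝔇.idx z c.1) (V c) w (𝔇.idx z b.1) = _
      split_ifs with hbc
      · subst hbc
        simp [corner, hV1]
      · have := hV0 c (𝔇.idx z b.1) (blk_idx _ _) fun hc =>
          hbc (Subtype.ext ((idx_strictMono z).injective hc))
        simp [corner, this]
    -- A matrix with zero first row in this block is the sum of its corners, each of which still has
    -- zero first row there.
    · intro U hU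
      have hU' : U = ∑ c : Quotient 𝔇.prob.vert, ∑ d : Quotient 𝔇.prob.vert,
          (⟨corner 𝔇.prob.vert c.out d.out U.1, 𝔇.prob.K1_corner _ U.2 _ _⟩ : 𝔇.prob.K1) := by
        apply Subtype.ext
        simp only [AddSubmonoidClass.coe_finsetSum]
        exact eq_sum_corner 𝔇.prob.vert U.1
      rw [hU']
      refine Submodule.sum_mem _ fun c _ => Submodule.sum_mem _ fun d _ =>
        Submodule.subset_span ⟨⟨_, _, corner_corner _ _ _ _⟩, fun b => ?_⟩
      have : U.1 w (𝔇.idx z b.1) = 0 := hU b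
      show corner 𝔇.prob.vert c.out d.out U.1 w (𝔇.idx z b.1) = 0
      simp [corner, this]

end Over

end MatrixBimoduleProblem

/-! ### The bordered matrix and the number of vertices -/

open Classical in
theorem card_filter_eq_add_of_injective {m n : ℕ} {e : Fin m → Fin n} (he : Function.Injective e)
    (P : Fin n → Prop) : (Finset.univ.filter P).card =
      (Finset.univ.filter fun x => P (e x)).card +
        (Finset.univ.filter fun w => P w ∧ w ∉ Set.range e).card := by
  have h1 : (Finset.univ.filter fun w => P w ∧ w ∈ Set.range e) =
      (Finset.univ.filter fun x => P (e x)).image e := by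
    ext w
    simp only [Finset.mem_filter, Finset.mem_univ, true_and, Finset.mem_image]
    constructor
    · rintro ⟨h, x, rfl⟩
      exact ⟨x, h, rfl⟩
    · rintro ⟨x, h, rfl⟩
      exact ⟨h, x, rfl⟩
  rw [← Finset.card_image_of_injective _ he, ← h1, ← Finset.filter_filter, ← Finset.filter_filter]
  exact (Finset.card_filter_add_card_filter_not _).symm

namespace MatrixBimoduleProblem

variable {k : Type*} [Field k] {𝔄 : MatrixBimoduleProblem k} {T₂ : Set (Fin 𝔄.t)} {z : Fin 𝔄.t}

namespace Over

variable {𝔇 𝔅 𝔖 : Over 𝔄} {e : Fin 𝔅.prob.t → Fin 𝔖.prob.t}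
  {Q : Fin 𝔅.prob.t × Fin 𝔅.prob.t → Prop} {ρ : Fin 𝔖.prob.t → Fin 𝔖.prob.t → Prop}

theorem isBordered_of_isBorderMap
    (he : IsBorderMap 𝔄 z 𝔅.prob 𝔅.blk 𝔖.prob 𝔖.blk e fun _ => True)
    (hS : Aligned 𝔄 T₂ 𝔖.prob 𝔖.blk ρ) (hF : FrontInv 𝔄 T₂ z 𝔖.prob 𝔖.blk)
    (hbip : 𝔄.IsBipartite T₂) (hz : z ∈ T₂) : IsBordered z 𝔅 𝔖 := by
  refine ⟨e, he.strictMono, he.blk, he.range, he.vert, fun w hw w' => ?_, he.H,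
    fun w hw => hF.H_zero w ((he.range w).1 hw), he.leads, fun w hw y hy hy' x => ?_,
    fun w hw x hm => ?_⟩
  · rw [he.range, hF.cls w ((he.range w).1 hw)]
  · rw [he.leads_front w ((he.range w).1 hw) y hy hy' x, and_true]
  · exact hS.lead_row_not_front hbip hz hm ((he.range w).1 hw)

open Classical in
theorem card_front (hS : Function.Surjective 𝔖.blk) (i : Fin 𝔄.t) :
    (Finset.univ.filter fun w => 𝔖.blk w = i ∧ 𝔄.IsFront z 𝔖.blk w).card =
      if 𝔄.vert.r i z then 1 else 0 := by
  split_ifs with hi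
  · obtain ⟨w, hw, hw'⟩ := exists_first_of_surjective hS i
    rw [Finset.card_eq_one]
    refine ⟨w, ?_⟩
    ext u
    simp only [Finset.mem_filter, Finset.mem_univ, true_and, Finset.mem_singleton]
    constructor
    · rintro ⟨h1, h2⟩
      exact le_antisymm (h2.2 w (hw.trans h1.symm)) (hw' u h1)
    · rintro rfl
      exact ⟨hw, hw ▸ hi, fun y hy => hw' y (hy.trans hw)⟩
  · rw [Finset.card_eq_zero, Finset.filter_eq_empty_iff]
    rintro w - ⟨rfl, h⟩
    exact hi h.1

open Classical in
theorem size_of_isBorderMap (he : IsBorderMap 𝔄 z 𝔅.prob 𝔅.blk 𝔖.prob 𝔖.blk e Q)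
    (hS : Function.Surjective 𝔖.blk) (i : Fin 𝔄.t) :
    𝔖.size i = 𝔅.size i + if 𝔄.vert.r i z then 1 else 0 := by
  rw [← card_front hS i, size, size]
  convert card_filter_eq_add_of_injective he.strictMono.injective (fun w => 𝔖.blk w = i) using 3
  · simp only [he.blk]
  · simp only [he.range]

open Classical in
theorem offset_of_isBorderMap (he : IsBorderMap 𝔄 z 𝔅.prob 𝔅.blk 𝔖.prob 𝔖.blk e Q)
    (hS : Function.Surjective 𝔖.blk) (x : Fin 𝔅.prob.t) :
    𝔖.offset (e x) = 𝔅.offset x + if 𝔄.vert.r (𝔅.blk x) z then 1 else 0 := by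
  rw [← card_front hS (𝔅.blk x), offset, offset]
  convert card_filter_eq_add_of_injective he.strictMono.injective
    (fun u => 𝔖.blk u = 𝔖.blk (e x) ∧ u < e x) using 3
  · simp only [he.blk, he.strictMono.lt_iff_lt]
  · ext w
    simp only [he.range, he.blk, and_assoc, Finset.mem_filter, Finset.mem_univ, true_and]
    refine and_congr_right fun hw => (and_iff_right_of_imp fun hwf => ?_).symm
    refine lt_of_le_of_ne (hwf.2 _ ((he.blk x).trans hw.symm)) ?_
    rintro rfl
    exact (he.range _).2 hwf ⟨x, rfl⟩

theorem idx_of_isBorderMap (he : IsBorderMap 𝔄 z 𝔅.prob 𝔅.blk 𝔖.prob 𝔖.blk e Q)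
    (hS : Function.Surjective 𝔖.blk) {i : Fin 𝔄.t} (hi : ¬ 𝔄.vert.r i z) (a : Fin (𝔖.size i))
    (a' : Fin (𝔅.size i)) (h : (a : ℕ) = a') : 𝔖.idx i a = e (𝔅.idx i a') := by
  refine idx_eq (by rw [he.blk, blk_idx]) ?_
  rw [offset_of_isBorderMap he hS, offset_idx, blk_idx, if_neg hi, h, add_zero]

theorem idx_succ_of_isBorderMap (he : IsBorderMap 𝔄 z 𝔅.prob 𝔅.blk 𝔖.prob 𝔖.blk e Q)
    (hS : Function.Surjective 𝔖.blk) {i : Fin 𝔄.t} (hi : 𝔄.vert.r i z) (a : Fin (𝔖.size i))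
    (a' : Fin (𝔅.size i)) (h : (a : ℕ) = a' + 1) : 𝔖.idx i a = e (𝔅.idx i a') := by
  refine idx_eq (by rw [he.blk, blk_idx]) ?_
  rw [offset_of_isBorderMap he hS, offset_idx, blk_idx, if_pos hi, h]

theorem theta_ent (h0 : 𝔄.H = 0) (l : 𝔄.leads) (a : Fin (𝔇.size l.1.1)) (b : Fin (𝔇.size l.1.2)) :
    (theta 𝔇).ent l a b = 𝔇.prob.H (𝔇.idx l.1.1 a) (𝔇.idx l.1.2 b) := by
  have hab : (a : ℕ) < (theta 𝔇).size l.1.1 ∧ (b : ℕ) < (theta 𝔇).size l.1.2 := ⟨a.2, b.2⟩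
  rw [Rep.ent, dif_pos hab]
  simp [theta, h0]

/-- The border contributes the zero columns, and elsewhere `H` is unchanged. It remains to see that
the blocks combine the base matrices, for which it is enough to look at leading positions. -/
theorem isTheta_of_isBorderMap (he : IsBorderMap 𝔄 z 𝔅.prob 𝔅.blk 𝔖.prob 𝔖.blk e Q)
    (hS : Aligned 𝔄 T₂ 𝔖.prob 𝔖.blk ρ) (hF : FrontInv 𝔄 T₂ z 𝔖.prob 𝔖.blk)
    (hbip : 𝔄.IsBipartite T₂) (hz : z ∈ T₂) : IsTheta 𝔖 ((theta 𝔅).border z) := by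
  classical
  have hsurj := hS.exp.surj
  have hsize := size_of_isBorderMap he hsurj
  refine ⟨hsize, fun i j a b => ?_⟩
  -- For fixed places in the blocks, the entries of `H` at all equivalent blocks form part of one
  -- matrix U of ℳ₁ of 𝔄; its coefficients are its entries at the leads.
  obtain ⟨U, hU, hUH⟩ := hS.H_compat (𝔖.idx i a) (𝔖.idx j b)
  rw [hUH _ _ (hS.exp.refl _) (hS.exp.refl _), blk_idx, blk_idx, M1_repr_apply hU i j, Rep.entry,
    hbip.H, Matrix.zero_apply, ite_self, zero_add]
  refine Finset.sum_congr rfl fun l _ => ?_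
  by_cases hA : 𝔄.A l i j = 0
  · rw [hA, mul_zero, zero_mul]
  rw [mul_comm]
  congr 1
  obtain ⟨hi, hj⟩ := A_vert hA
  have ha : (a : ℕ) < 𝔖.size l.1.1 := a.2.trans_eq (𝔖.card_vert _ _ hi)
  have hb : (b : ℕ) < 𝔖.size l.1.2 := b.2.trans_eq (𝔖.card_vert _ _ hj)
  have hUl := hUH _ _ (idx_related hS.exp (vert_symm hi) ⟨a, ha⟩ a rfl)
    (idx_related hS.exp (vert_symm hj) ⟨b, hb⟩ b rfl)
  rw [blk_idx, blk_idx] at hUl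
  rw [← hUl]
  have hl1 : ¬ 𝔄.vert.r l.1.1 z := fun hc =>
    (hbip.M1 _ (A_mem_M1 l) _ _ (𝔄.A_lead l).1).1 ((hbip.vert _ _ hc).2 hz)
  have ha' : (a : ℕ) < 𝔅.size l.1.1 := by
    have := hsize l.1.1
    rw [if_neg hl1, add_zero] at this
    exact this ▸ ha
  have hab : (a : ℕ) < ((theta 𝔅).border z).size l.1.1 ∧
      (b : ℕ) < ((theta 𝔅).border z).size l.1.2 :=
    ⟨ha.trans_eq (hsize _), hb.trans_eq (hsize _)⟩
  rw [Rep.ent, dif_pos hab]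
  simp only [Rep.border, Matrix.of_apply]
  rw [idx_of_isBorderMap he hsurj hl1 ⟨a, ha⟩ ⟨a, ha'⟩ rfl]
  by_cases hl2 : 𝔄.vert.r l.1.2 z
  · rw [if_pos hl2]
    split_ifs with hb0
    · refine hF.H_zero _ ⟨?_, ?_⟩ _
      · rw [blk_idx]; exact hl2
      · refine offset_eq_zero_iff.1 ?_
        rw [offset_idx]; exact hb0
    · have hb' : (b : ℕ) - 1 < 𝔅.size l.1.2 := by
        have := hsize l.1.2
        rw [if_pos hl2] at this
        omega
      rw [idx_succ_of_isBorderMap he hsurj hl2 ⟨b, hb⟩ ⟨b - 1, hb'⟩ (by simp only; omega), he.H]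
      exact (theta_ent hbip.H l ⟨a, ha'⟩ ⟨b - 1, hb'⟩).symm
  · rw [if_neg hl2]
    have hb' : (b : ℕ) < 𝔅.size l.1.2 := by
      have := hsize l.1.2
      rw [if_neg hl2, add_zero] at this
      exact this ▸ hb
    rw [idx_of_isBorderMap he hsurj hl2 ⟨b, hb⟩ ⟨b, hb'⟩ rfl, he.H]
    exact (theta_ent hbip.H l ⟨a, ha'⟩ ⟨b, hb'⟩).symm

theorem vert_of_card_eq_one (h : Nat.card 𝔇.prob.Vertex = 1) (x y : Fin 𝔇.prob.t) :
    𝔇.prob.vert.r x y := by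
  have := (Nat.card_eq_one_iff_unique.1 h).1
  exact Quotient.exact (Subsingleton.elim (Quotient.mk 𝔇.prob.vert x) (Quotient.mk 𝔇.prob.vert y))

theorem card_vertex_of_isBorderMap (he : IsBorderMap 𝔄 z 𝔅.prob 𝔅.blk 𝔖.prob 𝔖.blk e Q)
    (hB : Function.Surjective 𝔅.blk) (hS : Function.Surjective 𝔖.blk)
    (hF : FrontInv 𝔄 T₂ z 𝔖.prob 𝔖.blk) (h : Nat.card 𝔅.prob.Vertex = 1) :
    Nat.card 𝔖.prob.Vertex = 2 := by
  obtain ⟨w, hw, hw'⟩ := exists_first_of_surjective hS z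
  have hwf : 𝔄.IsFront z 𝔖.blk w := ⟨by rw [hw], fun y hy => hw' y (hy.trans hw)⟩
  obtain ⟨x, -⟩ := hB z
  rw [Nat.card_eq_two_iff]
  refine ⟨Quotient.mk _ w, Quotient.mk _ (e x), fun hc => ?_, Set.eq_univ_of_forall fun c => ?_⟩
  · exact (he.range (e x)).2 ((hF.cls w hwf _).1 (Quotient.exact hc)) ⟨x, rfl⟩
  · induction c using Quotient.inductionOn with
    | h u =>
      by_cases hu : u ∈ Set.range e
      · obtain ⟨y, rfl⟩ := hu
        exact Or.inr (Quotient.sound ((he.vert _ _).2 (vert_of_card_eq_one h y x)))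
      · exact Or.inl (Quotient.sound (vert_symm ((hF.cls w hwf u).2 ((he.range u).1 hu))))

/-- The border vertex would be the only vertex, but it lies over `T₂`, and there are blocks outside
`T₂`. So the sequence has branched by the time the given problem is local. -/
theorem not_frontInv_of_local (hB : Function.Surjective 𝔅.blk)
    (h : Nat.card 𝔅.prob.Vertex = 1) (hbip : 𝔄.IsBipartite T₂) (hz : z ∈ T₂) :
    ¬ FrontInv 𝔄 T₂ z 𝔅.prob 𝔅.blk := by
  intro hF
  obtain ⟨w, hw, hw'⟩ := exists_first_of_surjective hB z
  have hwf : 𝔄.IsFront z 𝔅.blk w := ⟨by rw [hw], fun y hy => hw' y (hy.trans hw)⟩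
  obtain ⟨i, hi⟩ := hbip.nonempty_left
  obtain ⟨u, rfl⟩ := hB i
  exact hi (((hF.cls w hwf u).1 (vert_of_card_eq_one h w u)).mem hbip hz)

end Over

end MatrixBimoduleProblem

/-! ### Problems based on the same term are not reductions of each other -/

namespace MatrixBimoduleProblem

variable {k : Type*} [Field k] {𝔄 : MatrixBimoduleProblem k} {T₂ : Set (Fin 𝔄.t)} {z : Fin 𝔄.t}

theorem IsReduction.card_le [LinearOrder k] {𝔅 𝔅' : MatrixBimoduleProblem k}
    {π : Fin 𝔅'.t → Fin 𝔅.t} (h : IsReduction 𝔅 𝔅' π) : 𝔅.t ≤ 𝔅'.t := by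
  obtain ⟨ρ, hρ⟩ := h.exists_isExpansion
  simpa using Fintype.card_le_of_surjective π hρ.surj

/-- If the number of indices does not grow, the block map is a bijection, and it carries the new
leads injectively into the old ones other than the reduced arrow. -/
theorem IsReduction.card_leads_lt [LinearOrder k] {𝔅 𝔅' : MatrixBimoduleProblem k}
    {π : Fin 𝔅'.t → Fin 𝔅.t} (h : IsReduction 𝔅 𝔅' π) (ht : 𝔅'.t = 𝔅.t) :
    𝔅'.leads.card < 𝔅.leads.card := by
  obtain ⟨ρ, hρ⟩ := h.exists_isExpansion
  obtain ⟨l, hl⟩ := h.mem_leads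
  have hinj : Function.Injective π :=
    ((Fintype.bijective_iff_surjective_and_card π).2 ⟨hρ.surj, by simpa using ht⟩).1
  refine lt_of_le_of_lt (Finset.card_le_card_of_injOn (t := 𝔅.leads.erase l.1)
    (fun m => (π m.1, π m.2)) (fun m hm => ?_) ?_) (Finset.card_erase_lt_of_mem l.2)
  · exact Finset.mem_erase.2 ((hl m).1 hm).symm
  · intro m _ m' _ hmm
    simp only [Prod.mk.injEq] at hmm
    exact Prod.ext (hinj hmm.1) (hinj hmm.2)

namespace Over

variable {𝔅 𝔖 𝔖' : Over 𝔄}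

theorem IsBordered.blk_surjective (h : IsBordered z 𝔅 𝔖) (hB : Function.Surjective 𝔅.blk) :
    Function.Surjective 𝔖.blk := by
  obtain ⟨e, -, h2, -⟩ := h
  intro i
  obtain ⟨x, rfl⟩ := hB i
  exact ⟨e x, h2 x⟩

open Classical in
theorem IsBordered.card_eq (h : IsBordered z 𝔅 𝔖) (hB : Function.Surjective 𝔅.blk) :
    𝔖.prob.t = 𝔅.prob.t + (Finset.univ.filter fun i => 𝔄.vert.r i z).card := by
  have hS := h.blk_surjective hB
  obtain ⟨e, h1, h2, h3, -⟩ := h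
  have := card_filter_eq_add_of_injective h1.injective fun _ => True
  simp only [Finset.filter_true, Finset.card_univ, Fintype.card_fin, true_and] at this
  rw [this]
  congr 1
  refine Finset.card_nbij 𝔖.blk ?_ ?_ ?_
  · intro w hw
    simp only [Finset.coe_filter, Finset.mem_univ, true_and, Set.mem_ofPred_eq] at hw
    simpa using ((h3 w).1 hw).1
  · intro w hw w' hw' hww
    simp only [Finset.coe_filter, Finset.mem_univ, true_and, Set.mem_ofPred_eq] at hw hw'
    exact le_antisymm (((h3 w).1 hw).2 w' hww.symm) (((h3 w').1 hw').2 w hww)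
  · intro i hi
    simp only [Finset.coe_filter, Finset.mem_univ, true_and, Set.mem_ofPred_eq] at hi
    obtain ⟨w, rfl, hw⟩ := exists_first_of_surjective hS i
    refine ⟨w, ?_, rfl⟩
    simpa using (h3 w).2 ⟨hi, hw⟩

-- The number of solid arrows of a bordering depends only on the problem that is bordered, so two
-- borderings of it have equally many.
open Classical in
theorem IsBordered.card_leads (h : IsBordered z 𝔅 𝔖) (hB : Function.Surjective 𝔅.blk) :
    𝔖.prob.leads.card = 𝔅.prob.leads.card +
      (𝔅.prob.leads.filter fun m => 𝔄.vert.r (𝔅.blk m.2) z ∧ 𝔅.IsFirstInBlock m.2).card := by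
  have hS := h.blk_surjective hB
  obtain ⟨e, h1, h2, h3, -, -, -, -, h8, h9, h10⟩ := h
  have hrow : ∀ m ∈ 𝔖.prob.leads, m.1 ∈ Set.range e := fun m hm => by
    by_contra hc
    exact h10 m.1 hc m.2 hm
  choose W hW hW' using exists_first_of_surjective hS
  have hWr : ∀ i, 𝔄.vert.r i z → W i ∉ Set.range e := fun i hi =>
    (h3 _).2 ⟨by rw [hW]; exact hi, fun y hy => hW' i y (hy.trans (hW i))⟩
  rw [← Finset.card_filter_add_card_filter_not (s := 𝔖.prob.leads) (fun m => m.2 ∈ Set.range e)]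
  congr 1
  · symm
    refine Finset.card_nbij (fun m => (e m.1, e m.2)) ?_ ?_ ?_
    · intro m hm
      exact Finset.mem_filter.2 ⟨(h8 m.1 m.2).2 hm, ⟨m.2, rfl⟩⟩
    · intro m _ m' _ hmm
      simp only [Prod.mk.injEq, h1.injective.eq_iff] at hmm
      exact Prod.ext hmm.1 hmm.2
    · rintro ⟨m1, m2⟩ hm
      obtain ⟨hm, y, rfl⟩ := Finset.mem_filter.1 (Finset.mem_coe.1 hm)
      obtain ⟨x, rfl⟩ := hrow _ hm
      exact ⟨(x, y), (h8 x y).1 hm, rfl⟩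
  · symm
    refine Finset.card_nbij (fun m => (e m.1, W (𝔅.blk m.2))) ?_ ?_ ?_
    · intro m hm
      obtain ⟨hm, hv, hf⟩ := Finset.mem_filter.1 hm
      exact Finset.mem_filter.2 ⟨(h9 _ (hWr _ hv) m.2 (hW _).symm hf m.1).2 hm, hWr _ hv⟩
    · intro m hm m' hm' hmm
      obtain ⟨hm, hv, hf⟩ := Finset.mem_filter.1 (Finset.mem_coe.1 hm)
      obtain ⟨hm', hv', hf'⟩ := Finset.mem_filter.1 (Finset.mem_coe.1 hm')
      simp only [Prod.mk.injEq, h1.injective.eq_iff] at hmm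
      have hblk : 𝔅.blk m.2 = 𝔅.blk m'.2 := by rw [← hW (𝔅.blk m.2), hmm.2, hW]
      exact Prod.ext hmm.1 (le_antisymm (hf _ hblk.symm) (hf' _ hblk))
    · rintro ⟨m1, w⟩ hm
      obtain ⟨hm, hw⟩ := Finset.mem_filter.1 (Finset.mem_coe.1 hm)
      obtain ⟨x, rfl⟩ := hrow _ hm
      obtain ⟨y, hy, hy'⟩ := exists_first_of_surjective hB (𝔖.blk w)
      have hy'' : 𝔅.IsFirstInBlock y := fun y' hh => hy' y' (hh.trans hy)
      have hw' := (h3 w).1 hw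
      refine ⟨(x, y), Finset.mem_coe.2 (Finset.mem_filter.2 ⟨(h9 w hw y hy hy'' x).1 hm,
        by rw [hy]; exact hw'.1, hy''⟩), Prod.ext rfl ?_⟩
      simp only [hy]
      exact le_antisymm (hW' _ w rfl) (hw'.2 _ (hW _))

variable [LinearOrder k]

/-- Suppose a problem were reduced to its own bordering. In the latter the former first index of a
block in Z is linked to an index outside `T₂`, so it was linked to one already before. The border
index lies over that first index and would inherit the link, but the border vertex lies over `T₂`.
-/
theorem IsBordered.false_of_red {ρ : Fin 𝔅.prob.t → Fin 𝔅.prob.t → Prop} (h : IsBordered z 𝔅 𝔖)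
    (hr : Red 𝔅 𝔖) (hB : Aligned 𝔄 T₂ 𝔅.prob 𝔅.blk ρ) (hbip : 𝔄.IsBipartite T₂) (hz : z ∈ T₂)
    (hF : FrontInv 𝔄 T₂ z 𝔅.prob 𝔅.blk ∨ FrontInv 𝔄 T₂ z 𝔖.prob 𝔖.blk) : False := by
  obtain ⟨π, hr, hblk⟩ := hr
  have hS := h.blk_surjective hB.exp.surj
  obtain ⟨e, h1, h2, h3, h4, h5, -⟩ := h
  have hnl : ∀ w u, 𝔄.IsFront z 𝔖.blk w → 𝔖.blk u ∉ T₂ → ¬ 𝔖.prob.vert.r w u := by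
    intro w u hw hu hwu
    have := (h3 u).1 ((h5 w ((h3 w).2 hw) u).1 hwu)
    exact hu (IsFront.mem (bS := 𝔖.blk) hbip hz this)
  -- If the invariant is known only before the reduction, the exceptional case would attach the
  -- border vertex to an index outside `T₂`, contrary to the bordering.
  have hFS : FrontInv 𝔄 T₂ z 𝔖.prob 𝔖.blk := by
    rcases hF with hF | hF
    · rw [hblk]
      refine (hF.reduction_or_linked hB hbip hz hr).resolve_right ?_
      rintro ⟨w, u, hw, hu, hwu⟩
      rw [← hblk] at hw
      exact hnl w u hw (by rw [hblk]; exact hu) hwu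
    · exact hF
  obtain ⟨y, hy, hy'⟩ := exists_first_of_surjective hB.exp.surj z
  obtain ⟨w, hw, hw'⟩ := exists_first_of_surjective hS z
  have hwf : 𝔄.IsFront z 𝔖.blk w := ⟨by rw [hw], fun y hy => hw' y (hy.trans hw)⟩
  have hney : ¬ 𝔄.IsFront z 𝔖.blk (e y) := fun hc => (h3 _).2 hc ⟨y, rfl⟩
  obtain ⟨u, hu, hyu⟩ := hFS.linked (e y) (by rw [h2, hy]) hney
  have hur : u ∈ Set.range e := by
    by_contra hc
    exact hu (IsFront.mem (bS := 𝔖.blk) hbip hz ((h3 u).1 hc))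
  obtain ⟨u, rfl⟩ := hur
  rw [h2] at hu
  have hyu' := (h4 y u).1 hyu
  obtain ⟨ρ', hρ⟩ := hr.exists_isExpansion
  -- Both w and y are the first indices of the block z, and π is monotone, onto and compatible with
  -- the blocks.
  have hπw : π w = y := by
    have hb : ∀ x, 𝔖.blk x = 𝔅.blk (π x) := fun x => congrFun hblk x
    refine le_antisymm ?_ (hy' _ ((hb w).symm.trans hw))
    obtain ⟨v, rfl⟩ := hρ.surj y
    exact hρ.mono (hw' v ((hb v).trans hy))
  rw [← hπw] at hyu'
  obtain ⟨v, hv, hwv⟩ := hρ.ex w u hyu'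
  refine hnl w v hwf ?_ (hρ.vert _ _ hwv)
  rw [hblk, Function.comp_apply, hv]
  exact hu

/-- A reduction cannot lower the number of indices, and if it keeps this number it loses arrows.
This excludes all cases except a reduction to the bordering itself, which is
`IsBordered.false_of_red`. -/
theorem not_red_of_based {ρ : Fin 𝔅.prob.t → Fin 𝔅.prob.t → Prop}
    (hB : Aligned 𝔄 T₂ 𝔅.prob 𝔅.blk ρ) (hbip : 𝔄.IsBipartite T₂) (hz : z ∈ T₂)
    (h : 𝔖 = 𝔅 ∨ IsBordered z 𝔅 𝔖) (h' : 𝔖' = 𝔅 ∨ IsBordered z 𝔅 𝔖')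
    (hF : FrontInv 𝔄 T₂ z 𝔖.prob 𝔖.blk ∨ FrontInv 𝔄 T₂ z 𝔖'.prob 𝔖'.blk) : ¬ Red 𝔖 𝔖' := by
  classical
  intro hr
  have hle : 𝔖.prob.t ≤ 𝔖'.prob.t := hr.choose_spec.1.card_le
  have hlt : 𝔖'.prob.t = 𝔖.prob.t → 𝔖'.prob.leads.card < 𝔖.prob.leads.card :=
    hr.choose_spec.1.card_leads_lt
  rcases h with rfl | h <;> rcases h' with rfl | h'
  · exact lt_irrefl _ (hlt rfl)
  · exact h'.false_of_red hr hB hbip hz hF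
  · have := h.card_eq hB.exp.surj
    have hpos : 0 < (Finset.univ.filter fun i => 𝔄.vert.r i z).card :=
      Finset.card_pos.2 ⟨z, by simp⟩
    omega
  · have := hlt (by rw [h.card_eq hB.exp.surj, h'.card_eq hB.exp.surj])
    rw [h.card_leads hB.exp.surj, h'.card_leads hB.exp.surj] at this
    exact lt_irrefl _ this

end Over

end MatrixBimoduleProblem

/-! ### Uniqueness of the parallel sequence -/

namespace MatrixBimoduleProblem

variable {k : Type*} [Field k] {𝔄 : MatrixBimoduleProblem k} {T₂ : Set (Fin 𝔄.t)} {z : Fin 𝔄.t}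

namespace Over

/-- Indices with the same block and the same offset are matched; sizes and matrices agree because
both are given by P. -/
theorem exists_map_of_isTheta {𝔖 𝔖' : Over 𝔄} {P : Rep 𝔄} (h : IsTheta 𝔖 P) (h' : IsTheta 𝔖' P) :
    ∃ σ : Fin 𝔖.prob.t → Fin 𝔖'.prob.t, StrictMono σ ∧ Function.Surjective σ ∧
      (∀ x, 𝔖'.blk (σ x) = 𝔖.blk x) ∧ 𝔖.prob.H = 𝔖'.prob.H.submatrix σ σ := by
  have hsize : ∀ i, 𝔖.size i = 𝔖'.size i := fun i => (h.1 i).trans (h'.1 i).symm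
  have hex : ∀ x, ∃ y, 𝔖'.blk y = 𝔖.blk x ∧ 𝔖'.offset y = 𝔖.offset x := by
    intro x
    obtain ⟨a, ha⟩ := exists_idx x
    refine ⟨𝔖'.idx (𝔖.blk x) (a.cast (hsize _)), blk_idx _ _, ?_⟩
    have := offset_idx (𝔖.blk x) a
    rw [ha] at this
    rw [offset_idx, this]
    rfl
  choose σ hσ hσ' using hex
  have hidx : ∀ i a, σ (𝔖.idx i a) = 𝔖'.idx i (a.cast (hsize i)) := by
    intro i a
    refine (idx_eq ((hσ _).trans (blk_idx _ _)) ?_).symm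
    rw [hσ', offset_idx]
    rfl
  refine ⟨σ, fun x y hxy => ?_, fun y => ?_, hσ, ?_⟩
  · rcases (𝔖.blk_mono hxy.le).lt_or_eq with hb | hb
    · rw [← hσ, ← hσ] at hb
      by_contra hc
      exact absurd (𝔖'.blk_mono (not_lt.1 hc)) (not_le.2 hb)
    · obtain ⟨i, hi⟩ : ∃ i, 𝔖.blk y = i := ⟨_, rfl⟩
      obtain ⟨a, rfl⟩ := exists_idx_of_blk (hb.trans hi)
      obtain ⟨b, rfl⟩ := exists_idx_of_blk hi
      rw [hidx, hidx]
      have hab : a < b := (idx_strictMono _).lt_iff_lt.1 hxy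
      exact idx_strictMono _ hab
  · obtain ⟨i, hi⟩ : ∃ i, 𝔖'.blk y = i := ⟨_, rfl⟩
    obtain ⟨a, rfl⟩ := exists_idx_of_blk hi
    exact ⟨𝔖.idx i (a.cast (hsize i).symm), hidx _ _⟩
  · ext x y
    obtain ⟨a, ha⟩ := exists_idx x
    obtain ⟨b, hb⟩ := exists_idx y
    rw [Matrix.submatrix_apply, ← ha, ← hb, hidx, hidx, h.2, h'.2]
    rfl

variable [LinearOrder k] {n : ℕ} {Hn : Matrix (Fin n) (Fin n) k}

/-- `𝔇'` is obtained from `𝔇` by a reduction that is compatible with maps from `Fin n`. -/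
def RedAlong (𝔇 𝔇' : Over 𝔄) (σ : Fin n → Fin 𝔇.prob.t) (σ' : Fin n → Fin 𝔇'.prob.t) : Prop :=
  ∃ π : Fin 𝔇'.prob.t → Fin 𝔇.prob.t, IsReduction 𝔇.prob 𝔇'.prob π ∧ 𝔇'.blk = 𝔇.blk ∘ π ∧
    σ = π ∘ σ'

theorem RedAlong.red {𝔇 𝔇' : Over 𝔄} {σ : Fin n → Fin 𝔇.prob.t} {σ' : Fin n → Fin 𝔇'.prob.t}
    (h : RedAlong 𝔇 𝔇' σ σ') : Red 𝔇 𝔇' :=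
  let ⟨π, h1, h2, _⟩ := h
  ⟨π, h1, h2⟩

theorem RedAlong.unique {𝔇 𝔇₁ 𝔇₂ : Over 𝔄} {σ : Fin n → Fin 𝔇.prob.t}
    {σ₁ : Fin n → Fin 𝔇₁.prob.t} {σ₂ : Fin n → Fin 𝔇₂.prob.t} (h₁ : RedAlong 𝔇 𝔇₁ σ σ₁)
    (h₂ : RedAlong 𝔇 𝔇₂ σ σ₂) (R₁ : Reach Hn 𝔇₁.prob σ₁) (R₂ : Reach Hn 𝔇₂.prob σ₂) :
    (⟨𝔇₁, σ₁⟩ : (𝔇 : Over 𝔄) × (Fin n → Fin 𝔇.prob.t)) = ⟨𝔇₂, σ₂⟩ := by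
  obtain ⟨π₁, h₁, b₁, rfl⟩ := h₁
  obtain ⟨π₂, h₂, b₂, hσ⟩ := h₂
  obtain ⟨f, hf, hπ, hfσ⟩ := h₁.isIso_of_reach h₂ R₁ R₂ (congrFun hσ)
  have hb : ∀ u, 𝔇₂.blk (f u) = 𝔇₁.blk u := fun u => by
    rw [b₁, b₂, Function.comp_apply, Function.comp_apply, hπ]
  obtain ⟨p₁, blk₁, m₁, c₁⟩ := 𝔇₁
  obtain ⟨p₂, blk₂, m₂, c₂⟩ := 𝔇₂
  obtain ⟨he, hcast⟩ := hf.eq_cast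
  change p₁ = p₂ at he
  subst he
  have hf' : ∀ x, f x = x := hcast
  obtain rfl : blk₁ = blk₂ := funext fun u => by
    have := hb u
    rw [hf'] at this
    exact this.symm
  obtain rfl : σ₁ = σ₂ := funext fun x => by
    have := hfσ x
    rw [hf'] at this
    exact this
  rfl

/-- One or two reductions compatible with maps from `Fin n`. -/
def StepAlong (𝔇 𝔇' : Over 𝔄) (σ : Fin n → Fin 𝔇.prob.t)
    (σ' : Fin n → Fin 𝔇'.prob.t) : Prop :=
  RedAlong 𝔇 𝔇' σ σ' ∨ ∃ (𝔐 : Over 𝔄) (τ : Fin n → Fin 𝔐.prob.t),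
    RedAlong 𝔇 𝔐 σ τ ∧ RedAlong 𝔐 𝔇' τ σ'

theorem RedAlong.reach {𝔇 𝔇' : Over 𝔄} {σ : Fin n → Fin 𝔇.prob.t} {σ' : Fin n → Fin 𝔇'.prob.t}
    (h : RedAlong 𝔇 𝔇' σ σ') (R : Reach Hn 𝔇'.prob σ') : Reach Hn 𝔇.prob σ := by
  obtain ⟨π, h1, -, rfl⟩ := h
  exact R.step h1

theorem RedAlong.blk_eq {𝔇 𝔇' : Over 𝔄} {σ : Fin n → Fin 𝔇.prob.t} {σ' : Fin n → Fin 𝔇'.prob.t}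
    (h : RedAlong 𝔇 𝔇' σ σ') : 𝔇.blk ∘ σ = 𝔇'.blk ∘ σ' := by
  obtain ⟨π, -, h2, rfl⟩ := h
  rw [h2]
  rfl

theorem StepAlong.reach {𝔇 𝔇' : Over 𝔄} {σ : Fin n → Fin 𝔇.prob.t} {σ' : Fin n → Fin 𝔇'.prob.t}
    (h : StepAlong 𝔇 𝔇' σ σ') (R : Reach Hn 𝔇'.prob σ') : Reach Hn 𝔇.prob σ := by
  rcases h with h | ⟨𝔐, τ, h, h'⟩
  · exact h.reach R
  · exact h.reach (h'.reach R)

theorem StepAlong.blk_eq {𝔇 𝔇' : Over 𝔄} {σ : Fin n → Fin 𝔇.prob.t} {σ' : Fin n → Fin 𝔇'.prob.t}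
    (h : StepAlong 𝔇 𝔇' σ σ') : 𝔇.blk ∘ σ = 𝔇'.blk ∘ σ' := by
  rcases h with h | ⟨𝔐, τ, h, h'⟩
  · exact h.blk_eq
  · exact h.blk_eq.trans h'.blk_eq

/-- Single reductions along the same map are unique. If one step is single and the other double, the
single one is the first half of the double one, and so one result reduces to the other, against `n₁`
or `n₂`. -/
theorem StepAlong.unique {𝔇 𝔇₁ 𝔇₂ : Over 𝔄} {σ : Fin n → Fin 𝔇.prob.t}
    {σ₁ : Fin n → Fin 𝔇₁.prob.t} {σ₂ : Fin n → Fin 𝔇₂.prob.t} (h₁ : StepAlong 𝔇 𝔇₁ σ σ₁)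
    (h₂ : StepAlong 𝔇 𝔇₂ σ σ₂) (R₁ : Reach Hn 𝔇₁.prob σ₁) (R₂ : Reach Hn 𝔇₂.prob σ₂)
    (n₁ : ¬ Red 𝔇₁ 𝔇₂) (n₂ : ¬ Red 𝔇₂ 𝔇₁) :
    (⟨𝔇₁, σ₁⟩ : (𝔇 : Over 𝔄) × (Fin n → Fin 𝔇.prob.t)) = ⟨𝔇₂, σ₂⟩ := by
  rcases h₁ with h₁ | ⟨𝔐₁, τ₁, h₁, h₁'⟩ <;> rcases h₂ with h₂ | ⟨𝔐₂, τ₂, h₂, h₂'⟩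
  · exact h₁.unique h₂ R₁ R₂
  · cases h₁.unique h₂ R₁ (h₂'.reach R₂)
    exact absurd h₂'.red n₁
  · cases h₁.unique h₂ (h₁'.reach R₁) R₂
    exact absurd h₁'.red n₂
  · cases h₁.unique h₂ (h₁'.reach R₁) (h₂'.reach R₂)
    exact h₁'.unique h₂' R₁ R₂

theorem exists_stepAlong {𝔇 𝔇' : Over 𝔄} (h : Red 𝔇 𝔇' ∨ ∃ 𝔐, Red 𝔇 𝔐 ∧ Red 𝔐 𝔇') :
    ∃ π : Fin 𝔇'.prob.t → Fin 𝔇.prob.t, ∀ σ' : Fin n → Fin 𝔇'.prob.t,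
      StepAlong 𝔇 𝔇' (π ∘ σ') σ' := by
  rcases h with ⟨π, h, hb⟩ | ⟨𝔐, ⟨π, h, hb⟩, π', h', hb'⟩
  · exact ⟨π, fun σ' => Or.inl ⟨π, h, hb, rfl⟩⟩
  · exact ⟨π ∘ π', fun σ' => Or.inr ⟨𝔐, π' ∘ σ', ⟨π, h, hb, rfl⟩, ⟨π', h', hb', rfl⟩⟩⟩

/-- The map onto the last problem is composed backwards with the block maps of the steps. Comparing
the problems together with these maps makes the final matrix accessible at every term. -/
theorem exists_maps {s : ℕ} {𝔖 : Fin (s + 1) → Over 𝔄}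
    (hstep : ∀ i : Fin s, Red (𝔖 i.castSucc) (𝔖 i.succ) ∨
      ∃ 𝔇, Red (𝔖 i.castSucc) 𝔇 ∧ Red 𝔇 (𝔖 i.succ))
    (σ₀ : Fin n → Fin (𝔖 (Fin.last s)).prob.t) (hR : Reach Hn (𝔖 (Fin.last s)).prob σ₀) :
    ∃ σ : ∀ i, Fin n → Fin (𝔖 i).prob.t,
      (∀ i : Fin s, StepAlong (𝔖 i.castSucc) (𝔖 i.succ) (σ i.castSucc) (σ i.succ)) ∧
      (∀ i, Reach Hn (𝔖 i).prob (σ i)) ∧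
      ∀ i, (𝔖 i).blk ∘ σ i = (𝔖 (Fin.last s)).blk ∘ σ₀ := by
  choose π hπ using fun i => exists_stepAlong (n := n) (hstep i)
  let σ : ∀ i, Fin n → Fin (𝔖 i).prob.t := fun i =>
    Fin.reverseInduction (motive := fun i => Fin n → Fin (𝔖 i).prob.t) σ₀ (fun i f => π i ∘ f) i
  have hlast : σ (Fin.last s) = σ₀ := Fin.reverseInduction_last ..
  have hcast : ∀ i : Fin s, σ i.castSucc = π i ∘ σ i.succ := fun i =>
    Fin.reverseInduction_castSucc ..
  have hs : ∀ i : Fin s, StepAlong (𝔖 i.castSucc) (𝔖 i.succ) (σ i.castSucc) (σ i.succ) := by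
    intro i
    rw [hcast]
    exact hπ i _
  refine ⟨σ, hs, fun i => ?_, fun i => ?_⟩
  · induction i using Fin.reverseInduction with
    | last => rw [hlast]; exact hR
    | cast i ih => exact (hs i).reach ih
  · induction i using Fin.reverseInduction with
    | last => rw [hlast]
    | cast i ih => exact (hs i).blk_eq.trans ih

/-- Both sequences end in the same partitioned matrix, so both are driven by one `Hn`. By induction
the pairs of a problem and the map onto it agree; the equality of the maps is needed to compare the
labels in the next step. -/
theorem IsParallel.unique {s : ℕ} {B 𝔖 𝔖' : Fin (s + 1) → Over 𝔄} (hbip : 𝔄.IsBipartite T₂)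
    (hz : z ∈ T₂) (h : IsParallel z B 𝔖) (h' : IsParallel z B 𝔖')
    (hinv : ∀ i, ParallelInv T₂ z (B i) (𝔖 i)) : 𝔖' = 𝔖 := by
  obtain ⟨σ₀, m₀, s₀, b₀, H₀⟩ := exists_map_of_isTheta h.theta h'.theta
  obtain ⟨σ, hσ, hR, hb⟩ := exists_maps h.step id
    (Reach.refl _ id strictMono_id Function.surjective_id rfl)
  obtain ⟨σ', hσ', hR', hb'⟩ := exists_maps h'.step σ₀ (Reach.refl _ σ₀ m₀ s₀ H₀)
  have hbb : (𝔖' (Fin.last s)).blk ∘ σ₀ = (𝔖 (Fin.last s)).blk ∘ id := funext b₀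
  have key : ∀ i, (⟨𝔖 i, σ i⟩ : (𝔇 : Over 𝔄) × (Fin _ → Fin 𝔇.prob.t)) = ⟨𝔖' i, σ' i⟩ := by
    intro i
    induction i using Fin.induction with
    -- Over the base problem the block map is the identity, so the map is the block map of the final
    -- problem in both cases.
    | zero =>
      have e1 := hb 0
      have e2 := (hb' 0).trans hbb
      revert e1 e2
      generalize σ 0 = f
      generalize σ' 0 = f'
      revert f f'
      rw [h.zero, h'.zero]
      intro f f' e1 e2
      rw [show f = f' from e1.trans e2.symm]
    | succ i ih =>
      have e1 := hσ i
      have e2 := hσ' i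
      revert e1 e2
      generalize σ i.castSucc = f at ih
      generalize σ' i.castSucc = f' at ih
      generalize 𝔖 i.castSucc = D at f ih
      generalize 𝔖' i.castSucc = D' at f' ih
      cases ih
      intro e1 e2
      obtain ⟨⟨ρ, hB⟩, -, hF, -⟩ := hinv i.succ
      refine e1.unique e2 (hR _) (hR' _) ?_ ?_
      · exact not_red_of_based hB hbip hz (h.based _) (h'.based _) (Or.inl hF)
      · exact not_red_of_based hB hbip hz (h'.based _) (h.based _) (Or.inr hF)
  funext i
  exact (congrArg Sigma.fst (key i)).symm

end Over

end MatrixBimoduleProblem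

theorem theorem5p2p1 {k : Type*} [Field k] [IsAlgClosed k] [LinearOrder k]
    (𝔄 : MatrixBimoduleProblem k) (T₂ : Set (Fin 𝔄.t)) (hbip : 𝔄.IsBipartite T₂)
    (hrdcc : 𝔄.IsRDCC) (z : Fin 𝔄.t) (hz : z ∈ T₂)
    (s : ℕ) (B : Fin (s + 1) → 𝔄.Over)
    (hB0 : B 0 = MatrixBimoduleProblem.Over.base 𝔄)
    (hB : ∀ i : Fin s, (B i.castSucc).Red (B i.succ))
    (hlocal : Nat.card (B (Fin.last s)).prob.Vertex = 1) :
    (∃! 𝔖 : Fin (s + 1) → 𝔄.Over, MatrixBimoduleProblem.Over.IsParallel z B 𝔖) ∧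
      ∀ 𝔖 : Fin (s + 1) → 𝔄.Over, MatrixBimoduleProblem.Over.IsParallel z B 𝔖 →
        Nat.card (𝔖 (Fin.last s)).prob.Vertex = 2 ∧
        ∀ i, (𝔖 i).HasFreeFirstRow z := by
  obtain ⟨𝔖, h0, hstep, hinv⟩ :=
    MatrixBimoduleProblem.Over.exists_parallelInv hbip hz hB0 hB
  obtain ⟨⟨ρB, hBl⟩, ⟨ρS, hSl⟩, hF, hc⟩ := hinv (Fin.last s)
  -- At the local end the parallel problem satisfies the border invariant and the given one cannot,
  -- so the two differ.
  have hborder := hc.resolve_left fun hc => by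
    rw [hc] at hF
    exact MatrixBimoduleProblem.Over.not_frontInv_of_local hBl.exp.surj hlocal hbip hz hF
  obtain ⟨e, he⟩ := hborder
  have hpar : MatrixBimoduleProblem.Over.IsParallel z B 𝔖 := by
    refine ⟨h0, hstep, fun i => ?_, ?_⟩
    · obtain ⟨-, ⟨ρ, hS⟩, hF, hc⟩ := hinv i
      exact hc.imp_right fun ⟨e, he⟩ =>
        MatrixBimoduleProblem.Over.isBordered_of_isBorderMap he hS hF hbip hz
    · exact MatrixBimoduleProblem.Over.isTheta_of_isBorderMap he hSl hF hbip hz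
  have huniq : ∀ 𝔖', MatrixBimoduleProblem.Over.IsParallel z B 𝔖' → 𝔖' = 𝔖 := fun 𝔖' h' =>
    hpar.unique hbip hz h' hinv
  refine ⟨⟨𝔖, hpar, huniq⟩, fun 𝔖' h' => ?_⟩
  rw [huniq 𝔖' h']
  refine ⟨MatrixBimoduleProblem.Over.card_vertex_of_isBorderMap he hBl.exp.surj hSl.exp.surj hF
    hlocal, fun i => ?_⟩
  obtain ⟨-, ⟨ρ, hS⟩, hF, -⟩ := hinv i
  exact MatrixBimoduleProblem.Over.hasFreeFirstRow hS hF
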